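/- Let $(\hat M,\hat g)$ be a spacetime of dimension $n+1$ which is asymptotically flat at time-like or space-like infinity, with boundary $\mathcal I$ and boundary defining function $\rho$. Near $\mathcal I$ use the coordinates $(\rho,y^\alpha)$, where the coordinates $y^\alpha$ of $\mathcal I$ are extended to be constant along $N^a=\rho^{-2}g^{ab}\nabla_b\rho$, with $g^{ab}=\rho^{-2}\hat g^{ab}$; the compactified spacetime $M$ is thus a neighbourhood of $\{0\}\times\mathcal I$ in $[0,\infty)\times\mathcal I$, and $\hat g$ has no $d\rho\,dy^\alpha$ terms. At the boundary, $\rho^4\hat g_{\rho\rho}\to\nu_0^{-1}$ with $\nu_0$ a non-zero constant, and $\rho^2\hat g_{\alpha\beta}\to h_{\alpha\beta}$, where either $\nu_0<0$ and $h$ is Riemannian (time-like infinity), or $\nu_0>0$ and $h$ is Lorentzian (space-like infinity). The extended boundary ($\mathrm{Ti}$, respectively $\mathrm{Spi}$) is the line bundle over $\mathcal I$ whose points over $y$ are the $2$-jets $j^2_y\rho+u\,j^2_y\rho^2$, $u\in\mathbb R$, of functions on $M$. It carries the action of $\mathbb R$ by $j\mapsto j+\alpha\,j^2_y\rho^2$,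 generated by a vector field $n^a$, and the pullback $h_{ab}$ of $h$. An asymptotic symmetry with data $(\omega,\chi)$ is a vector field $\xi$ on $M$, smooth up to the boundary, with $$\xi^\rho=-\rho^2\omega(y)+o(\rho^2),\qquad \xi^\alpha=\chi^\alpha(y)+\rho\,\nu_0^{-1}\partial^\alpha\omega(y)+o(\rho),$$ where $\omega\in C^\infty(\mathcal I)$, the index is raised with $h$, and $\chi$ is a Killing field of $h$. Proposition. 1. The pairs $(u,y)\in\mathbb R\times\mathcal I$ are global coordinates on the extended boundary; $\mathbb R$ acts by $(u,y)\mapsto(u+\alpha,y)$, so that $n^a=\partial_u$. 2. Let $\xi$ be an asymptotic symmetry with data $(\omega,\chi)$. It has local flows $\Phi_t$ on $M$ around every boundary point, and for every local flow the action on $2$-jets, $j^2_xf\mapsto j^2_{\Phi_t(x)}(f\circ\Phi_{-t})$, maps points of the extended boundary to points of the extended boundary. The induced local flow there is generated by the vector field $$\bar\xi=\omega(y)\,\partial_u+\chi^\alpha(y)\,\partial_\alpha,$$ and by no other vector field. 3. The asymptotic symmetries form a Lie algebra, and $\xi\mapsto\bar\xi$ is a homomorphism of Lie algebras. 4. A smooth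 vector field $X$ on the extended boundary satisfies $\mathcal L_Xh_{ab}=0$ and $\mathcal L_Xn^a=0$ if and only if $X=\omega(y)\partial_u+\chi^\alpha(y)\partial_\alpha$ with $\omega\in C^\infty(\mathcal I)$ and $\chi$ a Killing field of $h$. 5. Consequently the vector fields $\bar\xi$ induced by asymptotic symmetries are exactly the infinitesimal automorphisms of the weak Carrollian structure $(h_{ab},n^a)$. -/

import Mathlib

open Set Filter Topology Asymptotics Bundle
open scoped Manifold ContDiff

/-! ### Tensor calculus on manifolds -/

section General

variable {E : Type*} [NormedAddCommGroup E] [NormedSpace ℝ E]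
  {H : Type*} [TopologicalSpace H] (I : ModelWithCorners ℝ E H)
  {M : Type*} [TopologicalSpace M] [ChartedSpace H M] [IsManifold I ∞ M]

/-- `X` is a smooth vector field at every point of `s` (up to the boundary, if `s` has one). -/
def SmoothFieldOn (X : Π x : M, TangentSpace I x) (s : Set M) : Prop :=
  ContMDiffOn I I.tangent ∞ (fun x ↦ (⟨x, X x⟩ : TangentBundle I M)) s

/-- A covariant tensor field of rank two. -/
abbrev TensorField02 (M : Type*) [TopologicalSpace M] [ChartedSpace H M] :=
  Π x : M, TangentSpace I x →L[ℝ] TangentSpace I x →L[ℝ] ℝ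

/-- The components of a covariant tensor field of rank two, without bundled bilinearity. -/
abbrev PreTensor02 (M : Type*) [TopologicalSpace M] [ChartedSpace H M] :=
  Π x : M, TangentSpace I x → TangentSpace I x → ℝ

/-- `g` is smooth at every point of `s`, as a section of the bundle of bilinear forms. -/
def SmoothTensorOn (g : TensorField02 I M) (s : Set M) : Prop :=
  ContMDiffOn I (I.prod 𝓘(ℝ, E →L[ℝ] E →L[ℝ] ℝ)) ∞
    (fun x ↦ TotalSpace.mk' (E →L[ℝ] E →L[ℝ] ℝ)
      (E := fun x : M ↦ TangentSpace I x →L[ℝ] TangentSpace I x →L[ℝ] ℝ) x (g x)) s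

/-- The value of the Lie derivative of `g` along `X`,
`(L_X g)(Y, Z) = X (g(Y, Z)) - g([X, Y], Z) - g(Y, [X, Z])`. -/
noncomputable def lieDerivTensor (g : PreTensor02 I M) (X Y Z : Π x : M, TangentSpace I x)
    (x : M) : ℝ :=
  (show ℝ from mfderiv I 𝓘(ℝ, ℝ) (fun x' ↦ g x' (Y x') (Z x')) x (X x))
    - g x (VectorField.mlieBracket I X Y x) (Z x)
    - g x (Y x) (VectorField.mlieBracket I X Z x)

/-- `L_X g = 0`, tested on all local smooth vector fields `Y`, `Z`. -/
def PreservesTensor (g : PreTensor02 I M) (X : Π x : M, TangentSpace I x) : Prop :=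
  ∀ (x : M) (Y Z : Π x : M, TangentSpace I x),
    (∀ᶠ x' in 𝓝 x, ContMDiffAt I I.tangent ∞ (fun z ↦ (⟨z, Y z⟩ : TangentBundle I M)) x') →
    (∀ᶠ x' in 𝓝 x, ContMDiffAt I I.tangent ∞ (fun z ↦ (⟨z, Z z⟩ : TangentBundle I M)) x') →
    lieDerivTensor I g X Y Z x = 0

/-- `X` is a smooth vector field with `L_X g = 0`. -/
def IsKilling (g : TensorField02 I M) (X : Π x : M, TangentSpace I x) : Prop :=
  SmoothFieldOn I X univ ∧ PreservesTensor I (fun x v w ↦ g x v w) X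

/-- `G` is the gradient `∂^α f` of `f`, the index being raised with `g`. -/
def IsGradient (g : TensorField02 I M) (f : M → ℝ) (G : Π x : M, TangentSpace I x) : Prop :=
  ∀ (x : M) (v : TangentSpace I x), g x (G x) v = (mfderiv I 𝓘(ℝ, ℝ) f x v : ℝ)

end General

/-- A bilinear form is symmetric of signature `(+, …, +)`. -/
def IsEuclideanForm {V : Type*} [AddCommGroup V] [Module ℝ V] [TopologicalSpace V]
    (b : V →L[ℝ] V →L[ℝ] ℝ) : Prop :=
  (∀ v w, b v w = b w v) ∧ ∀ v, v ≠ 0 → 0 < b v v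

/-- A bilinear form is symmetric of signature `(-, +, …, +)`. -/
def IsLorentzianForm {V : Type*} [AddCommGroup V] [Module ℝ V] [TopologicalSpace V]
    (b : V →L[ℝ] V →L[ℝ] ℝ) : Prop :=
  (∀ v w, b v w = b w v) ∧
    ∃ t, b t t < 0 ∧ ∀ v, b t v = 0 → v ≠ 0 → 0 < b v v

/-! ### The product of a line with an `n`-manifold

A neighbourhood of the boundary in the compactified spacetime sits in `ℝ × B`, with coordinates
`(ρ, y)`; the extended boundary is parametrised by `ℝ × B`, with coordinates `(u, y)`. -/

section Line

variable {n : ℕ} {B : Type*} [TopologicalSpace B] [ChartedSpace (EuclideanSpace ℝ (Fin n)) B]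

/-- The model of the manifold `ℝ × B`. -/
noncomputable abbrev lineModel (n : ℕ) : ModelWithCorners ℝ (ℝ × EuclideanSpace ℝ (Fin n))
    (ModelProd ℝ (EuclideanSpace ℝ (Fin n))) :=
  𝓘(ℝ, ℝ).prod (𝓡 n)

/-- The tangent vector `a ∂ + v` of `ℝ × B`, where `∂` is the coordinate vector of the line. -/
noncomputable def lineVec {p : ℝ × B} (a : ℝ) (v : TangentSpace (𝓡 n) p.2) : TangentSpace (lineModel n) p :=
  ((a, v) : ℝ × EuclideanSpace ℝ (Fin n))

/-- The component of a tangent vector of `ℝ × B` along the line. -/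
noncomputable def lineComp {p : ℝ × B} (V : TangentSpace (lineModel n) p) : ℝ :=
  (show ℝ × EuclideanSpace ℝ (Fin n) from V).1

/-- The component of a tangent vector of `ℝ × B` along `B`. -/
noncomputable def baseComp {p : ℝ × B} (V : TangentSpace (lineModel n) p) : TangentSpace (𝓡 n) p.2 :=
  (show ℝ × EuclideanSpace ℝ (Fin n) from V).2

/-- The components `(v^α)` of a tangent vector `v` at `y` in the chart of `B` centred at `y₀`. -/
noncomputable def chartComp (y₀ y : B) (v : TangentSpace (𝓡 n) y) : EuclideanSpace ℝ (Fin n) :=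
  mfderiv (𝓡 n) 𝓘(ℝ, EuclideanSpace ℝ (Fin n)) (extChartAt (𝓡 n) y₀) y v

/-- The vector field `w(y) ∂_u + χ^α(y) ∂_α` on `ℝ × B`. -/
noncomputable def verticalLift (w : B → ℝ) (χ : Π y : B, TangentSpace (𝓡 n) y) :
    Π p : ℝ × B, TangentSpace (lineModel n) p :=
  fun p ↦ lineVec (w p.2) (χ p.2)

end Line

/-! ### Asymptotically flat spacetimes -/

/-- Which boundary is considered: past or future time-like infinity, or space-like infinity. -/
inductive InfinityKind
  | timelike
  | spacelike

/-- A spacetime which is asymptotically flat at time-like or space-like infinity, near its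
boundary `B`, in the coordinates `(ρ, y)` given by the boundary defining function `ρ` and the
integral curves of `N^a = ρ⁻² g^{ab} ∇_b ρ`.  The manifold with boundary is
a neighbourhood `dom` of `{0} × B` in `[0, ∞) × B`; its interior carries the physical metric
`metric`, with `ρ⁴ metric(∂_ρ, ∂_ρ) → ν₀⁻¹` and `ρ² metric(Y, Z) → h(Y, Z)` at the boundary.
Neither the Einstein equations nor their consequence that `h` is locally the metric of hyperbolic
or de Sitter space are imposed. -/
structure AsymptoticallyFlat (kind : InfinityKind) (n : ℕ) (B : Type*) [TopologicalSpace B]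
    [ChartedSpace (EuclideanSpace ℝ (Fin n)) B] [IsManifold (𝓡 n) ∞ B] where
  /-- the manifold with boundary -/
  dom : Set (ℝ × B)
  dom_eq : ∃ O : Set (ℝ × B), IsOpen O ∧ dom = O ∩ {p | 0 ≤ p.1}
  boundary_mem : ∀ y : B, ((0 : ℝ), y) ∈ dom
  /-- the physical metric, which matters at points of `dom` with `0 < ρ` only -/
  metric : TensorField02 (lineModel n) (ℝ × B)
  metric_smooth : SmoothTensorOn (lineModel n) metric (dom ∩ {p | 0 < p.1})
  metric_lorentzian : ∀ p ∈ dom, 0 < p.1 → IsLorentzianForm (metric p)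
  /-- the curves of constant `y` are the integral curves of `N` -/
  metric_normal : ∀ p ∈ dom, 0 < p.1 → ∀ v : TangentSpace (𝓡 n) p.2,
    metric p (lineVec 1 0) (lineVec 0 v) = 0
  /-- the boundary value of `ν` -/
  ν₀ : ℝ
  /-- the boundary metric -/
  h : TensorField02 (𝓡 n) B
  h_smooth : SmoothTensorOn (𝓡 n) h univ
  ν₀_sign : match kind with
    | .timelike => ν₀ < 0
    | .spacelike => 0 < ν₀
  h_signature : match kind with
    | .timelike => ∀ y, IsEuclideanForm (h y)
    | .spacelike => ∀ y, IsLorentzianForm (h y)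
  tendsto_ν : ∀ y : B, Tendsto (fun p : ℝ × B ↦ p.1 ^ 4 * metric p (lineVec 1 0) (lineVec 1 0))
    (𝓝[dom ∩ {p | 0 < p.1}] (0, y)) (𝓝 ν₀⁻¹)
  tendsto_h : ∀ (y : B) (Y Z : Π y : B, TangentSpace (𝓡 n) y),
    SmoothFieldOn (𝓡 n) Y univ → SmoothFieldOn (𝓡 n) Z univ →
    Tendsto (fun p : ℝ × B ↦ p.1 ^ 2 * metric p (lineVec 0 (Y p.2)) (lineVec 0 (Z p.2)))
      (𝓝[dom ∩ {p | 0 < p.1}] (0, y)) (𝓝 (h y (Y y) (Z y)))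

namespace AsymptoticallyFlat

variable {kind : InfinityKind} {n : ℕ} {B : Type*} [TopologicalSpace B]
  [ChartedSpace (EuclideanSpace ℝ (Fin n)) B] [IsManifold (𝓡 n) ∞ B]
  (S : AsymptoticallyFlat kind n B)

/-! #### Two-jets and the extended boundary -/

/-- `f` and `g` agree to second order at `p` within the spacetime: in a chart, their difference is
`o(|q - p|²)`.  For `C²` functions this says that `f` and `g` have the same value and the same
first and second partial derivatives at `p`. -/
def SameTwoJet (p : ℝ × B) (f g : ℝ × B → ℝ) : Prop :=
  (fun q ↦ f q - g q) =o[𝓝[S.dom] p]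
    fun q ↦ ‖extChartAt (lineModel n) p q - extChartAt (lineModel n) p p‖ ^ 2

/-- The functions which are smooth near `p`, up to the boundary. -/
noncomputable def smoothAt (p : ℝ × B) : Submodule ℝ (ℝ × B → ℝ) where
  carrier := {f | ContMDiffWithinAt (lineModel n) 𝓘(ℝ, ℝ) ∞ f S.dom p}
  add_mem' hf hg := ContMDiffWithinAt.add hf hg
  zero_mem' := contMDiffWithinAt_const
  smul_mem' c f hf := by
    have hc : ContMDiffWithinAt (lineModel n) 𝓘(ℝ, ℝ) ∞ (fun _ : ℝ × B ↦ c) S.dom p :=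
      contMDiffWithinAt_const
    exact hc.smul hf

/-- The functions with vanishing two-jet at `p`. -/
noncomputable def jetZero (p : ℝ × B) : Submodule ℝ (S.smoothAt p) where
  carrier := {f | S.SameTwoJet p f 0}
  add_mem' {f g} hf hg := by
    have := IsLittleO.add hf hg
    simpa [SameTwoJet] using this
  zero_mem' := by simp [SameTwoJet]
  smul_mem' c f hf := by
    have := IsLittleO.const_mul_left hf c
    simpa [SameTwoJet] using this

/-- The fibre at `p` of the bundle of two-jets of real functions on the spacetime. -/
abbrev TwoJet (p : ℝ × B) : Type _ := S.smoothAt p ⧸ S.jetZero p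

/-- The two-jet at `p` of a function. -/
noncomputable def jet (p : ℝ × B) (f : S.smoothAt p) : S.TwoJet p := (S.jetZero p).mkQ f

/-- The boundary defining function `ρ`. -/
noncomputable def rho (p : ℝ × B) : S.smoothAt p := ⟨fun q ↦ q.1, contMDiffWithinAt_fst⟩

/-- The square `ρ²` of the boundary defining function. -/
noncomputable def rhoSq (p : ℝ × B) : S.smoothAt p :=
  ⟨fun q ↦ q.1 ^ 2, ContMDiffWithinAt.pow contMDiffWithinAt_fst 2⟩

/-- The line in the space of two-jets at the boundary point `y` generated by `j²ρ²`. -/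
noncomputable def lineRhoSq (y : B) : Submodule ℝ (S.TwoJet (0, y)) :=
  Submodule.span ℝ {S.jet (0, y) (S.rhoSq (0, y))}

/-- The section `φ` of the quotient bundle `J²/j²ρ²` over the boundary defined by `ρ`. -/
noncomputable def phi (y : B) : S.TwoJet (0, y) ⧸ S.lineRhoSq y :=
  (S.lineRhoSq y).mkQ (S.jet (0, y) (S.rho (0, y)))

/-- The extended boundary Ti or Spi: the pullback along `φ` of the line bundle
`J² → J²/j²ρ²` over the boundary. -/
def ExtendedBoundary : Type _ :=
  Σ y : B, {j : S.TwoJet (0, y) // (S.lineRhoSq y).mkQ j = S.phi y}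

/-- The action of `α : ℝ` on the extended boundary, `j ↦ j + α j²ρ²`. -/
noncomputable def translate (α : ℝ) (s : S.ExtendedBoundary) : S.ExtendedBoundary :=
  ⟨s.1, s.2.1 + α • S.jet (0, s.1) (S.rhoSq (0, s.1)), by
    have h0 : (S.lineRhoSq s.1).mkQ (S.jet (0, s.1) (S.rhoSq (0, s.1))) = 0 := by
      rw [Submodule.mkQ_apply, Submodule.Quotient.mk_eq_zero]
      exact Submodule.mem_span_singleton_self _
    rw [map_add, map_smul, h0, smul_zero, add_zero]
    exact s.2.2⟩

/-- The point of the extended boundary with coordinates `(u, y)`: the two-jet of `ρ + u ρ²`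
at the boundary point `y`. -/
noncomputable def point (c : ℝ × B) : S.ExtendedBoundary :=
  S.translate c.1 ⟨c.2, S.jet (0, c.2) (S.rho (0, c.2)), rfl⟩

/-! #### The weak Carrollian structure, in the coordinates `(u, y)` of the extended boundary -/

/-- The vector field `n^a = ∂_u` generating the action of `ℝ`. -/
noncomputable def carrollVector : Π p : ℝ × B, TangentSpace (lineModel n) p := fun _ ↦ lineVec 1 0

/-- The degenerate metric `h_ab`: the pullback of the boundary metric along `(u, y) ↦ y`. -/
noncomputable def carrollMetric : PreTensor02 (lineModel n) (ℝ × B) := fun p V W ↦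
  S.h p.2 (mfderiv (lineModel n) (𝓡 n) Prod.snd p V) (mfderiv (lineModel n) (𝓡 n) Prod.snd p W)

/-- Infinitesimal automorphisms of the weak Carrollian structure:
smooth vector fields with `L_X h_ab = 0` and `L_X n^a = 0`. -/
def IsCarrollAutomorphism (X : Π p : ℝ × B, TangentSpace (lineModel n) p) : Prop :=
  SmoothFieldOn (lineModel n) X univ ∧ PreservesTensor (lineModel n) S.carrollMetric X ∧
    ∀ p, VectorField.mlieBracket (lineModel n) X (carrollVector (n := n) (B := B)) p = 0

/-! #### Asymptotic symmetries -/

/-- `ξ` is an asymptotic symmetry with data `(w, χ)`: a smooth vector field on the spacetime, up to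
the boundary, with `ξ^ρ = -ρ² w(y) + o(ρ²)` and `ξ^α = χ^α(y) + ρ ν₀⁻¹ ∂^α w(y) + o(ρ)`,
where `w` is a smooth function and `χ` a Killing field of `h`. -/
def IsAsymptoticSymmetry (ξ : Π p : ℝ × B, TangentSpace (lineModel n) p) (w : B → ℝ)
    (χ : Π y : B, TangentSpace (𝓡 n) y) : Prop :=
  SmoothFieldOn (lineModel n) ξ S.dom ∧ ContMDiff (𝓡 n) 𝓘(ℝ, ℝ) ∞ w ∧ IsKilling (𝓡 n) S.h χ ∧
  (∀ y₀ : B, (fun p : ℝ × B ↦ lineComp (ξ p) - (-(p.1 ^ 2 * w p.2)))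
    =o[𝓝[S.dom] (0, y₀)] fun p ↦ p.1 ^ 2) ∧
  ∃ G : Π y : B, TangentSpace (𝓡 n) y, IsGradient (𝓡 n) S.h w G ∧
    ∀ y₀ : B, (fun p : ℝ × B ↦
      chartComp y₀ p.2 (baseComp (ξ p) - (χ p.2 + (p.1 * S.ν₀⁻¹) • G p.2)))
        =o[𝓝[S.dom] (0, y₀)] fun p ↦ p.1

/-- `Φ` is a local flow of `ξ` on the spacetime, with domain `D` (relatively open, and consisting
of intervals of times around `0`).  Such a flow is unique on its domain, and it is smooth whenever
`ξ` is, so that only continuity is asked for. -/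
structure IsLocalFlow (ξ : Π p : ℝ × B, TangentSpace (lineModel n) p)
    (Φ : ℝ → ℝ × B → ℝ × B) (D : Set (ℝ × (ℝ × B))) : Prop where
  isOpen : ∃ O : Set (ℝ × (ℝ × B)), IsOpen O ∧ D = O ∩ {z | z.2 ∈ S.dom}
  interval : ∀ t p, (t, p) ∈ D → ∀ s ∈ uIcc 0 t, (s, p) ∈ D
  mapsTo : ∀ t p, (t, p) ∈ D → Φ t p ∈ S.dom
  zero : ∀ p, ((0 : ℝ), p) ∈ D → Φ 0 p = p
  continuousOn : ContinuousOn (fun z : ℝ × (ℝ × B) ↦ Φ z.1 z.2) D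
  integralCurve : ∀ p, IsMIntegralCurveOn (fun t ↦ Φ t p) ξ {t | (t, p) ∈ D}

/-- The two-jet `j'` at `p'` is the image of the two-jet `j` at `p` under a local diffeomorphism
with inverse `Ψ`, mapping `p` to `p'`: if `j = j²f` then `j' = j²(f ∘ Ψ)`. -/
def IsJetImage (Ψ : ℝ × B → ℝ × B) {p p' : ℝ × B} (j : S.TwoJet p) (j' : S.TwoJet p') : Prop :=
  Ψ p' = p ∧ ∀ (f : S.smoothAt p) (f' : S.smoothAt p'), S.jet p f = j → S.jet p' f' = j' →
    S.SameTwoJet p' (f'.1) (f.1 ∘ Ψ)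

/-- The action of `ξ` on two-jets, `j²f at x ↦ j²(f ∘ Φ_{-t}) at Φ_t(x)` for the local flow `Φ` of
`ξ`, restricts to the extended boundary and is generated there by the vector field `X`: local flows
exist around all boundary points, they preserve the boundary, they map the points of the extended
boundary to points of the extended boundary, and the curves described by the latter are, in the
coordinates `(u, y)`, integral curves of `X`. -/
def Induces (ξ X : Π p : ℝ × B, TangentSpace (lineModel n) p) : Prop :=
  (∀ y : B, ∃ Φ D, S.IsLocalFlow ξ Φ D ∧ ((0 : ℝ), ((0 : ℝ), y)) ∈ D) ∧
  ∀ Φ D, S.IsLocalFlow ξ Φ D → ∀ u y, ((0 : ℝ), ((0 : ℝ), y)) ∈ D →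
    ∃ c : ℝ → ℝ × B, c 0 = (u, y) ∧
      (∀ t, (t, ((0 : ℝ), y)) ∈ D → (-t, Φ t (0, y)) ∈ D →
        Φ t (0, y) = (0, (c t).2) ∧
        S.IsJetImage (Φ (-t)) (S.point (u, y)).2.1 (S.point (c t)).2.1) ∧
      IsMIntegralCurveOn c X {t | (t, ((0 : ℝ), y)) ∈ D ∧ (-t, Φ t (0, y)) ∈ D}

/-- The algebra of asymptotic symmetries. -/
def asymptoticSymmetries : Set (Π p : ℝ × B, TangentSpace (lineModel n) p) :=
  {ξ | ∃ w χ, S.IsAsymptoticSymmetry ξ w χ}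

end AsymptoticallyFlat

set_option linter.unusedSectionVars false

/-! ### Two-jets -/

namespace AsymptoticallyFlat

section Jets

variable {kind : InfinityKind} {n : ℕ} {B : Type*} [TopologicalSpace B]
  [ChartedSpace (EuclideanSpace ℝ (Fin n)) B] [IsManifold (𝓡 n) ∞ B]
  (S : AsymptoticallyFlat kind n B)

/-! The coefficient `u` of a two-jet `j²ρ + u j²ρ²` is seen by restriction to the half-line over the
boundary point, where `ρ²` is not `o(ρ²)`. So `j²ρ²` is non-zero, and the fibre of the extended
boundary is an affine line on which `ℝ` acts by translation (`point_bijective`, `translate_point`).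

Near the boundary, the flow `Φ` of an asymptotic symmetry satisfies `dρ/dt = -ρ² w + O(ρ³)`.
Gronwall's inequality shows that the boundary is preserved, and integration gives `ρ ∘ Φ_s = ρ - ρ²
∫₀ˢ w(Φ_σ p) dσ` up to `O(ρ² |q - p|)`, which is invisible in the two-jet at the boundary point `p`
(`IsLocalFlow.expandsAt`). Only Lipschitz dependence on initial values is needed, not smoothness of
the flow. Replacing `s` by `-t` at the point `Φ_t p`, one finds that `j²(ρ + uρ²)` moves to `j²(ρ +
(u + ∫₀ᵗ w)ρ²)`, while the base point follows `χ`. The velocity is `w ∂_u + χ`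
(`IsAsymptoticSymmetry.induces`). Jets determine `u`, so the moving point, and with it its velocity,
is unique (`eq_of_induces`).

For the Lie algebra, the conditions `o(ρ²)` and `o(ρ)` have to survive differentiation. For a
function smooth up to the boundary, a little-o along rays means that normal derivatives vanish on
the boundary (`flatAt_of_isLittleO_ray`). That property passes to tangential derivatives and gives
back a big-O with one more power of `ρ` (`FlatAt.dTan`, `FlatAt.isBigO`). The bracket then has
leading terms `-ρ²(χ₁w₂ - χ₂w₁)` and `[χ₁, χ₂] + ρ ν₀⁻¹([χ₁, ∂w₂] - [χ₂, ∂w₁])`. Since Killing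
fields commute with raising indices, the last parenthesis is the gradient of `χ₁w₂ - χ₂w₁`
(`IsGradient.mlieBracket`). The same pair of data appears in the bracket of the vertical lifts
(`verticalLift_mlieBracket`).

For the Carrollian side, `[X, ∂_u] = 0` says that `X` does not depend on `u`, so `X = w ∂_u + χ`;
the Lie derivative of the pulled back metric along it is the pullback of `L_χ h`
(`isCarrollAutomorphism_iff`). The two algebras agree because every pair `(w, χ)` is realised by the
field `χ + ρ ν₀⁻¹ ∂w - ρ² w ∂_ρ` (`exists_isAsymptoticSymmetry`). -/

lemma extChartAt_line (p q : ℝ × B) :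
    extChartAt (lineModel n) p q = (q.1, extChartAt (𝓡 n) p.2 q.2) := by
  rw [extChartAt_prod]; simp [chartAt_self_eq]

variable {S}

lemma SameTwoJet.symm {p : ℝ × B} {f g : ℝ × B → ℝ} (h : S.SameTwoJet p f g) :
    S.SameTwoJet p g f := by
  have := IsLittleO.neg_left h
  simpa [SameTwoJet] using this

lemma SameTwoJet.trans {p : ℝ × B} {f g k : ℝ × B → ℝ} (h : S.SameTwoJet p f g)
    (h' : S.SameTwoJet p g k) : S.SameTwoJet p f k := by
  have := IsLittleO.add h h'
  simpa [SameTwoJet] using this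

variable (S)

lemma jet_eq_iff {p : ℝ × B} (f g : S.smoothAt p) :
    S.jet p f = S.jet p g ↔ S.SameTwoJet p f.1 g.1 := by
  rw [jet, jet, Submodule.mkQ_apply, Submodule.mkQ_apply, Submodule.Quotient.eq]
  change S.SameTwoJet p (f - g : S.smoothAt p).1 0 ↔ _
  simp [SameTwoJet]

/-- The half-line over a boundary point approaches that point within the spacetime. -/
lemma tendsto_ray (y : B) :
    Tendsto (fun r : ℝ ↦ (r, y)) (𝓝[>] 0) (𝓝[S.dom] ((0 : ℝ), y)) := by
  obtain ⟨O, hO, hdom⟩ := S.dom_eq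
  have hy := S.boundary_mem y
  have hc : Tendsto (fun r : ℝ ↦ (r, y)) (𝓝 0) (𝓝 ((0 : ℝ), y)) :=
    (Continuous.prodMk_left y).tendsto 0
  refine tendsto_nhdsWithin_iff.2 ⟨hc.mono_left nhdsWithin_le_nhds, ?_⟩
  have h1 : ∀ᶠ r : ℝ in 𝓝[>] 0, (r, y) ∈ O :=
    nhdsWithin_le_nhds (hc (hO.mem_nhds (by rw [hdom] at hy; exact hy.1)))
  filter_upwards [h1, self_mem_nhdsWithin] with r hr hr0
  rw [hdom]
  exact ⟨hr, (show (0 : ℝ) < r from hr0).le⟩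

/-- On the half-line over `y` the chart displacement has norm exactly `ρ`, so the hypothesis becomes
`a ρ² = o(ρ²)`. The open half-line is used because there `ρ²` does not vanish. This is the
non-vanishing of `j²ρ²`, which makes `u` a coordinate. -/
lemma sameTwoJet_smul_rhoSq {y : B} {a : ℝ}
    (h : S.SameTwoJet (0, y) (fun q ↦ a * q.1 ^ 2) 0) : a = 0 := by
  have h1 := IsLittleO.comp_tendsto h (S.tendsto_ray y)
  have h2 : (fun r : ℝ ↦ a * r ^ 2) =o[𝓝[>] 0] fun r : ℝ ↦ r ^ 2 := by
    refine (h1.congr' (by simp [Function.comp_def]) ?_)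
    simp only [Function.comp_def, extChartAt_line]
    simp [Prod.norm_def]
  by_contra ha
  have h3 : (fun r : ℝ ↦ r ^ 2) =o[𝓝[>] (0 : ℝ)] fun r : ℝ ↦ r ^ 2 := by
    have := h2.const_mul_left a⁻¹
    simpa [ha] using this
  have h4 := (isLittleO_irrefl' (f' := fun r : ℝ ↦ r ^ 2) (l := 𝓝[>] (0 : ℝ)) ?_) h3
  · exact h4
  · refine Eventually.frequently ?_
    filter_upwards [self_mem_nhdsWithin] with r hr
    have h0 : 0 < r := hr
    exact norm_ne_zero_iff.2 (pow_ne_zero 2 h0.ne')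

/-- The function `ρ + u ρ²`. -/
noncomputable def rhoQuad (u : ℝ) (p : ℝ × B) : S.smoothAt p := S.rho p + u • S.rhoSq p

lemma rhoQuad_apply (u : ℝ) (p q : ℝ × B) : (S.rhoQuad u p).1 q = q.1 + u * q.1 ^ 2 := rfl

lemma point_snd (c : ℝ × B) : (S.point c).2.1 = S.jet (0, c.2) (S.rhoQuad c.1 (0, c.2)) := by
  simp [point, translate, rhoQuad, jet]

lemma jet_rhoQuad_injective {y : B} {u v : ℝ}
    (h : S.SameTwoJet (0, y) (S.rhoQuad u (0, y)).1 (S.rhoQuad v (0, y)).1) : u = v := by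
  have : u - v = 0 := by
    refine S.sameTwoJet_smul_rhoSq (y := y) ?_
    refine IsLittleO.congr_left h fun q ↦ ?_
    simp only [rhoQuad_apply, Pi.zero_apply]; ring
  linarith

lemma translate_point (α u : ℝ) (y : B) : S.translate α (S.point (u, y)) = S.point (u + α, y) := by
  refine Sigma.ext rfl (heq_of_eq (Subtype.ext ?_))
  have h (v : ℝ) : (show S.TwoJet (0, y) from (S.point (v, y)).2.1) =
    S.jet (0, y) (S.rhoQuad v (0, y)) := S.point_snd (v, y)
  refine (congrArg (· + α • S.jet (0, y) (S.rhoSq (0, y))) (h u)).trans (Eq.trans ?_ (h _).symm)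
  simp [rhoQuad, jet, add_smul, add_assoc]

/-- Injectivity is the non-vanishing of `j²ρ²`. For surjectivity, a jet over `y` lying above `φ`
differs from `j²ρ` by an element of the line spanned by `j²ρ²`, and its coefficient is `u`. -/
lemma point_bijective : Function.Bijective S.point := by
  constructor
  · rintro ⟨u, y⟩ ⟨v, z⟩ h
    have hy : y = z := congrArg Sigma.fst h
    subst hy
    have h2 : (S.point (u, y)).2 = (S.point (v, y)).2 := eq_of_heq (Sigma.ext_iff.1 h).2
    have h3 := congrArg Subtype.val h2
    rw [point_snd, point_snd] at h3
    exact Prod.ext (S.jet_rhoQuad_injective ((S.jet_eq_iff _ _).1 h3)) rfl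
  · rintro ⟨y, j, hj⟩
    have : j - S.jet (0, y) (S.rho (0, y)) ∈ S.lineRhoSq y := by
      rw [phi, Submodule.mkQ_apply, Submodule.mkQ_apply, Submodule.Quotient.eq] at hj
      exact hj
    obtain ⟨u, hu⟩ := Submodule.mem_span_singleton.1 this
    refine ⟨(u, y), Sigma.ext rfl (heq_of_eq (Subtype.ext ?_))⟩
    rw [point_snd]
    simp only [rhoQuad, jet, map_add, map_smul] at hu ⊢
    rw [hu, add_sub_cancel]

/-- Two two-jets of the form `ρ + u ρ²` at the same point which are images of the same two-jet
coincide. -/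
lemma IsJetImage.unique {Ψ : ℝ × B → ℝ × B} {p : ℝ × B} {j : S.TwoJet p} {y : B} {u v : ℝ}
    (h₁ : S.IsJetImage Ψ j (S.point (u, y)).2.1) (h₂ : S.IsJetImage Ψ j (S.point (v, y)).2.1) :
    u = v := by
  obtain ⟨f, rfl⟩ := Submodule.mkQ_surjective _ j
  have a := h₁.2 f _ rfl (S.point_snd (u, y)).symm
  have b := h₂.2 f _ rfl (S.point_snd (v, y)).symm
  exact S.jet_rhoQuad_injective (a.trans b.symm)

end Jets

end AsymptoticallyFlat

/-! ### Vector fields in charts -/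

section Charts

variable {E : Type*} [NormedAddCommGroup E] [NormedSpace ℝ E]
  {H : Type*} [TopologicalSpace H] {I : ModelWithCorners ℝ E H}
  {M : Type*} [TopologicalSpace M] [ChartedSpace H M]

/-- The components of a vector field in the chart centred at `x₀`. -/
noncomputable def chartRep (I : ModelWithCorners ℝ E H) (x₀ : M) (X : Π x : M, TangentSpace I x)
    (z : E) : E :=
  mfderiv I 𝓘(ℝ, E) (extChartAt I x₀) ((extChartAt I x₀).symm z) (X ((extChartAt I x₀).symm z))

lemma chartRep_add (x₀ : M) (X Y : Π x : M, TangentSpace I x) (z : E) :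
    chartRep I x₀ (X + Y) z = chartRep I x₀ X z + chartRep I x₀ Y z :=
  map_add _ _ _

lemma chartRep_smul (x₀ : M) (c : ℝ) (X : Π x : M, TangentSpace I x) (z : E) :
    chartRep I x₀ (c • X) z = c • chartRep I x₀ X z :=
  map_smul _ _ _

variable [IsManifold I ∞ M]

lemma chartRep_extChartAt {x₀ p : M} (hp : p ∈ (extChartAt I x₀).source)
    (X : Π x : M, TangentSpace I x) :
    chartRep I x₀ X (extChartAt I x₀ p) = mfderiv I 𝓘(ℝ, E) (extChartAt I x₀) p (X p) := by
  -- The two vectors live in fibres over points that are only propositionally equal; generalising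
  -- over `q = p` allows substitution. The same device recurs below wherever a chart is composed
  -- with its inverse.
  have key : ∀ q, q = p → (show E from mfderiv I 𝓘(ℝ, E) (extChartAt I x₀) q (X q)) =
      mfderiv I 𝓘(ℝ, E) (extChartAt I x₀) p (X p) := by
    rintro q rfl; rfl
  exact key _ ((extChartAt I x₀).left_inv hp)

/-- The derivative of a preferred chart at its own centre is the identity of the model space, so
there a vector coincides with its components. -/
lemma chartRep_self [IsManifold I 1 M] (x₀ : M) (X : Π x : M, TangentSpace I x) :
    chartRep I x₀ X (extChartAt I x₀ x₀) = X x₀ := by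
  rw [chartRep_extChartAt (mem_extChartAt_source x₀), mfderiv_extChartAt_self]; rfl

lemma isInvertible_mfderiv_chart {x₀ p : M} (hp : p ∈ (extChartAt I x₀).source) :
    (mfderiv I 𝓘(ℝ, E) (extChartAt I x₀) p).IsInvertible :=
  haveI : IsManifold I 1 M := .of_le (n := ∞) (by simp)
  isInvertible_mfderiv_extChartAt hp

/-- The trivialization of the tangent bundle at `x₀` is, fibrewise, the derivative of the chart, so
the fibre component of the section read in that chart is `chartRep`. -/
lemma contMDiffWithinAt_iff_chartRep [I.Boundaryless] {x₀ p : M} {s : Set M} (hp : p ∈ (extChartAt I x₀).source)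
    {X : Π x : M, TangentSpace I x} :
    ContMDiffWithinAt I I.tangent ∞ (fun x ↦ (⟨x, X x⟩ : TangentBundle I M)) s p ↔
      ContDiffWithinAt ℝ ∞ (chartRep I x₀ X) ((extChartAt I x₀).symm ⁻¹' s)
        (extChartAt I x₀ p) := by
  have hp' : p ∈ (chartAt H x₀).source := by rwa [extChartAt_source] at hp
  have : IsManifold I 1 M := .of_le (n := ∞) (by simp)
  have hb : p ∈ (trivializationAt E (TangentSpace I) x₀).baseSet := by simpa using hp'
  refine (Trivialization.contMDiffWithinAt_section (IB := I) (F := E) (n := ∞)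
    (E := (TangentSpace I : M → Type _)) s hb).trans ?_
  rw [contMDiffWithinAt_iff_source_of_mem_source (x := x₀) hp', contMDiffWithinAt_iff_contDiffWithinAt,
    I.range_eq_univ, inter_univ]
  have key : ∀ z ∈ (extChartAt I x₀).target,
      chartRep I x₀ X z = ((fun x ↦ (trivializationAt E (TangentSpace I) x₀ ⟨x, X x⟩).2) ∘
        (extChartAt I x₀).symm) z := by
    intro z hz
    have hz' : (extChartAt I x₀).symm z ∈ (chartAt H x₀).source := by
      rw [← extChartAt_source I]; exact (extChartAt I x₀).map_target hz
    have h1 := TangentBundle.continuousLinearMapAt_trivializationAt (I := I) hz'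
    have h2 := DFunLike.congr_fun h1 (X ((extChartAt I x₀).symm z))
    refine h2.symm.trans ?_
    rw [Trivialization.continuousLinearMapAt_apply, Trivialization.coe_linearMapAt_of_mem _ (by simpa using hz')]
    rfl
  have hz := (isOpen_extChartAt_target (I := I) x₀).mem_nhds ((extChartAt I x₀).map_source hp)
  refine ⟨fun h ↦ ContDiffWithinAt.congr_of_eventuallyEq h ?_ (key _ (mem_of_mem_nhds hz)),
    fun h ↦ ContDiffWithinAt.congr_of_eventuallyEq h ?_ (key _ (mem_of_mem_nhds hz)).symm⟩
  all_goals
    filter_upwards [mem_nhdsWithin_of_mem_nhds hz] with z hz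
  exacts [key z hz, (key z hz).symm]

lemma smoothFieldOn_univ_iff {X : Π x : M, TangentSpace I x} :
    SmoothFieldOn I X univ ↔
      ContMDiff I I.tangent ∞ (fun x ↦ (⟨x, X x⟩ : TangentBundle I M)) :=
  contMDiffOn_univ

lemma contMDiffAt_iff_chartRep [I.Boundaryless] {x₀ p : M} (hp : p ∈ (extChartAt I x₀).source)
    {X : Π x : M, TangentSpace I x} :
    ContMDiffAt I I.tangent ∞ (fun x ↦ (⟨x, X x⟩ : TangentBundle I M)) p ↔
      ContDiffAt ℝ ∞ (chartRep I x₀ X) (extChartAt I x₀ p) := by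
  rw [← contMDiffWithinAt_univ, contMDiffWithinAt_iff_chartRep hp, preimage_univ,
    contDiffWithinAt_univ]

/-- On the target, the derivatives of the chart and of its inverse are inverse to each other. In the
form of a pullback, components inherit the naturality of the Lie bracket. -/
lemma chartRep_eq_mpullback [I.Boundaryless] {x₀ : M} {z : E} (hz : z ∈ (extChartAt I x₀).target)
    (X : Π x : M, TangentSpace I x) :
    chartRep I x₀ X z = VectorField.mpullback 𝓘(ℝ, E) I (extChartAt I x₀).symm X z := by
  have : IsManifold I 1 M := .of_le (n := ∞) (by simp)
  have h1 := mfderiv_extChartAt_comp_mfderivWithin_extChartAt_symm (I := I) hz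
  have h2 := mfderivWithin_extChartAt_symm_comp_mfderiv_extChartAt (I := I) hz
  rw [I.range_eq_univ, mfderivWithin_univ] at h1 h2
  rw [VectorField.mpullback_apply, ContinuousLinearMap.inverse_eq h2 h1]
  rfl

/-- Naturality of the bracket under pullback by the inverse chart. The set `s` is general in order
to cover a domain with boundary; the target of the chart is a neighbourhood and drops out. -/
lemma chartRep_mlieBracketWithin [I.Boundaryless] [CompleteSpace E] {x₀ p : M} {s : Set M}
    (hs : UniqueMDiffOn I s) (hp : p ∈ (extChartAt I x₀).source) (hps : p ∈ s)
    {X Y : Π x : M, TangentSpace I x}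
    (hX : ContMDiffWithinAt I I.tangent ∞ (fun x ↦ (⟨x, X x⟩ : TangentBundle I M)) s p)
    (hY : ContMDiffWithinAt I I.tangent ∞ (fun x ↦ (⟨x, Y x⟩ : TangentBundle I M)) s p) :
    chartRep I x₀ (VectorField.mlieBracketWithin I X Y s) (extChartAt I x₀ p) =
      VectorField.lieBracketWithin ℝ (chartRep I x₀ X) (chartRep I x₀ Y)
        ((extChartAt I x₀).symm ⁻¹' s) (extChartAt I x₀ p) := by
  have : IsManifold I 1 M := .of_le (n := ∞) (by simp)
  have : IsManifold I (minSmoothness ℝ 2) M :=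
    .of_le (n := ∞) (by rw [minSmoothness_of_isRCLikeNormedField]; exact WithTop.coe_le_coe.2 le_top)
  have hz := (extChartAt I x₀).map_source hp
  have ht := (isOpen_extChartAt_target (I := I) x₀).mem_nhds hz
  have hinv := (extChartAt I x₀).left_inv hp
  have hsm : ContMDiffAt 𝓘(ℝ, E) I 2 (extChartAt I x₀).symm (extChartAt I x₀ p) := by
    have := contMDiffWithinAt_extChartAt_symm_range (I := I) (n := 2) x₀ hz
    rwa [I.range_eq_univ, contMDiffWithinAt_univ] at this
  rw [chartRep_eq_mpullback hz]
  have hX' := hX.mdifferentiableWithinAt (by simp)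
  have hY' := hY.mdifferentiableWithinAt (by simp)
  rw [← hinv] at hX' hY'
  have hmem : extChartAt I x₀ p ∈ (extChartAt I x₀).target ∩ (extChartAt I x₀).symm ⁻¹' s :=
    ⟨hz, by rwa [mem_preimage, hinv]⟩
  rw [VectorField.mpullback_mlieBracketWithin (n := 2) hX' hY' (hs.uniqueMDiffOn_target_inter x₀) hsm
    hmem minSmoothness_of_isRCLikeNormedField.le (mem_of_superset self_mem_nhdsWithin inter_subset_right),
    VectorField.mlieBracketWithin_eq_lieBracketWithin, inter_comm]
  refine (VectorField.lieBracketWithin_inter ht).trans ?_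
  refine Filter.EventuallyEq.lieBracketWithin_vectorField_eq_of_mem ?_ ?_ hmem.2
  all_goals
    filter_upwards [mem_nhdsWithin_of_mem_nhds ht] with z hz
    exact (chartRep_eq_mpullback hz _).symm

lemma chartRep_mlieBracket [I.Boundaryless] [CompleteSpace E] {x₀ p : M}
    (hp : p ∈ (extChartAt I x₀).source) {X Y : Π x : M, TangentSpace I x}
    (hX : ContMDiffAt I I.tangent ∞ (fun x ↦ (⟨x, X x⟩ : TangentBundle I M)) p)
    (hY : ContMDiffAt I I.tangent ∞ (fun x ↦ (⟨x, Y x⟩ : TangentBundle I M)) p) :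
    chartRep I x₀ (VectorField.mlieBracket I X Y) (extChartAt I x₀ p) =
      VectorField.lieBracket ℝ (chartRep I x₀ X) (chartRep I x₀ Y) (extChartAt I x₀ p) := by
  have := chartRep_mlieBracketWithin (uniqueMDiffOn_univ) hp (mem_univ p)
    (contMDiffWithinAt_univ.2 hX) (contMDiffWithinAt_univ.2 hY)
  rwa [preimage_univ, VectorField.lieBracketWithin_univ, VectorField.mlieBracketWithin_univ] at this

lemma mfderiv_apply_chart [I.Boundaryless] {F : Type*} [NormedAddCommGroup F] [NormedSpace ℝ F]
    {x₀ p : M} (hp : p ∈ (extChartAt I x₀).source) {f : M → F}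
    (hf : MDifferentiableAt I 𝓘(ℝ, F) f p) (v : TangentSpace I p) :
    (show F from mfderiv I 𝓘(ℝ, F) f p v) =
      fderiv ℝ (f ∘ (extChartAt I x₀).symm) (extChartAt I x₀ p)
        (mfderiv I 𝓘(ℝ, E) (extChartAt I x₀) p v) := by
  have : IsManifold I 1 M := .of_le (n := ∞) (by simp)
  have hp' : p ∈ (chartAt H x₀).source := by rwa [extChartAt_source] at hp
  have hz := (extChartAt I x₀).map_source hp
  have hinv := (extChartAt I x₀).left_inv hp
  have hsm : MDifferentiableAt 𝓘(ℝ, E) I (extChartAt I x₀).symm (extChartAt I x₀ p) := by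
    have := mdifferentiableWithinAt_extChartAt_symm (I := I) hz
    rwa [I.range_eq_univ, mdifferentiableWithinAt_univ] at this
  have hf' : MDifferentiableAt I 𝓘(ℝ, F) f ((extChartAt I x₀).symm (extChartAt I x₀ p)) := by
    rwa [hinv]
  have h1 := hf'.comp _ hsm
  have h2 := mdifferentiableAt_extChartAt (I := I) hp'
  rw [← mfderiv_eq_fderiv]
  refine Eq.trans ?_ (mfderiv_comp_apply p h1 h2 v)
  have : f =ᶠ[𝓝 p] ((f ∘ (extChartAt I x₀).symm) ∘ extChartAt I x₀) := by
    filter_upwards [(isOpen_extChartAt_source (I := I) x₀).mem_nhds hp] with q hq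
    exact congrArg f ((extChartAt I x₀).left_inv hq).symm
  rw [this.mfderiv_eq]
  rfl

/-- The vector field with prescribed components in the chart centred at `x₀`. -/
noncomputable def ofChartRep (I : ModelWithCorners ℝ E H) (x₀ : M) (V : E → E) :
    Π x : M, TangentSpace I x :=
  VectorField.mpullback I 𝓘(ℝ, E) (extChartAt I x₀) V

lemma chartRep_ofChartRep (x₀ : M) (V : E → E) {z : E} (hz : z ∈ (extChartAt I x₀).target) :
    chartRep I x₀ (ofChartRep I x₀ V) z = V z := by
  have h := isInvertible_mfderiv_chart ((extChartAt I x₀).map_target hz)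
  have h1 := h.self_comp_inverse
  have h2 := DFunLike.congr_fun h1 (V (extChartAt I x₀ ((extChartAt I x₀).symm z)))
  refine Eq.trans h2 ?_
  rw [(extChartAt I x₀).right_inv hz]; rfl

lemma contMDiffAt_ofChartRep [I.Boundaryless] {x₀ p : M} {V : E → E}
    (hp : p ∈ (extChartAt I x₀).source) (hV : ContDiffAt ℝ ∞ V (extChartAt I x₀ p)) :
    ContMDiffAt I I.tangent ∞ (fun x ↦ (⟨x, ofChartRep I x₀ V x⟩ : TangentBundle I M)) p := by
  rw [contMDiffAt_iff_chartRep hp]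
  refine hV.congr_of_eventuallyEq ?_
  filter_upwards [(isOpen_extChartAt_target (I := I) x₀).mem_nhds ((extChartAt I x₀).map_source hp)]
    with z hz using chartRep_ofChartRep x₀ V hz

/-- Every tangent vector extends to a vector field which is smooth nearby. -/
lemma exists_local_extension [I.Boundaryless] (p : M) (v : TangentSpace I p) :
    ∃ Y : Π x : M, TangentSpace I x, Y p = v ∧
      ∀ᶠ x in 𝓝 p, ContMDiffAt I I.tangent ∞ (fun z ↦ (⟨z, Y z⟩ : TangentBundle I M)) x := by
  have : IsManifold I 1 M := .of_le (n := ∞) (by simp)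
  have key (w : E) : (show E from ofChartRep I p (fun _ ↦ w) p) = w ∧
      ∀ᶠ x in 𝓝 p, ContMDiffAt I I.tangent ∞
        (fun z ↦ (⟨z, ofChartRep I p (fun _ ↦ w) z⟩ : TangentBundle I M)) x := by
    refine ⟨?_, ?_⟩
    · refine (chartRep_self p (ofChartRep I p fun _ ↦ w)).symm.trans ?_
      exact chartRep_ofChartRep p _ (mem_extChartAt_target p)
    · filter_upwards [(isOpen_extChartAt_source (I := I) p).mem_nhds (mem_extChartAt_source p)]
        with q hq using contMDiffAt_ofChartRep hq contDiffAt_const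
  exact ⟨ofChartRep I p (fun _ ↦ (show E from v)), (key v).1, (key v).2⟩

end Charts

/-! ### Derivatives of functions and tensors along vector fields -/

section Derivations

variable {E : Type*} [NormedAddCommGroup E] [NormedSpace ℝ E]
  {H : Type*} [TopologicalSpace H] {I : ModelWithCorners ℝ E H} [I.Boundaryless]
  {M : Type*} [TopologicalSpace M] [ChartedSpace H M]

/-- The derivative of `f` along `X`. -/
noncomputable def dirDeriv (I : ModelWithCorners ℝ E H) (f : M → ℝ) (X : Π x : M, TangentSpace I x)
    (x : M) : ℝ :=
  mfderiv I 𝓘(ℝ, ℝ) f x (X x)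

variable [IsManifold I ∞ M]

lemma contMDiffAt_iff_comp_symm {F : Type*} [NormedAddCommGroup F] [NormedSpace ℝ F] {x₀ p : M}
    (hp : p ∈ (extChartAt I x₀).source) {f : M → F} :
    ContMDiffAt I 𝓘(ℝ, F) ∞ f p ↔
      ContDiffAt ℝ ∞ (f ∘ (extChartAt I x₀).symm) (extChartAt I x₀ p) := by
  have hp' : p ∈ (chartAt H x₀).source := by rwa [extChartAt_source] at hp
  rw [← contMDiffWithinAt_univ, contMDiffWithinAt_iff_source_of_mem_source (x := x₀) hp',
    contMDiffWithinAt_iff_contDiffWithinAt, I.range_eq_univ, preimage_univ, inter_univ,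
    contDiffWithinAt_univ]

lemma ContMDiffAt.eventually_mdifferentiableAt {F : Type*} [NormedAddCommGroup F] [NormedSpace ℝ F]
    {f : M → F} {p : M} (hf : ContMDiffAt I 𝓘(ℝ, F) ∞ f p) :
    ∀ᶠ q in 𝓝 p, MDifferentiableAt I 𝓘(ℝ, F) f q := by
  have : IsManifold I 1 M := .of_le (n := ∞) (by simp)
  have h1 : ContMDiffAt I 𝓘(ℝ, F) 1 f p := hf.of_le (by simp)
  filter_upwards [(contMDiffAt_iff_contMDiffAt_nhds (by simp)).1 h1] with q hq
  exact hq.mdifferentiableAt one_ne_zero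

/-- An equality of germs and not only of values, because the expression is differentiated once more
in `dirDeriv_dirDeriv`. -/
lemma dirDeriv_comp_symm {x₀ p : M} (hp : p ∈ (extChartAt I x₀).source) {f : M → ℝ}
    {X : Π x : M, TangentSpace I x} (hf : ContMDiffAt I 𝓘(ℝ, ℝ) ∞ f p) :
    (dirDeriv I f X ∘ (extChartAt I x₀).symm) =ᶠ[𝓝 (extChartAt I x₀ p)]
      fun z ↦ fderiv ℝ (f ∘ (extChartAt I x₀).symm) z (chartRep I x₀ X z) := by
  have h1 := (isOpen_extChartAt_target (I := I) x₀).mem_nhds ((extChartAt I x₀).map_source hp)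
  have h2 : Tendsto (extChartAt I x₀).symm (𝓝 (extChartAt I x₀ p)) (𝓝 p) := by
    have := continuousAt_extChartAt_symm'' (I := I) ((extChartAt I x₀).map_source hp)
    rwa [ContinuousAt, (extChartAt I x₀).left_inv hp] at this
  filter_upwards [h1, h2.eventually hf.eventually_mdifferentiableAt] with z hz hz'
  have := mfderiv_apply_chart ((extChartAt I x₀).map_target hz) hz' (X ((extChartAt I x₀).symm z))
  rw [(extChartAt I x₀).right_inv hz] at this
  exact this

lemma contMDiffAt_dirDeriv {p : M} {f : M → ℝ} {X : Π x : M, TangentSpace I x}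
    (hf : ContMDiffAt I 𝓘(ℝ, ℝ) ∞ f p)
    (hX : ContMDiffAt I I.tangent ∞ (fun x ↦ (⟨x, X x⟩ : TangentBundle I M)) p) :
    ContMDiffAt I 𝓘(ℝ, ℝ) ∞ (dirDeriv I f X) p := by
  have hp := mem_extChartAt_source (I := I) p
  have h1 := (contMDiffAt_iff_comp_symm hp).1 hf
  rw [contMDiffAt_iff_chartRep hp] at hX
  rw [contMDiffAt_iff_comp_symm hp]
  exact ((h1.fderiv_right (m := ∞) (by simp)).clm_apply hX).congr_of_eventuallyEq
    (dirDeriv_comp_symm hp hf)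

/-- The product rule in a chart. The Hessian term is symmetric in `X` and `Y` and cancels in the
commutator; the other term produces the bracket. -/
lemma dirDeriv_dirDeriv {x₀ p : M} (hp : p ∈ (extChartAt I x₀).source) {f : M → ℝ}
    {X Y : Π x : M, TangentSpace I x} (hf : ContMDiffAt I 𝓘(ℝ, ℝ) ∞ f p)
    (hY : ContMDiffAt I I.tangent ∞ (fun x ↦ (⟨x, Y x⟩ : TangentBundle I M)) p) :
    dirDeriv I (dirDeriv I f Y) X p =
      fderiv ℝ (fderiv ℝ (f ∘ (extChartAt I x₀).symm)) (extChartAt I x₀ p)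
        (chartRep I x₀ X (extChartAt I x₀ p)) (chartRep I x₀ Y (extChartAt I x₀ p)) +
      fderiv ℝ (f ∘ (extChartAt I x₀).symm) (extChartAt I x₀ p)
        (fderiv ℝ (chartRep I x₀ Y) (extChartAt I x₀ p)
          (chartRep I x₀ X (extChartAt I x₀ p))) := by
  have h1 := (contMDiffAt_iff_comp_symm hp).1 hf
  have h2 := (contMDiffAt_iff_chartRep hp).1 hY
  have h3 : DifferentiableAt ℝ (fderiv ℝ (f ∘ (extChartAt I x₀).symm)) (extChartAt I x₀ p) :=
    (h1.fderiv_right (m := ∞) (by simp)).differentiableAt (by simp)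
  have h4 := (dirDeriv_comp_symm (X := X) hp (contMDiffAt_dirDeriv hf hY)).eq_of_nhds
  rw [(dirDeriv_comp_symm (X := Y) hp hf).fderiv_eq,
    fderiv_clm_apply h3 (h2.differentiableAt (by simp))] at h4
  simp only [Function.comp_apply, (extChartAt I x₀).left_inv hp] at h4
  rw [h4]
  simp [add_comm]

/-- A vector field is a derivation, and the Lie bracket is the commutator of derivations. -/
lemma dirDeriv_mlieBracket [CompleteSpace E] {p : M} {f : M → ℝ} {X Y : Π x : M, TangentSpace I x}
    (hf : ContMDiffAt I 𝓘(ℝ, ℝ) ∞ f p)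
    (hX : ContMDiffAt I I.tangent ∞ (fun x ↦ (⟨x, X x⟩ : TangentBundle I M)) p)
    (hY : ContMDiffAt I I.tangent ∞ (fun x ↦ (⟨x, Y x⟩ : TangentBundle I M)) p) :
    dirDeriv I f (VectorField.mlieBracket I X Y) p =
      dirDeriv I (dirDeriv I f Y) X p - dirDeriv I (dirDeriv I f X) Y p := by
  have hp := mem_extChartAt_source (I := I) p
  have h1 := (contMDiffAt_iff_comp_symm hp).1 hf
  have h4 := (dirDeriv_comp_symm (X := VectorField.mlieBracket I X Y) hp hf).eq_of_nhds
  simp only [Function.comp_apply, (extChartAt I p).left_inv hp] at h4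
  rw [h4, dirDeriv_dirDeriv hp hf hY, dirDeriv_dirDeriv hp hf hX, chartRep_mlieBracket hp hX hY,
    VectorField.lieBracket]
  have h5 := (h1.isSymmSndFDerivAt (by rw [minSmoothness_of_isRCLikeNormedField]; exact WithTop.coe_le_coe.2 le_top)).eq
    (chartRep I p X (extChartAt I p p)) (chartRep I p Y (extChartAt I p p))
  rw [h5, map_sub]; ring

lemma dirDeriv_add_field (f : M → ℝ) (X Y : Π x : M, TangentSpace I x) (p : M) :
    dirDeriv I f (X + Y) p = dirDeriv I f X p + dirDeriv I f Y p :=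
  map_add _ _ _

lemma dirDeriv_smul_field (f : M → ℝ) (c : ℝ) (X : Π x : M, TangentSpace I x) (p : M) :
    dirDeriv I f (c • X) p = c * dirDeriv I f X p :=
  map_smul _ _ _

lemma dirDeriv_add {f g : M → ℝ} {p : M} (hf : MDifferentiableAt I 𝓘(ℝ, ℝ) f p)
    (hg : MDifferentiableAt I 𝓘(ℝ, ℝ) g p) (X : Π x : M, TangentSpace I x) :
    dirDeriv I (fun x ↦ f x + g x) X p = dirDeriv I f X p + dirDeriv I g X p := by
  have := mfderiv_add hf hg
  exact DFunLike.congr_fun this (X p)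

lemma Filter.EventuallyEq.dirDeriv_eq {f g : M → ℝ} {p : M} (h : f =ᶠ[𝓝 p] g)
    (X : Π x : M, TangentSpace I x) : dirDeriv I f X p = dirDeriv I g X p := by
  rw [dirDeriv, dirDeriv, h.mfderiv_eq]; rfl

lemma SmoothTensorOn.contMDiffAt_apply {g : TensorField02 I M} (hg : SmoothTensorOn I g univ) {p : M}
    {X Y : Π x : M, TangentSpace I x}
    (hX : ContMDiffAt I I.tangent ∞ (fun x ↦ (⟨x, X x⟩ : TangentBundle I M)) p)
    (hY : ContMDiffAt I I.tangent ∞ (fun x ↦ (⟨x, Y x⟩ : TangentBundle I M)) p) :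
    ContMDiffAt I 𝓘(ℝ, ℝ) ∞ (fun x ↦ g x (X x) (Y x)) p := by
  have h1 := (contMDiffOn_univ.1 hg) p
  have h2 : ContMDiffAt I (I.prod 𝓘(ℝ, ℝ)) ∞
      (fun m ↦ TotalSpace.mk' ℝ (E := Bundle.Trivial M ℝ) m (g m (X m) (Y m))) p := by
    apply ContMDiffAt.clm_bundle_apply₂ (F₁ := E) (F₂ := E)
    · exact h1
    · exact hX
    · exact hY
  simp only [contMDiffAt_totalSpace] at h2
  exact h2.2

end Derivations

/-! ### Killing fields and gradients -/

section Killing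

variable {E : Type*} [NormedAddCommGroup E] [NormedSpace ℝ E] [CompleteSpace E]
  {H : Type*} [TopologicalSpace H] {I : ModelWithCorners ℝ E H} [I.Boundaryless]
  {M : Type*} [TopologicalSpace M] [ChartedSpace H M] [IsManifold I ∞ M]

lemma ContMDiffAt.mlieBracket_field {X Y : Π x : M, TangentSpace I x} {p : M}
    (hX : ContMDiffAt I I.tangent ∞ (fun x ↦ (⟨x, X x⟩ : TangentBundle I M)) p)
    (hY : ContMDiffAt I I.tangent ∞ (fun x ↦ (⟨x, Y x⟩ : TangentBundle I M)) p) :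
    ContMDiffAt I I.tangent ∞
      (fun x ↦ (⟨x, VectorField.mlieBracket I X Y x⟩ : TangentBundle I M)) p := by
  have : IsManifold I (minSmoothness ℝ 2) M :=
    .of_le (n := ∞) (by rw [minSmoothness_of_isRCLikeNormedField]; exact WithTop.coe_le_coe.2 le_top)
  have : IsManifold I ((⊤ : ℕ∞) + 1 : WithTop ℕ∞) M := ‹IsManifold I ∞ M›
  exact ContMDiffAt.mlieBracket_vectorField (m := ⊤) (n := ⊤) hX hY
    (by rw [minSmoothness_of_isRCLikeNormedField]; rfl)

lemma lieDerivTensor_eq_zero_iff (g : TensorField02 I M) (X Y Z : Π x : M, TangentSpace I x)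
    (x : M) : lieDerivTensor I (fun x v w ↦ g x v w) X Y Z x = 0 ↔
      dirDeriv I (fun q ↦ g q (Y q) (Z q)) X x =
        g x (VectorField.mlieBracket I X Y x) (Z x) +
          g x (Y x) (VectorField.mlieBracket I X Z x) := by
  rw [lieDerivTensor, sub_sub, sub_eq_zero]; rfl

lemma IsKilling.contMDiffAt {g : TensorField02 I M} {X : Π x : M, TangentSpace I x}
    (hX : IsKilling I g X) (p : M) :
    ContMDiffAt I I.tangent ∞ (fun x ↦ (⟨x, X x⟩ : TangentBundle I M)) p :=
  (smoothFieldOn_univ_iff.1 hX.1) p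

lemma IsKilling.add {g : TensorField02 I M} {X Y : Π x : M, TangentSpace I x}
    (hX : IsKilling I g X) (hY : IsKilling I g Y) : IsKilling I g (X + Y) := by
  have : IsManifold I 1 M := .of_le (n := ∞) (by simp)
  have : IsManifold I 2 M := .of_le (n := ∞) (WithTop.coe_le_coe.2 le_top)
  refine ⟨fun p _ ↦ ?_, fun x V W hV hW ↦ ?_⟩
  · exact ContMDiffWithinAt.add_section (hX.1 p trivial) (hY.1 p trivial)
  · have h1 := (lieDerivTensor_eq_zero_iff _ _ _ _ _).1 (hX.2 x V W hV hW)
    have h2 := (lieDerivTensor_eq_zero_iff _ _ _ _ _).1 (hY.2 x V W hV hW)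
    rw [lieDerivTensor_eq_zero_iff, dirDeriv_add_field, h1, h2]
    have a := (hX.contMDiffAt x).mdifferentiableAt (by simp)
    have b := (hY.contMDiffAt x).mdifferentiableAt (by simp)
    rw [VectorField.mlieBracket_add_left a b, VectorField.mlieBracket_add_left a b]
    simp only [map_add, add_apply]
    ring

lemma IsKilling.smul {g : TensorField02 I M} {X : Π x : M, TangentSpace I x}
    (hX : IsKilling I g X) (c : ℝ) : IsKilling I g (c • X) := by
  have : IsManifold I 1 M := .of_le (n := ∞) (by simp)
  have : IsManifold I 2 M := .of_le (n := ∞) (WithTop.coe_le_coe.2 le_top)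
  refine ⟨fun p _ ↦ ?_, fun x V W hV hW ↦ ?_⟩
  · exact ContMDiffWithinAt.const_smul_section (hX.1 p trivial)
  · have h1 := (lieDerivTensor_eq_zero_iff _ _ _ _ _).1 (hX.2 x V W hV hW)
    rw [lieDerivTensor_eq_zero_iff, dirDeriv_smul_field, h1]
    have a := (hX.contMDiffAt x).mdifferentiableAt (by simp)
    rw [VectorField.mlieBracket_const_smul_left a, VectorField.mlieBracket_const_smul_left a]
    simp only [map_smul, smul_apply, smul_eq_mul]
    ring

/-- Differentiating `g(Y, Z)` twice along Killing fields. -/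
lemma IsKilling.dirDeriv_dirDeriv {g : TensorField02 I M} (hg : SmoothTensorOn I g univ)
    {X₁ X₂ : Π x : M, TangentSpace I x} (h₁ : IsKilling I g X₁) (h₂ : IsKilling I g X₂)
    {x : M} {Y Z : Π x : M, TangentSpace I x}
    (hY : ∀ᶠ x' in 𝓝 x, ContMDiffAt I I.tangent ∞ (fun z ↦ (⟨z, Y z⟩ : TangentBundle I M)) x')
    (hZ : ∀ᶠ x' in 𝓝 x, ContMDiffAt I I.tangent ∞ (fun z ↦ (⟨z, Z z⟩ : TangentBundle I M)) x') :
    dirDeriv I (dirDeriv I (fun q ↦ g q (Y q) (Z q)) X₂) X₁ x =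
      (g x (VectorField.mlieBracket I X₁ (VectorField.mlieBracket I X₂ Y) x) (Z x) +
        g x (VectorField.mlieBracket I X₂ Y x) (VectorField.mlieBracket I X₁ Z x)) +
      (g x (VectorField.mlieBracket I X₁ Y x) (VectorField.mlieBracket I X₂ Z x) +
        g x (Y x) (VectorField.mlieBracket I X₁ (VectorField.mlieBracket I X₂ Z) x)) := by
  have hY2 : ∀ᶠ x' in 𝓝 x, ContMDiffAt I I.tangent ∞
      (fun z ↦ (⟨z, VectorField.mlieBracket I X₂ Y z⟩ : TangentBundle I M)) x' := by
    filter_upwards [hY] with q hq using (h₂.contMDiffAt q).mlieBracket_field hq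
  have hZ2 : ∀ᶠ x' in 𝓝 x, ContMDiffAt I I.tangent ∞
      (fun z ↦ (⟨z, VectorField.mlieBracket I X₂ Z z⟩ : TangentBundle I M)) x' := by
    filter_upwards [hZ] with q hq using (h₂.contMDiffAt q).mlieBracket_field hq
  -- The Killing equation is needed on a neighbourhood, since it is about to be differentiated along
  -- `X₁`.
  have e1 : dirDeriv I (fun q ↦ g q (Y q) (Z q)) X₂ =ᶠ[𝓝 x] fun q ↦
      g q (VectorField.mlieBracket I X₂ Y q) (Z q) + g q (Y q) (VectorField.mlieBracket I X₂ Z q) := by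
    filter_upwards [eventually_eventually_nhds.2 hY, eventually_eventually_nhds.2 hZ] with q hqY hqZ
    exact (lieDerivTensor_eq_zero_iff _ _ _ _ _).1 (h₂.2 q Y Z hqY hqZ)
  rw [e1.dirDeriv_eq, dirDeriv_add
    ((hg.contMDiffAt_apply hY2.self_of_nhds hZ.self_of_nhds).mdifferentiableAt (by simp))
    ((hg.contMDiffAt_apply hY.self_of_nhds hZ2.self_of_nhds).mdifferentiableAt (by simp)),
    (lieDerivTensor_eq_zero_iff _ _ _ _ _).1 (h₁.2 x _ _ hY2 hZ),
    (lieDerivTensor_eq_zero_iff _ _ _ _ _).1 (h₁.2 x _ _ hY hZ2)]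

lemma mlieBracket_mlieBracket {X₁ X₂ Y : Π x : M, TangentSpace I x} {x : M}
    (h₁ : ContMDiffAt I I.tangent ∞ (fun z ↦ (⟨z, X₁ z⟩ : TangentBundle I M)) x)
    (h₂ : ContMDiffAt I I.tangent ∞ (fun z ↦ (⟨z, X₂ z⟩ : TangentBundle I M)) x)
    (hY : ContMDiffAt I I.tangent ∞ (fun z ↦ (⟨z, Y z⟩ : TangentBundle I M)) x) :
    VectorField.mlieBracket I (VectorField.mlieBracket I X₁ X₂) Y x =
      VectorField.mlieBracket I X₁ (VectorField.mlieBracket I X₂ Y) x -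
        VectorField.mlieBracket I X₂ (VectorField.mlieBracket I X₁ Y) x := by
  have : IsManifold I (minSmoothness ℝ 3) M :=
    .of_le (n := ∞) (by rw [minSmoothness_of_isRCLikeNormedField]; exact WithTop.coe_le_coe.2 le_top)
  have hle : minSmoothness ℝ 2 ≤ ∞ := by
    rw [minSmoothness_of_isRCLikeNormedField]; exact WithTop.coe_le_coe.2 le_top
  rw [VectorField.leibniz_identity_mlieBracket_apply (h₁.of_le hle) (h₂.of_le hle) (hY.of_le hle)]
  simp

/-- On tensors `L_[X₁,X₂]` is the commutator of `L_X₁` and `L_X₂`. In the difference of the two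
iterated derivatives of `g(Y, Z)` the mixed terms cancel, and the double brackets combine by the
Jacobi identity. -/
lemma IsKilling.mlieBracket {g : TensorField02 I M} (hg : SmoothTensorOn I g univ)
    {X₁ X₂ : Π x : M, TangentSpace I x} (h₁ : IsKilling I g X₁) (h₂ : IsKilling I g X₂) :
    IsKilling I g (VectorField.mlieBracket I X₁ X₂) := by
  refine ⟨fun p _ ↦ ((h₁.contMDiffAt p).mlieBracket_field (h₂.contMDiffAt p)).contMDiffWithinAt,
    fun x Y Z hY hZ ↦ ?_⟩
  have hY' := hY.self_of_nhds
  have hZ' := hZ.self_of_nhds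
  rw [lieDerivTensor_eq_zero_iff,
    dirDeriv_mlieBracket (hg.contMDiffAt_apply hY' hZ') (h₁.contMDiffAt x) (h₂.contMDiffAt x),
    h₁.dirDeriv_dirDeriv hg h₂ hY hZ, h₂.dirDeriv_dirDeriv hg h₁ hY hZ,
    mlieBracket_mlieBracket (h₁.contMDiffAt x) (h₂.contMDiffAt x) hY',
    mlieBracket_mlieBracket (h₁.contMDiffAt x) (h₂.contMDiffAt x) hZ']
  simp only [map_sub, sub_apply]
  ring

/-- The Lie derivative of a gradient along a Killing field is a gradient. -/
lemma IsGradient.mlieBracket {g : TensorField02 I M} {f : M → ℝ} {X G : Π x : M, TangentSpace I x}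
    (hG : IsGradient I g f G) (hX : IsKilling I g X) (hf : ContMDiff I 𝓘(ℝ, ℝ) ∞ f)
    (hGs : SmoothFieldOn I G univ) :
    IsGradient I g (dirDeriv I f X) (VectorField.mlieBracket I X G) := by
  intro x v
  obtain ⟨Z, rfl, hZ⟩ := exists_local_extension x v
  have h1 := (lieDerivTensor_eq_zero_iff _ _ _ _ _).1
    (hX.2 x G Z (Eventually.of_forall (smoothFieldOn_univ_iff.1 hGs)) hZ)
  -- Since `g(G, Z) = Z f`, the Killing equation for `G` and `Z` reads `X (Z f) = g([X, G], Z) + [X,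
  -- Z] f`, and the commutator formula leaves `g([X, G], Z) = Z (X f)`.
  have h2 : (fun q ↦ g q (G q) (Z q)) = dirDeriv I f Z := funext fun q ↦ hG q (Z q)
  have h3 := hG x (VectorField.mlieBracket I X Z x)
  have h4 := dirDeriv_mlieBracket (hf x) (hX.contMDiffAt x) hZ.self_of_nhds
  rw [h2] at h1
  have h5 : (show ℝ from mfderiv I 𝓘(ℝ, ℝ) f x (VectorField.mlieBracket I X Z x)) =
    dirDeriv I f (VectorField.mlieBracket I X Z) x := rfl
  have h6 : (show ℝ from mfderiv I 𝓘(ℝ, ℝ) (dirDeriv I f X) x (Z x)) =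
    dirDeriv I (dirDeriv I f X) Z x := rfl
  have h7 : g x (G x) (VectorField.mlieBracket I X Z x) = _ := h3.trans h5
  have h8 : ∀ a b c d e : ℝ, a = b + c → c = d → d = a - e → b = e := by
    intros; linarith
  exact (h8 _ _ _ _ _ h1 h7 h4).trans h6.symm

lemma IsGradient.add {g : TensorField02 I M} {f₁ f₂ : M → ℝ} {G₁ G₂ : Π x : M, TangentSpace I x}
    (h₁ : IsGradient I g f₁ G₁) (h₂ : IsGradient I g f₂ G₂) (hf₁ : ContMDiff I 𝓘(ℝ, ℝ) ∞ f₁)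
    (hf₂ : ContMDiff I 𝓘(ℝ, ℝ) ∞ f₂) : IsGradient I g (f₁ + f₂) (G₁ + G₂) := by
  intro x v
  have := mfderiv_add ((hf₁ x).mdifferentiableAt (by simp)) ((hf₂ x).mdifferentiableAt (by simp))
  refine Eq.trans ?_ (DFunLike.congr_fun this v).symm
  rw [Pi.add_apply, map_add]
  exact congrArg₂ (· + ·) (h₁ x v) (h₂ x v)

lemma IsGradient.smul {g : TensorField02 I M} {f : M → ℝ} {G : Π x : M, TangentSpace I x}
    (h : IsGradient I g f G) (hf : ContMDiff I 𝓘(ℝ, ℝ) ∞ f) (c : ℝ) :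
    IsGradient I g (c • f) (c • G) := by
  intro x v
  have := const_smul_mfderiv ((hf x).mdifferentiableAt (by simp)) c
  refine Eq.trans ?_ (DFunLike.congr_fun this v).symm
  rw [Pi.smul_apply, map_smul]
  exact congrArg (c • ·) (h x v)

end Killing

/-! ### Tensors in charts -/

section TensorCharts

variable {E : Type*} [NormedAddCommGroup E] [NormedSpace ℝ E]
  {H : Type*} [TopologicalSpace H] {I : ModelWithCorners ℝ E H} [I.Boundaryless]
  {M : Type*} [TopologicalSpace M] [ChartedSpace H M] [IsManifold I ∞ M]

/-- The Lie derivative of a tensor at a point, in terms of its components `A` in a chart. -/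
lemma lieDerivTensor_eq_of_chart [CompleteSpace E] {g : PreTensor02 I M} {p : M}
    {A : E → E →L[ℝ] E →L[ℝ] ℝ} (hA : DifferentiableAt ℝ A (extChartAt I p p))
    (hg : ∀ z ∈ (extChartAt I p).target, ∀ X Y : Π x : M, TangentSpace I x,
      g ((extChartAt I p).symm z) (X _) (Y _) = A z (chartRep I p X z) (chartRep I p Y z))
    {X Y Z : Π x : M, TangentSpace I x}
    (hX : ContMDiffAt I I.tangent ∞ (fun x ↦ (⟨x, X x⟩ : TangentBundle I M)) p)
    (hY : ContMDiffAt I I.tangent ∞ (fun x ↦ (⟨x, Y x⟩ : TangentBundle I M)) p)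
    (hZ : ContMDiffAt I I.tangent ∞ (fun x ↦ (⟨x, Z x⟩ : TangentBundle I M)) p) :
    lieDerivTensor I g X Y Z p =
      fderiv ℝ A (extChartAt I p p) (X p) (Y p) (Z p) +
        A (extChartAt I p p) (fderiv ℝ (chartRep I p X) (extChartAt I p p) (Y p)) (Z p) +
        A (extChartAt I p p) (Y p) (fderiv ℝ (chartRep I p X) (extChartAt I p p) (Z p)) := by
  have : IsManifold I 1 M := .of_le (n := ∞) (by simp)
  have hp := mem_extChartAt_source (I := I) p
  have ht := (isOpen_extChartAt_target (I := I) p).mem_nhds (mem_extChartAt_target p)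
  have hinv := extChartAt_to_inv (I := I) p
  set z₀ := extChartAt I p p with hz₀
  have dX := ((contMDiffAt_iff_chartRep hp).1 hX).differentiableAt (by simp)
  have dY := ((contMDiffAt_iff_chartRep hp).1 hY).differentiableAt (by simp)
  have dZ := ((contMDiffAt_iff_chartRep hp).1 hZ).differentiableAt (by simp)
  have hX' := chartRep_self p X
  have hY' := chartRep_self p Y
  have hZ' := chartRep_self p Z
  have bY := chartRep_mlieBracket hp hX hY
  have bZ := chartRep_mlieBracket hp hX hZ
  rw [chartRep_self] at bY bZ
  simp only [← hz₀] at dX dY dZ hX' hY' hZ' bY bZ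
  -- the function `g(Y, Z)` in the chart
  set f : M → ℝ := fun x ↦ g x (Y x) (Z x) with hf
  have e1 : (f ∘ (extChartAt I p).symm) =ᶠ[𝓝 z₀]
      fun z ↦ A z (chartRep I p Y z) (chartRep I p Z z) := by
    filter_upwards [ht] with z hz using hg z hz Y Z
  have d1 : DifferentiableAt ℝ (fun z ↦ A z (chartRep I p Y z) (chartRep I p Z z)) z₀ :=
    (hA.clm_apply dY).clm_apply dZ
  have e2 : f =ᶠ[𝓝 p] (f ∘ (extChartAt I p).symm) ∘ extChartAt I p := by
    filter_upwards [(isOpen_extChartAt_source (I := I) p).mem_nhds hp] with q hq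
    exact congrArg f ((extChartAt I p).left_inv hq).symm
  have hfd : MDifferentiableAt I 𝓘(ℝ, ℝ) f p := by
    have h1 : DifferentiableAt ℝ (f ∘ (extChartAt I p).symm) z₀ := d1.congr_of_eventuallyEq e1
    have h2 := mdifferentiableAt_extChartAt (I := I) (mem_chart_source H p)
    have h3 : MDifferentiableAt 𝓘(ℝ, E) 𝓘(ℝ, ℝ) (f ∘ (extChartAt I p).symm) (extChartAt I p p) :=
      h1.mdifferentiableAt
    exact (h3.comp p h2).congr_of_eventuallyEq e2
  have hd := mfderiv_apply_chart hp hfd (X p)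
  rw [← hz₀, e1.fderiv_eq, fderiv_clm_apply (hA.clm_apply dY) dZ, fderiv_clm_apply hA dY] at hd
  have hXp : (show E from mfderiv I 𝓘(ℝ, E) (extChartAt I p) p (X p)) = X p := by
    rw [mfderiv_extChartAt_self]; rfl
  -- The hypothesis on `A` concerns fields; fields with constant components turn it into a statement
  -- about vectors at `p`.
  have gp (V W : TangentSpace I p) : g p V W = A z₀ V W := by
    have key (v w : E) : g p v w = A z₀ v w := by
      have := hg z₀ (mem_extChartAt_target p) (ofChartRep I p fun _ ↦ v) (ofChartRep I p fun _ ↦ w)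
      rw [chartRep_ofChartRep p _ (mem_extChartAt_target p),
        chartRep_ofChartRep p _ (mem_extChartAt_target p)] at this
      rw [← this]
      have k2 (u : E) : (show E from ofChartRep I p (fun _ ↦ u) p) = u := by
        refine (chartRep_self p (ofChartRep I p fun _ ↦ u)).symm.trans ?_
        exact chartRep_ofChartRep p _ (mem_extChartAt_target p)
      have k3 : ∀ q, q = p → g p v w =
          g q (ofChartRep I p (fun _ ↦ v) q) (ofChartRep I p (fun _ ↦ w) q) := by
        rintro q rfl
        exact (congrArg₂ (g q) (k2 v) (k2 w)).symm
      exact k3 _ hinv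
    exact key V W
  -- What remains is linear algebra, with `u`, `v`, `w` the derivatives of `X`, `Y`, `Z`: the
  -- derivatives of `Y` and `Z` cancel, so the result depends on these fields only through their
  -- values at `p`.
  have fin : ∀ (A₀ : E →L[ℝ] E →L[ℝ] ℝ) (A' : E →L[ℝ] E →L[ℝ] E →L[ℝ] ℝ) (x y z : E) (D : ℝ)
      (u v w : E →L[ℝ] E),
      D = (A₀ y ∘SL w + (A₀ ∘SL v + A'.flip y).flip z) x →
      D - A₀ (v x - u y) z - A₀ y (w x - u z) = A' x y z + A₀ (u y) z + A₀ y (u z) := by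
    rintro A₀ A' x y z D u v w rfl
    simp; ring
  rw [hY', hZ'] at hd
  rw [lieDerivTensor, bY, bZ, VectorField.lieBracket, VectorField.lieBracket, hX', hY', hZ']
  refine Eq.trans (congrArg₂ (fun t t' : ℝ ↦ (show ℝ from mfderiv I 𝓘(ℝ, ℝ) f p (X p)) - t - t')
    (gp _ (Z p)) (gp (Y p) _)) ?_
  exact fin _ _ _ _ _ _ (fderiv ℝ (chartRep I p X) z₀) _ _ (hd.trans (congrArg _ hXp))

variable [FiniteDimensional ℝ E]

/-- The components of a covariant tensor in the chart centred at `x₀`. -/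
noncomputable def tensorRep (g : TensorField02 I M) (x₀ : M) (z : E) : E →L[ℝ] E →L[ℝ] ℝ :=
  let D : E →L[ℝ] TangentSpace I ((extChartAt I x₀).symm z) :=
    (mfderiv I 𝓘(ℝ, E) (extChartAt I x₀) ((extChartAt I x₀).symm z)).inverse
  LinearMap.toContinuousLinearMap (((LinearMap.toContinuousLinearMap : (E →ₗ[ℝ] ℝ) ≃ₗ[ℝ] _).toLinearMap) ∘ₗ
    LinearMap.mk₂ ℝ (fun v w ↦ g ((extChartAt I x₀).symm z) (D v) (D w))
      (fun _ _ _ ↦ by rw [map_add, map_add]; rfl) (fun _ _ _ ↦ by rw [map_smul, map_smul]; rfl)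
      (fun _ _ _ ↦ by rw [map_add, map_add]) (fun _ _ _ ↦ by rw [map_smul, map_smul]))

lemma tensorRep_apply (g : TensorField02 I M) (x₀ : M) (z : E)
    (v w : E) : tensorRep g x₀ z v w = g ((extChartAt I x₀).symm z)
      (ofChartRep I x₀ (fun _ ↦ v) _) (ofChartRep I x₀ (fun _ ↦ w) _) := rfl

lemma ofChartRep_chartRep (x₀ : M) {z : E} (hz : z ∈ (extChartAt I x₀).target)
    (X : Π x : M, TangentSpace I x) :
    ofChartRep I x₀ (fun _ ↦ chartRep I x₀ X z) ((extChartAt I x₀).symm z) =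
      X ((extChartAt I x₀).symm z) := by
  have h := (isInvertible_mfderiv_chart ((extChartAt I x₀).map_target hz)).inverse_comp_self
  exact DFunLike.congr_fun h (X ((extChartAt I x₀).symm z))

lemma tensorRep_chartRep (g : TensorField02 I M) (x₀ : M) {z : E}
    (hz : z ∈ (extChartAt I x₀).target) (X Y : Π x : M, TangentSpace I x) :
    g ((extChartAt I x₀).symm z) (X _) (Y _) =
      tensorRep g x₀ z (chartRep I x₀ X z) (chartRep I x₀ Y z) := by
  rw [tensorRep_apply, ofChartRep_chartRep x₀ hz, ofChartRep_chartRep x₀ hz]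

/-- In finite dimension, smoothness of an operator-valued map can be tested on fixed vectors, and
the components are values of `g` on fields with constant components. -/
lemma contDiffOn_tensorRep {g : TensorField02 I M} (hg : SmoothTensorOn I g univ) (x₀ : M) :
    ContDiffOn ℝ ∞ (tensorRep g x₀) (extChartAt I x₀).target := by
  rw [contDiffOn_clm_apply]
  intro v
  rw [contDiffOn_clm_apply]
  intro w z hz
  have hs := (extChartAt I x₀).map_target hz
  have h1 (u : E) := contMDiffAt_ofChartRep (V := fun _ ↦ u) hs contDiffAt_const
  have h2 := (contMDiffAt_iff_comp_symm hs).1 (hg.contMDiffAt_apply (h1 v) (h1 w))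
  rw [(extChartAt I x₀).right_inv hz] at h2
  exact (h2.congr_of_eventuallyEq (by rfl)).contDiffWithinAt

lemma contDiffAt_tensorRep {g : TensorField02 I M} (hg : SmoothTensorOn I g univ) {x₀ p : M}
    (hp : p ∈ (extChartAt I x₀).source) : ContDiffAt ℝ ∞ (tensorRep g x₀) (extChartAt I x₀ p) :=
  (contDiffOn_tensorRep hg x₀).contDiffAt
    ((isOpen_extChartAt_target x₀).mem_nhds ((extChartAt I x₀).map_source hp))

/-- An injective map from `E` to its dual is bijective, both having the same finite dimension. -/
lemma exists_equiv_of_nondegenerate {A : E →L[ℝ] E →L[ℝ] ℝ} (hA : ∀ v, A v = 0 → v = 0) :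
    ∃ e : E ≃L[ℝ] (E →L[ℝ] ℝ), (e : E →L[ℝ] E →L[ℝ] ℝ) = A := by
  have hinj : Function.Injective A.toLinearMap :=
    (injective_iff_map_eq_zero A.toLinearMap).2 hA
  have hdim : Module.finrank ℝ E = Module.finrank ℝ (E →L[ℝ] ℝ) := by
    rw [← (LinearMap.toContinuousLinearMap : (E →ₗ[ℝ] ℝ) ≃ₗ[ℝ] (E →L[ℝ] ℝ)).finrank_eq]
    exact (Subspace.dual_finrank_eq (K := ℝ) (V := E)).symm
  refine ⟨(A.toLinearMap.linearEquivOfInjective hinj hdim).toContinuousLinearEquiv, ?_⟩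
  ext v w; simp

lemma ContDiffAt.inverse_clm_apply {E F D : Type*} [NormedAddCommGroup E] [NormedSpace ℝ E]
    [CompleteSpace E] [NormedAddCommGroup F] [NormedSpace ℝ F] [NormedAddCommGroup D]
    [NormedSpace ℝ D] {m : WithTop ℕ∞} {A : D → E →L[ℝ] F} {b : D → F} {z : D}
    (hA : ContDiffAt ℝ m A z) (hb : ContDiffAt ℝ m b z) {e : E ≃L[ℝ] F}
    (he : (e : E →L[ℝ] F) = A z) : ContDiffAt ℝ m (fun z ↦ (A z).inverse (b z)) z := by
  have h0 : ContDiffAt ℝ m (ContinuousLinearMap.inverse : (E →L[ℝ] F) → F →L[ℝ] E) (A z) := by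
    rw [← he]; exact contDiffAt_map_inverse e
  exact (h0.comp z hA).clm_apply hb

lemma exists_gradient (g : TensorField02 I M)
    (hnd : ∀ x v, (∀ w, g x v w = 0) → v = 0) (f : M → ℝ) :
    ∃ G : Π x : M, TangentSpace I x, IsGradient I g f G := by
  have key (x : M) : ∃ G : TangentSpace I x, ∀ v, g x G v = (mfderiv I 𝓘(ℝ, ℝ) f x v : ℝ) := by
    have h (b : E →L[ℝ] E →L[ℝ] ℝ) (hb : ∀ v, (∀ w, b v w = 0) → v = 0) (l : E →L[ℝ] ℝ) :
        ∃ G : E, ∀ v, b G v = l v := by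
      obtain ⟨e, rfl⟩ := exists_equiv_of_nondegenerate (A := b)
        fun v hv ↦ hb v fun w ↦ by rw [hv]; rfl
      exact ⟨e.symm l, fun v ↦ by simp⟩
    exact h (g x) (hnd x) (mfderiv I 𝓘(ℝ, ℝ) f x)
  choose G hG using key
  exact ⟨G, hG⟩

/-- In a chart the gradient is the inverse of the component operator of `g` applied to the
differential of `f`, and inversion of operators is smooth. Since `IsAsymptoticSymmetry` provides its
gradient only pointwise, regularity has to be derived. -/
lemma IsGradient.smooth {g : TensorField02 I M} (hg : SmoothTensorOn I g univ)
    (hnd : ∀ x v, (∀ w, g x v w = 0) → v = 0) {f : M → ℝ} (hf : ContMDiff I 𝓘(ℝ, ℝ) ∞ f)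
    {G : Π x : M, TangentSpace I x} (hG : IsGradient I g f G) : SmoothFieldOn I G univ := by
  have : CompleteSpace E := FiniteDimensional.complete ℝ E
  intro p _
  have hp := mem_extChartAt_source (I := I) p
  refine ContMDiffAt.contMDiffWithinAt ((contMDiffAt_iff_chartRep hp).2 ?_)
  have ht := (isOpen_extChartAt_target (I := I) p).mem_nhds (mem_extChartAt_target p)
  have hA := contDiffAt_tensorRep hg hp
  have hF := (contMDiffAt_iff_comp_symm hp).1 (hf p)
  set F := f ∘ (extChartAt I p).symm with hFdef
  have hinj : ∀ z ∈ (extChartAt I p).target, ∀ v, tensorRep g p z v = 0 → v = 0 := by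
    intro z hz v hv
    have h1 : ofChartRep I p (fun _ ↦ v) ((extChartAt I p).symm z) = 0 := by
      refine hnd _ _ fun w ↦ ?_
      have h2 : ∃ u, ofChartRep I p (fun _ ↦ u) ((extChartAt I p).symm z) = w := by
        let W : Π x : M, TangentSpace I x := ofChartRep I p fun _ ↦
          mfderiv I 𝓘(ℝ, E) (extChartAt I p) ((extChartAt I p).symm z) w
        have h := (isInvertible_mfderiv_chart ((extChartAt I p).map_target hz)).inverse_comp_self
        exact ⟨_, DFunLike.congr_fun h w⟩
      obtain ⟨u, rfl⟩ := h2
      rw [← tensorRep_apply, hv]; rfl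
    have h3 := chartRep_ofChartRep p (fun _ ↦ v) hz
    rw [chartRep, h1, map_zero] at h3
    exact h3.symm
  have key : chartRep I p G =ᶠ[𝓝 (extChartAt I p p)]
      fun z ↦ (tensorRep g p z).inverse (fderiv ℝ F z) := by
    filter_upwards [ht] with z hz
    obtain ⟨e, he⟩ := exists_equiv_of_nondegenerate (hinj z hz)
    have h1 : tensorRep g p z (chartRep I p G z) = fderiv ℝ F z := by
      ext v
      have hs := (extChartAt I p).map_target hz
      have h2 := tensorRep_chartRep g p hz G (ofChartRep I p fun _ ↦ v)
      rw [chartRep_ofChartRep p _ hz] at h2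
      have h3 := mfderiv_apply_chart hs ((hf _).mdifferentiableAt (by simp))
        (ofChartRep I p (fun _ ↦ v) ((extChartAt I p).symm z))
      rw [(extChartAt I p).right_inv hz] at h3
      have h4 := chartRep_ofChartRep p (fun _ ↦ v) hz
      rw [chartRep] at h4
      refine h2.symm.trans ((hG _ _).trans (h3.trans ?_))
      exact congrArg _ h4
    rw [← he] at h1 ⊢
    rw [← h1, ContinuousLinearMap.inverse_equiv]
    simp
  refine ContDiffAt.congr_of_eventuallyEq ?_ key
  obtain ⟨e, he⟩ := exists_equiv_of_nondegenerate (hinj _ (mem_extChartAt_target p))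
  exact hA.inverse_clm_apply (hF.fderiv_right (m := ∞) (by simp)) he

end TensorCharts

/-! ### Charts of the product of a line with a manifold -/

/-- The target carries the model of the vector space `F × F'` and not the product of two models,
because an extended chart of a product takes values in the vector space. -/
lemma HasMFDerivAt.prodMk_space {E : Type*} [NormedAddCommGroup E] [NormedSpace ℝ E]
    {H : Type*} [TopologicalSpace H] {I : ModelWithCorners ℝ E H}
    {M : Type*} [TopologicalSpace M] [ChartedSpace H M] {F F' : Type*} [NormedAddCommGroup F]
    [NormedSpace ℝ F] [NormedAddCommGroup F'] [NormedSpace ℝ F'] {f : M → F} {g : M → F'} {x : M}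
    {f' : TangentSpace I x →L[ℝ] F} {g' : TangentSpace I x →L[ℝ] F'}
    (hf : HasMFDerivAt I 𝓘(ℝ, F) f x f') (hg : HasMFDerivAt I 𝓘(ℝ, F') g x g') :
    HasMFDerivAt I 𝓘(ℝ, F × F') (fun x ↦ (f x, g x)) x (f'.prod g') :=
  ⟨hf.1.prodMk hg.1, hf.2.prodMk hg.2⟩

section LineCharts

variable {n : ℕ} {B : Type*} [TopologicalSpace B] [ChartedSpace (EuclideanSpace ℝ (Fin n)) B]

lemma extChartAt_lineModel (p q : ℝ × B) :
    extChartAt (lineModel n) p q = (q.1, extChartAt (𝓡 n) p.2 q.2) := by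
  rw [extChartAt_prod]; simp [chartAt_self_eq]

lemma extChartAt_lineModel_symm (p : ℝ × B) (z : ℝ × EuclideanSpace ℝ (Fin n)) :
    (extChartAt (lineModel n) p).symm z = (z.1, (extChartAt (𝓡 n) p.2).symm z.2) := by
  rw [extChartAt_prod]; simp [chartAt_self_eq]

lemma mem_extChartAt_lineModel_source {p q : ℝ × B} :
    q ∈ (extChartAt (lineModel n) p).source ↔ q.2 ∈ (extChartAt (𝓡 n) p.2).source := by
  rw [extChartAt_prod]; simp [chartAt_self_eq]

lemma mem_extChartAt_lineModel_target {p : ℝ × B} {z : ℝ × EuclideanSpace ℝ (Fin n)} :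
    z ∈ (extChartAt (lineModel n) p).target ↔ z.2 ∈ (extChartAt (𝓡 n) p.2).target := by
  rw [extChartAt_prod]; simp [chartAt_self_eq]

lemma lineComp_add {p : ℝ × B} (V W : TangentSpace (lineModel n) p) :
    lineComp (V + W) = lineComp V + lineComp W := rfl

lemma lineComp_smul {p : ℝ × B} (c : ℝ) (V : TangentSpace (lineModel n) p) :
    lineComp (c • V) = c * lineComp V := rfl

lemma baseComp_add {p : ℝ × B} (V W : TangentSpace (lineModel n) p) :
    baseComp (V + W) = baseComp V + baseComp W := rfl

lemma baseComp_smul {p : ℝ × B} (c : ℝ) (V : TangentSpace (lineModel n) p) :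
    baseComp (c • V) = c • baseComp V := rfl

lemma lineComp_lineVec {p : ℝ × B} (a : ℝ) (v : TangentSpace (𝓡 n) p.2) :
    lineComp (lineVec a v : TangentSpace (lineModel n) p) = a := rfl

lemma baseComp_lineVec {p : ℝ × B} (a : ℝ) (v : TangentSpace (𝓡 n) p.2) :
    baseComp (lineVec a v : TangentSpace (lineModel n) p) = v := rfl

lemma tangent_ext {p : ℝ × B} {V W : TangentSpace (lineModel n) p}
    (h₁ : lineComp V = lineComp W) (h₂ : baseComp V = baseComp W) : V = W :=
  Prod.ext (α := ℝ) (β := EuclideanSpace ℝ (Fin n)) h₁ h₂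

lemma mfderiv_snd_line {p : ℝ × B} (V : TangentSpace (lineModel n) p) :
    mfderiv (lineModel n) (𝓡 n) Prod.snd p V = baseComp V := by
  rw [mfderiv_snd]; rfl

variable [IsManifold (𝓡 n) ∞ B]

lemma mfderiv_extChartAt_lineModel {p q : ℝ × B} (hq : q.2 ∈ (extChartAt (𝓡 n) p.2).source)
    (V : TangentSpace (lineModel n) q) :
    (mfderiv (lineModel n) 𝓘(ℝ, ℝ × EuclideanSpace ℝ (Fin n)) (extChartAt (lineModel n) p) q V :
      ℝ × EuclideanSpace ℝ (Fin n)) = (lineComp V, chartComp p.2 q.2 (baseComp V)) := by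
  have : IsManifold (𝓡 n) 1 B := .of_le (n := ∞) (by simp)
  have h0 : (extChartAt (lineModel n) p : ℝ × B → ℝ × EuclideanSpace ℝ (Fin n)) =
      fun q ↦ (q.1, (extChartAt (𝓡 n) p.2 ∘ Prod.snd) q) := funext (extChartAt_lineModel p)
  have h1 : HasMFDerivAt (lineModel n) 𝓘(ℝ, ℝ) (Prod.fst : ℝ × B → ℝ) q _ := hasMFDerivAt_fst q
  have h2 : HasMFDerivAt (lineModel n) (𝓡 n) (Prod.snd : ℝ × B → B) q _ := hasMFDerivAt_snd q
  have h3 : HasMFDerivAt (𝓡 n) 𝓘(ℝ, EuclideanSpace ℝ (Fin n)) (extChartAt (𝓡 n) p.2) q.2 _ :=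
    (mdifferentiableAt_extChartAt (I := 𝓡 n) (by rwa [extChartAt_source] at hq)).hasMFDerivAt
  have h4 := HasMFDerivAt.prodMk_space h1 (h3.comp q h2)
  rw [h0]
  exact congrArg (fun L : TangentSpace (lineModel n) q →L[ℝ] ℝ × EuclideanSpace ℝ (Fin n) ↦ L V)
    h4.mfderiv

lemma chartRep_line {p : ℝ × B} {z : ℝ × EuclideanSpace ℝ (Fin n)}
    (hz : z.2 ∈ (extChartAt (𝓡 n) p.2).target) (X : Π p : ℝ × B, TangentSpace (lineModel n) p) :
    chartRep (lineModel n) p X z =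
      (lineComp (X (z.1, (extChartAt (𝓡 n) p.2).symm z.2)),
        chartComp p.2 ((extChartAt (𝓡 n) p.2).symm z.2)
          (baseComp (X (z.1, (extChartAt (𝓡 n) p.2).symm z.2)))) := by
  have key : ∀ q : ℝ × B, q = (z.1, (extChartAt (𝓡 n) p.2).symm z.2) →
      (mfderiv (lineModel n) 𝓘(ℝ, ℝ × EuclideanSpace ℝ (Fin n)) (extChartAt (lineModel n) p) q (X q) :
      ℝ × EuclideanSpace ℝ (Fin n)) = (lineComp (X (z.1, (extChartAt (𝓡 n) p.2).symm z.2)),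
        chartComp p.2 ((extChartAt (𝓡 n) p.2).symm z.2)
          (baseComp (X (z.1, (extChartAt (𝓡 n) p.2).symm z.2)))) := by
    rintro q rfl
    exact mfderiv_extChartAt_lineModel ((extChartAt (𝓡 n) p.2).map_target hz) _
  exact key _ (extChartAt_lineModel_symm p z)

lemma chartRep_verticalLift {p : ℝ × B} {z : ℝ × EuclideanSpace ℝ (Fin n)}
    (hz : z.2 ∈ (extChartAt (𝓡 n) p.2).target) (w : B → ℝ) (χ : Π y : B, TangentSpace (𝓡 n) y) :
    chartRep (lineModel n) p (verticalLift w χ) z =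
      (w ((extChartAt (𝓡 n) p.2).symm z.2), chartRep (𝓡 n) p.2 χ z.2) :=
  chartRep_line hz _

lemma eventually_mem_line_target {p q : ℝ × B} (hq : q.2 ∈ (extChartAt (𝓡 n) p.2).source) :
    ∀ᶠ z : ℝ × EuclideanSpace ℝ (Fin n) in 𝓝 (extChartAt (lineModel n) p q),
      z.2 ∈ (extChartAt (𝓡 n) p.2).target := by
  filter_upwards [(isOpen_extChartAt_target (I := lineModel n) p).mem_nhds
    ((extChartAt (lineModel n) p).map_source (mem_extChartAt_lineModel_source.2 hq))] with z hz
  exact mem_extChartAt_lineModel_target.1 hz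

lemma smoothFieldOn_verticalLift {w : B → ℝ} {χ : Π y : B, TangentSpace (𝓡 n) y}
    (hw : ContMDiff (𝓡 n) 𝓘(ℝ, ℝ) ∞ w) (hχ : SmoothFieldOn (𝓡 n) χ univ) :
    SmoothFieldOn (lineModel n) (verticalLift w χ) univ := by
  rw [smoothFieldOn_univ_iff] at hχ ⊢
  intro p
  have hp := mem_extChartAt_source (I := 𝓡 n) p.2
  rw [contMDiffAt_iff_chartRep (mem_extChartAt_source p)]
  have h1 := (contMDiffAt_iff_comp_symm hp).1 (hw p.2)
  have h2 := (contMDiffAt_iff_chartRep hp).1 (hχ p.2)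
  have h3 : extChartAt (lineModel n) p p = (p.1, extChartAt (𝓡 n) p.2 p.2) :=
    extChartAt_lineModel p p
  have h4 : ContDiffAt ℝ ∞ (fun z : ℝ × EuclideanSpace ℝ (Fin n) ↦
      (w ((extChartAt (𝓡 n) p.2).symm z.2), chartRep (𝓡 n) p.2 χ z.2))
      (extChartAt (lineModel n) p p) := by
    rw [h3]
    exact (ContDiffAt.comp (p.1, extChartAt (𝓡 n) p.2 p.2) h1 contDiffAt_snd).prodMk
      (ContDiffAt.comp (p.1, extChartAt (𝓡 n) p.2 p.2) h2 contDiffAt_snd)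
  refine h4.congr_of_eventuallyEq ?_
  filter_upwards [eventually_mem_line_target hp] with z hz using chartRep_verticalLift hz w χ

/-- The components of a vertical lift do not depend on the line coordinate, hence only `V.2` enters.
-/
lemma hasFDerivAt_chartRep_verticalLift {w : B → ℝ} {χ : Π y : B, TangentSpace (𝓡 n) y} {p : ℝ × B}
    (hw : ContMDiff (𝓡 n) 𝓘(ℝ, ℝ) ∞ w) (hχ : SmoothFieldOn (𝓡 n) χ univ)
    (V : ℝ × EuclideanSpace ℝ (Fin n)) :
    fderiv ℝ (chartRep (lineModel n) p (verticalLift w χ)) (extChartAt (lineModel n) p p) V =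
      (fderiv ℝ (w ∘ (extChartAt (𝓡 n) p.2).symm) (extChartAt (𝓡 n) p.2 p.2) V.2,
        fderiv ℝ (chartRep (𝓡 n) p.2 χ) (extChartAt (𝓡 n) p.2 p.2) V.2) := by
  rw [smoothFieldOn_univ_iff] at hχ
  have hp := mem_extChartAt_source (I := 𝓡 n) p.2
  have h1 := ((contMDiffAt_iff_comp_symm hp).1 (hw p.2)).differentiableAt (by simp)
  have h2 := ((contMDiffAt_iff_chartRep hp).1 (hχ p.2)).differentiableAt (by simp)
  have h0 : chartRep (lineModel n) p (verticalLift w χ) =ᶠ[𝓝 (extChartAt (lineModel n) p p)]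
      (fun z : ℝ × EuclideanSpace ℝ (Fin n) ↦
      ((w ∘ (extChartAt (𝓡 n) p.2).symm) z.2, chartRep (𝓡 n) p.2 χ z.2)) := by
    filter_upwards [eventually_mem_line_target hp] with z hz using chartRep_verticalLift hz w χ
  have h3 : extChartAt (lineModel n) p p = (p.1, extChartAt (𝓡 n) p.2 p.2) :=
    extChartAt_lineModel p p
  have hs : HasFDerivAt (Prod.snd : ℝ × EuclideanSpace ℝ (Fin n) → _)
    (ContinuousLinearMap.snd ℝ ℝ (EuclideanSpace ℝ (Fin n)))
    (p.1, extChartAt (𝓡 n) p.2 p.2) := hasFDerivAt_snd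
  have h4 := (HasFDerivAt.comp (p.1, extChartAt (𝓡 n) p.2 p.2) h1.hasFDerivAt hs).prodMk
    (HasFDerivAt.comp (p.1, extChartAt (𝓡 n) p.2 p.2) h2.hasFDerivAt hs)
  rw [h0.fderiv_eq, h3]
  exact congrArg (fun L : ℝ × EuclideanSpace ℝ (Fin n) →L[ℝ] ℝ × EuclideanSpace ℝ (Fin n) ↦ L V)
    h4.fderiv

/-- The Lie bracket of vertical lifts. -/
lemma verticalLift_mlieBracket {w₁ w₂ : B → ℝ} {χ₁ χ₂ : Π y : B, TangentSpace (𝓡 n) y}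
    (hw₁ : ContMDiff (𝓡 n) 𝓘(ℝ, ℝ) ∞ w₁) (hχ₁ : SmoothFieldOn (𝓡 n) χ₁ univ)
    (hw₂ : ContMDiff (𝓡 n) 𝓘(ℝ, ℝ) ∞ w₂) (hχ₂ : SmoothFieldOn (𝓡 n) χ₂ univ) :
    VectorField.mlieBracket (lineModel n) (verticalLift w₁ χ₁) (verticalLift w₂ χ₂) =
      verticalLift (fun y ↦ dirDeriv (𝓡 n) w₂ χ₁ y - dirDeriv (𝓡 n) w₁ χ₂ y)
        (VectorField.mlieBracket (𝓡 n) χ₁ χ₂) := by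
  have : IsManifold (𝓡 n) 1 B := .of_le (n := ∞) (by simp)
  have : IsManifold (lineModel n) 1 (ℝ × B) := .of_le (n := ∞) (by simp)
  funext p
  have hp := mem_extChartAt_source (I := 𝓡 n) p.2
  have hs₁ := smoothFieldOn_univ_iff.1 hχ₁ p.2
  have hs₂ := smoothFieldOn_univ_iff.1 hχ₂ p.2
  have h1 := chartRep_mlieBracket (mem_extChartAt_source p)
    (smoothFieldOn_univ_iff.1 (smoothFieldOn_verticalLift hw₁ hχ₁) p)
    (smoothFieldOn_univ_iff.1 (smoothFieldOn_verticalLift hw₂ hχ₂) p)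
  rw [chartRep_self, VectorField.lieBracket, hasFDerivAt_chartRep_verticalLift hw₁ hχ₁,
    hasFDerivAt_chartRep_verticalLift hw₂ hχ₂, chartRep_self, chartRep_self] at h1
  refine h1.trans ?_
  have h2 := chartRep_mlieBracket hp hs₁ hs₂
  rw [chartRep_self, VectorField.lieBracket, chartRep_self, chartRep_self] at h2
  have h3 (w : B → ℝ) (hw : ContMDiff (𝓡 n) 𝓘(ℝ, ℝ) ∞ w) (χ : Π y : B, TangentSpace (𝓡 n) y) :
      dirDeriv (𝓡 n) w χ p.2 =
        fderiv ℝ (w ∘ (extChartAt (𝓡 n) p.2).symm) (extChartAt (𝓡 n) p.2 p.2) (χ p.2) := by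
    have := (dirDeriv_comp_symm (X := χ) hp (hw p.2)).eq_of_nhds
    rw [chartRep_self] at this
    rw [← this, Function.comp_apply, (extChartAt (𝓡 n) p.2).left_inv hp]
  refine Prod.ext (α := ℝ) (β := EuclideanSpace ℝ (Fin n)) ?_ ?_
  · exact (congrArg₂ (· - ·) (h3 w₂ hw₂ χ₁) (h3 w₁ hw₁ χ₂)).symm
  · exact h2.symm

end LineCharts

/-! ### Infinitesimal automorphisms of the weak Carrollian structure -/

section PullbackForm

variable {E F : Type*} [NormedAddCommGroup E] [NormedSpace ℝ E] [NormedAddCommGroup F]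
  [NormedSpace ℝ F]

/-- Pullback of bilinear forms along a linear map. -/
noncomputable def pullbackForm (s : F →L[ℝ] E) : (E →L[ℝ] E →L[ℝ] ℝ) →L[ℝ] F →L[ℝ] F →L[ℝ] ℝ :=
  ContinuousLinearMap.compL ℝ F (E →L[ℝ] ℝ) (F →L[ℝ] ℝ) ((ContinuousLinearMap.compL ℝ F E ℝ).flip s) ∘L
    (ContinuousLinearMap.compL ℝ F E (E →L[ℝ] ℝ)).flip s

lemma pullbackForm_apply (s : F →L[ℝ] E) (b : E →L[ℝ] E →L[ℝ] ℝ) (v w : F) :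
    pullbackForm s b v w = b (s v) (s w) := rfl

lemma HasFDerivAt.clm_comp_clm {V W : Type*} [NormedAddCommGroup V] [NormedSpace ℝ V]
    [NormedAddCommGroup W] [NormedSpace ℝ W] (L : V →L[ℝ] W) (s : F →L[ℝ] E) {A : E → V}
    {A' : E →L[ℝ] V} {z : F} (hA : HasFDerivAt A A' (s z)) :
    HasFDerivAt (fun z ↦ L (A (s z))) (L.comp (A'.comp s)) z :=
  L.hasFDerivAt.comp z (hA.comp z s.hasFDerivAt)

variable {s : F →L[ℝ] E} {A : E → E →L[ℝ] E →L[ℝ] ℝ} {z : F}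

set_option synthInstance.maxHeartbeats 200000 in
lemma differentiableAt_pullbackForm_comp (hA : DifferentiableAt ℝ A (s z)) :
    DifferentiableAt ℝ (fun z ↦ pullbackForm s (A (s z))) z :=
  (HasFDerivAt.clm_comp_clm (V := E →L[ℝ] E →L[ℝ] ℝ) (W := F →L[ℝ] F →L[ℝ] ℝ)
    (pullbackForm s) s (A := A) hA.hasFDerivAt).differentiableAt

set_option synthInstance.maxHeartbeats 200000 in
lemma fderiv_pullbackForm_comp (hA : DifferentiableAt ℝ A (s z)) (V v w : F) :
    fderiv ℝ (fun z ↦ pullbackForm s (A (s z))) z V v w = fderiv ℝ A (s z) (s V) (s v) (s w) := by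
  rw [(HasFDerivAt.clm_comp_clm (V := E →L[ℝ] E →L[ℝ] ℝ) (W := F →L[ℝ] F →L[ℝ] ℝ)
    (pullbackForm s) s (A := A) hA.hasFDerivAt).fderiv]
  rfl

end PullbackForm

namespace AsymptoticallyFlat

variable {kind : InfinityKind} {n : ℕ} {B : Type*} [TopologicalSpace B]
  [ChartedSpace (EuclideanSpace ℝ (Fin n)) B] [IsManifold (𝓡 n) ∞ B]
  (S : AsymptoticallyFlat kind n B)

lemma carrollMetric_apply (p : ℝ × B) (V W : TangentSpace (lineModel n) p) :
    S.carrollMetric p V W = S.h p.2 (baseComp V) (baseComp W) := by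
  rw [carrollMetric, mfderiv_snd_line, mfderiv_snd_line]

lemma tensorRep_chartComp (y₀ : B) {x : EuclideanSpace ℝ (Fin n)}
    (hx : x ∈ (extChartAt (𝓡 n) y₀).target)
    (v w : TangentSpace (𝓡 n) ((extChartAt (𝓡 n) y₀).symm x)) :
    S.h _ v w = tensorRep S.h y₀ x (chartComp y₀ _ v) (chartComp y₀ _ w) := by
  obtain ⟨X, rfl, -⟩ := exists_local_extension _ v
  obtain ⟨Y, rfl, -⟩ := exists_local_extension _ w
  exact tensorRep_chartRep S.h y₀ hx X Y

/-- In product charts the projection to `B` is linear, so the components of the pulled back metric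
are the linear pullback of those of `h`. -/
lemma carrollMetric_chart (p : ℝ × B) {z : ℝ × EuclideanSpace ℝ (Fin n)}
    (hz : z ∈ (extChartAt (lineModel n) p).target) (X Y : Π p : ℝ × B, TangentSpace (lineModel n) p) :
    S.carrollMetric ((extChartAt (lineModel n) p).symm z) (X _) (Y _) =
      pullbackForm (ContinuousLinearMap.snd ℝ ℝ (EuclideanSpace ℝ (Fin n))) (tensorRep S.h p.2 z.2)
        (chartRep (lineModel n) p X z) (chartRep (lineModel n) p Y z) := by
  have hz' := mem_extChartAt_lineModel_target.1 hz
  rw [pullbackForm_apply, chartRep_line hz', chartRep_line hz', carrollMetric_apply]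
  have key : ∀ q : ℝ × B, q = (z.1, (extChartAt (𝓡 n) p.2).symm z.2) →
      S.h q.2 (baseComp (X q)) (baseComp (Y q)) = tensorRep S.h p.2 z.2
        (chartComp p.2 ((extChartAt (𝓡 n) p.2).symm z.2)
          (baseComp (X (z.1, (extChartAt (𝓡 n) p.2).symm z.2))))
        (chartComp p.2 ((extChartAt (𝓡 n) p.2).symm z.2)
          (baseComp (Y (z.1, (extChartAt (𝓡 n) p.2).symm z.2)))) := by
    rintro q rfl
    exact S.tensorRep_chartComp p.2 hz' _ _
  exact key _ (extChartAt_lineModel_symm p z)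

/-- The Lie derivative of the degenerate metric along `w ∂_u + χ`. -/
lemma lieDerivTensor_carrollMetric {w : B → ℝ} {χ : Π y : B, TangentSpace (𝓡 n) y}
    (hw : ContMDiff (𝓡 n) 𝓘(ℝ, ℝ) ∞ w) (hχ : SmoothFieldOn (𝓡 n) χ univ) {p : ℝ × B}
    {Y Z : Π p : ℝ × B, TangentSpace (lineModel n) p} {Y' Z' : Π y : B, TangentSpace (𝓡 n) y}
    (hY : ContMDiffAt (lineModel n) (lineModel n).tangent ∞
      (fun z ↦ (⟨z, Y z⟩ : TangentBundle (lineModel n) (ℝ × B))) p)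
    (hZ : ContMDiffAt (lineModel n) (lineModel n).tangent ∞
      (fun z ↦ (⟨z, Z z⟩ : TangentBundle (lineModel n) (ℝ × B))) p)
    (hY' : ContMDiffAt (𝓡 n) (𝓡 n).tangent ∞ (fun z ↦ (⟨z, Y' z⟩ : TangentBundle (𝓡 n) B)) p.2)
    (hZ' : ContMDiffAt (𝓡 n) (𝓡 n).tangent ∞ (fun z ↦ (⟨z, Z' z⟩ : TangentBundle (𝓡 n) B)) p.2)
    (hYY : baseComp (Y p) = Y' p.2) (hZZ : baseComp (Z p) = Z' p.2) :
    lieDerivTensor (lineModel n) S.carrollMetric (verticalLift w χ) Y Z p =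
      lieDerivTensor (𝓡 n) (fun x v w ↦ S.h x v w) χ Y' Z' p.2 := by
  have hp := mem_extChartAt_source (I := 𝓡 n) p.2
  have hA := (contDiffAt_tensorRep S.h_smooth hp).differentiableAt (by simp)
  have h3 : extChartAt (lineModel n) p p = (p.1, extChartAt (𝓡 n) p.2 p.2) :=
    extChartAt_lineModel p p
  have hA' : DifferentiableAt ℝ (fun z : ℝ × EuclideanSpace ℝ (Fin n) ↦
      pullbackForm (ContinuousLinearMap.snd ℝ ℝ (EuclideanSpace ℝ (Fin n))) (tensorRep S.h p.2 z.2))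
      (extChartAt (lineModel n) p p) :=
    differentiableAt_pullbackForm_comp (s := ContinuousLinearMap.snd ℝ ℝ (EuclideanSpace ℝ (Fin n)))
      (by rw [h3]; exact hA)
  have hA'' (V v w : ℝ × EuclideanSpace ℝ (Fin n)) : fderiv ℝ (fun z : ℝ × EuclideanSpace ℝ (Fin n) ↦
      pullbackForm (ContinuousLinearMap.snd ℝ ℝ (EuclideanSpace ℝ (Fin n))) (tensorRep S.h p.2 z.2))
      (extChartAt (lineModel n) p p) V v w =
      fderiv ℝ (tensorRep S.h p.2) (extChartAt (𝓡 n) p.2 p.2) V.2 v.2 w.2 := by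
    refine (fderiv_pullbackForm_comp (s := ContinuousLinearMap.snd ℝ ℝ (EuclideanSpace ℝ (Fin n)))
      (by rw [h3]; exact hA) V v w).trans ?_
    rw [h3]; rfl
  -- The chart formula sees the test fields only through their values at the point, so agreement of
  -- `Y` with `Y'` and of `Z` with `Z'` there is enough.
  rw [lieDerivTensor_eq_of_chart hA' (fun z hz X Y ↦ S.carrollMetric_chart p hz X Y)
      (smoothFieldOn_univ_iff.1 (smoothFieldOn_verticalLift hw hχ) p) hY hZ,
    lieDerivTensor_eq_of_chart hA (fun z hz X Y ↦ tensorRep_chartRep S.h p.2 hz X Y)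
      (smoothFieldOn_univ_iff.1 hχ p.2) hY' hZ']
  have key (V : TangentSpace (lineModel n) p) :=
    hasFDerivAt_chartRep_verticalLift (p := p) hw hχ V
  rw [key, key, ← hYY, ← hZZ]
  refine congrArg₂ (· + ·) (congrArg₂ (· + ·) (hA'' _ _ _) ?_) ?_
  all_goals rw [h3]; rfl

/-- Because only the values of the test fields at one point matter, test fields on `B` and on `ℝ ×
B` can be exchanged for local extensions of the corresponding vectors. Any point over `y` would
serve in place of `(0, y)`. -/
lemma preservesTensor_verticalLift_iff {w : B → ℝ} {χ : Π y : B, TangentSpace (𝓡 n) y}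
    (hw : ContMDiff (𝓡 n) 𝓘(ℝ, ℝ) ∞ w) (hχ : SmoothFieldOn (𝓡 n) χ univ) :
    PreservesTensor (lineModel n) S.carrollMetric (verticalLift w χ) ↔
      PreservesTensor (𝓡 n) (fun x v w ↦ S.h x v w) χ := by
  constructor
  · intro h y Y Z hY hZ
    obtain ⟨Y₁, hY₁, hY₁'⟩ := exists_local_extension (I := lineModel n) ((0 : ℝ), y) (lineVec 0 (Y y))
    obtain ⟨Z₁, hZ₁, hZ₁'⟩ := exists_local_extension (I := lineModel n) ((0 : ℝ), y) (lineVec 0 (Z y))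
    refine Eq.trans (Eq.symm ?_) (h (0, y) Y₁ Z₁ hY₁' hZ₁')
    exact S.lieDerivTensor_carrollMetric hw hχ hY₁'.self_of_nhds hZ₁'.self_of_nhds
      hY.self_of_nhds hZ.self_of_nhds (by rw [hY₁]; rfl) (by rw [hZ₁]; rfl)
  · intro h p Y Z hY hZ
    obtain ⟨Y₁, hY₁, hY₁'⟩ := exists_local_extension (I := 𝓡 n) p.2 (baseComp (Y p))
    obtain ⟨Z₁, hZ₁, hZ₁'⟩ := exists_local_extension (I := 𝓡 n) p.2 (baseComp (Z p))
    refine Eq.trans ?_ (h p.2 Y₁ Z₁ hY₁' hZ₁')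
    exact S.lieDerivTensor_carrollMetric hw hχ hY.self_of_nhds hZ.self_of_nhds
      hY₁'.self_of_nhds hZ₁'.self_of_nhds hY₁.symm hZ₁.symm

lemma carrollVector_eq : carrollVector (n := n) (B := B) = verticalLift (fun _ ↦ 1) 0 := rfl

lemma smoothFieldOn_zero : SmoothFieldOn (𝓡 n) (0 : Π y : B, TangentSpace (𝓡 n) y) univ :=
  smoothFieldOn_univ_iff.2 (Bundle.contMDiff_zeroSection ℝ (TangentSpace (𝓡 n) : B → Type _))

lemma mlieBracket_verticalLift_carrollVector {w : B → ℝ} {χ : Π y : B, TangentSpace (𝓡 n) y}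
    (hw : ContMDiff (𝓡 n) 𝓘(ℝ, ℝ) ∞ w) (hχ : SmoothFieldOn (𝓡 n) χ univ) :
    VectorField.mlieBracket (lineModel n) (verticalLift w χ) (carrollVector (n := n) (B := B)) = 0 := by
  rw [carrollVector_eq, verticalLift_mlieBracket hw hχ contMDiff_const smoothFieldOn_zero,
    VectorField.mlieBracket_zero_right]
  funext p
  refine tangent_ext ?_ rfl
  change dirDeriv (𝓡 n) (fun _ ↦ (1 : ℝ)) χ p.2 - dirDeriv (𝓡 n) w 0 p.2 = 0
  have h1 : dirDeriv (𝓡 n) (fun _ ↦ (1 : ℝ)) χ p.2 = 0 := by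
    rw [dirDeriv, mfderiv_const]; rfl
  have h2 : dirDeriv (𝓡 n) w 0 p.2 = 0 := map_zero _
  rw [h1, h2, sub_zero]

/-- A vector field commuting with `∂_u` does not depend on `u`. -/
lemma eq_verticalLift_of_commute {X : Π p : ℝ × B, TangentSpace (lineModel n) p}
    (hX : SmoothFieldOn (lineModel n) X univ)
    (h : ∀ p, VectorField.mlieBracket (lineModel n) X (carrollVector (n := n) (B := B)) p = 0) :
    X = verticalLift (fun y ↦ lineComp (X (0, y))) (fun y ↦ baseComp (X (0, y))) := by
  have : IsManifold (lineModel n) 1 (ℝ × B) := .of_le (n := ∞) (by simp)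
  have hX' := smoothFieldOn_univ_iff.1 hX
  -- The field `∂_u` has constant components, so in a chart its bracket with `X` is minus the
  -- `u`-derivative of the components of `X`.
  have key (y : B) (u : ℝ) : HasDerivAt
      (fun u : ℝ ↦ chartRep (lineModel n) (0, y) X (u, extChartAt (𝓡 n) y y)) 0 u := by
    have h1 := chartRep_mlieBracket (mem_extChartAt_source (u, y)) (hX' (u, y))
      (smoothFieldOn_univ_iff.1
        (smoothFieldOn_verticalLift (n := n) (B := B) (contMDiff_const (c := (1 : ℝ)))
          smoothFieldOn_zero) (u, y))
    rw [← carrollVector_eq, chartRep_self, h, VectorField.lieBracket, chartRep_self, chartRep_self] at h1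
    have h4 : fderiv ℝ (chartRep (lineModel n) (u, y) X) (extChartAt (lineModel n) (u, y) (u, y))
        ((1, 0) : ℝ × EuclideanSpace ℝ (Fin n)) = 0 := by
      have h2 : chartRep (𝓡 n) y (0 : Π y : B, TangentSpace (𝓡 n) y) = 0 := funext fun z ↦ map_zero _
      have k (V : ℝ × EuclideanSpace ℝ (Fin n)) : fderiv ℝ (chartRep (lineModel n) (u, y)
          (carrollVector (n := n) (B := B))) (extChartAt (lineModel n) (u, y) (u, y)) V = 0 := by
        refine (hasFDerivAt_chartRep_verticalLift (p := (u, y)) (w := fun _ ↦ 1)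
          (χ := 0) contMDiff_const smoothFieldOn_zero V).trans ?_
        rw [h2]
        have h5 (x : EuclideanSpace ℝ (Fin n)) : fderiv ℝ ((fun _ ↦ 1) ∘ (extChartAt (𝓡 n) y).symm :
          EuclideanSpace ℝ (Fin n) → ℝ) x = 0 := fderiv_const_apply _
        refine Prod.ext ?_ ?_
        · exact (DFunLike.congr_fun (h5 _) _).trans rfl
        · simp
      have g : ∀ a b : ℝ × EuclideanSpace ℝ (Fin n), 0 = a - b → a = 0 → b = 0 := by
        rintro a b h rfl
        simpa using h.symm
      exact g _ _ h1 (k _)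
    have h6 := ((contMDiffAt_iff_chartRep (mem_extChartAt_source (u, y))).1
      (hX' (u, y))).differentiableAt (by simp)
    rw [extChartAt_lineModel] at h4 h6
    have h7 : HasDerivAt (fun u : ℝ ↦ (u, extChartAt (𝓡 n) y y)) (1, 0) u :=
      (hasDerivAt_id u).prodMk (hasDerivAt_const u _)
    have h8 := h6.hasFDerivAt.comp_hasDerivAt u h7
    rw [h4] at h8
    refine h8.congr_of_eventuallyEq (Eventually.of_forall fun v ↦ ?_)
    have ht := mem_extChartAt_target (I := 𝓡 n) y
    -- The charts centred at `(0, y)` and `(u, y)` give the same components, the line being charted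
    -- by the identity.
    change chartRep (lineModel n) (0, y) X (v, _) = chartRep (lineModel n) (u, y) X (v, _)
    rw [chartRep_line (p := (0, y)) (z := (v, extChartAt (𝓡 n) y y)) ht,
      chartRep_line (p := (u, y)) (z := (v, extChartAt (𝓡 n) y y)) ht]
  have const (y : B) (u : ℝ) : chartRep (lineModel n) (0, y) X (u, extChartAt (𝓡 n) y y) =
      chartRep (lineModel n) (0, y) X (0, extChartAt (𝓡 n) y y) :=
    is_const_of_deriv_eq_zero (fun u ↦ (key y u).differentiableAt) (fun u ↦ (key y u).deriv) _ _
  funext ⟨u, y⟩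
  have ht := mem_extChartAt_target (I := 𝓡 n) y
  have e (v : ℝ) : chartRep (lineModel n) (0, y) X (v, extChartAt (𝓡 n) y y) = X (v, y) := by
    rw [chartRep_line (p := (0, y)) (z := (v, extChartAt (𝓡 n) y y)) ht,
      ← chartRep_line (p := (v, y)) (z := (v, extChartAt (𝓡 n) y y)) ht]
    have := chartRep_self (v, y) X
    rwa [extChartAt_lineModel] at this
  exact ((e u).symm.trans (const y u)).trans (e 0)

lemma smooth_components {X : Π p : ℝ × B, TangentSpace (lineModel n) p}
    (hX : SmoothFieldOn (lineModel n) X univ) :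
    ContMDiff (𝓡 n) 𝓘(ℝ, ℝ) ∞ (fun y : B ↦ lineComp (X (0, y))) ∧
      SmoothFieldOn (𝓡 n) (fun y : B ↦ baseComp (X (0, y))) univ := by
  have key (y : B) : ContDiffAt ℝ ∞ (fun x ↦ chartRep (lineModel n) (0, y) X (0, x))
      (extChartAt (𝓡 n) y y) := by
    have h1 := (contMDiffAt_iff_chartRep (mem_extChartAt_source ((0 : ℝ), y))).1
      (smoothFieldOn_univ_iff.1 hX (0, y))
    rw [extChartAt_lineModel] at h1
    exact h1.comp (extChartAt (𝓡 n) y y) (contDiffAt_const.prodMk contDiffAt_id)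
  rw [smoothFieldOn_univ_iff]
  refine ⟨fun y ↦ ?_, fun y ↦ ?_⟩
  · rw [contMDiffAt_iff_comp_symm (mem_extChartAt_source y)]
    refine (contDiffAt_fst.comp _ (key y)).congr_of_eventuallyEq ?_
    filter_upwards [(isOpen_extChartAt_target (I := 𝓡 n) y).mem_nhds (mem_extChartAt_target y)]
      with x hx
    exact (congrArg Prod.fst (chartRep_line (p := ((0 : ℝ), y)) (z := (0, x)) hx X)).symm
  · rw [contMDiffAt_iff_chartRep (mem_extChartAt_source y)]
    refine (contDiffAt_snd.comp _ (key y)).congr_of_eventuallyEq ?_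
    filter_upwards [(isOpen_extChartAt_target (I := 𝓡 n) y).mem_nhds (mem_extChartAt_target y)]
      with x hx
    exact (congrArg Prod.snd (chartRep_line (p := ((0 : ℝ), y)) (z := (0, x)) hx X)).symm

/-- Commuting with `∂_u` forces the shape of a vertical lift; on vertical lifts, preserving the
degenerate metric is the Killing equation for `χ`. -/
theorem isCarrollAutomorphism_iff (X : Π p : ℝ × B, TangentSpace (lineModel n) p) :
    S.IsCarrollAutomorphism X ↔ ∃ w χ, ContMDiff (𝓡 n) 𝓘(ℝ, ℝ) ∞ w ∧
      IsKilling (𝓡 n) S.h χ ∧ X = verticalLift w χ := by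
  constructor
  · rintro ⟨hX, hT, hn⟩
    have h1 := eq_verticalLift_of_commute hX hn
    obtain ⟨hw, hχ⟩ := smooth_components hX
    refine ⟨_, _, hw, ⟨hχ, ?_⟩, h1⟩
    rw [h1] at hT
    exact (S.preservesTensor_verticalLift_iff hw hχ).1 hT
  · rintro ⟨w, χ, hw, hχ, rfl⟩
    exact ⟨smoothFieldOn_verticalLift hw hχ.1, (S.preservesTensor_verticalLift_iff hw hχ.1).2 hχ.2,
      fun p ↦ congrFun (mlieBracket_verticalLift_carrollVector hw hχ.1) p⟩

end AsymptoticallyFlat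

/-! ### Taylor expansions at the boundary of a half-space -/

section HalfSpace

variable {E : Type*} [NormedAddCommGroup E] [NormedSpace ℝ E]
  {V : Type*} [NormedAddCommGroup V] [NormedSpace ℝ V]

/-- The half-space `[0, ∞) × E`. -/
def halfSpace (E : Type*) : Set (ℝ × E) := {z | 0 ≤ z.1}

/-- The one-sided normal derivative in a half-space. -/
noncomputable def dRho (f : ℝ × E → V) (z : ℝ × E) : V := fderivWithin ℝ f (halfSpace E) z (1, 0)

/-- The tangential derivative in a half-space. -/
noncomputable def dTan (f : ℝ × E → V) (z : ℝ × E) : E →L[ℝ] V :=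
  (fderivWithin ℝ f (halfSpace E) z).comp (ContinuousLinearMap.inr ℝ ℝ E)

/-- All normal derivatives up to order `k` vanish on the boundary, near `x₀`. -/
def FlatAt (k : ℕ) (f : ℝ × E → V) (x₀ : E) : Prop :=
  ∀ j ≤ k, ∀ᶠ x in 𝓝 x₀, dRho^[j] f (0, x) = 0

lemma halfSpace_eq_prod : halfSpace E = Ici (0 : ℝ) ×ˢ univ := by
  ext z; simp [halfSpace]

lemma convex_halfSpace : Convex ℝ (halfSpace E) := by
  rw [halfSpace_eq_prod]; exact (convex_Ici 0).prod convex_univ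

lemma uniqueDiffOn_halfSpace : UniqueDiffOn ℝ (halfSpace E) := by
  rw [halfSpace_eq_prod]; exact (uniqueDiffOn_Ici 0).prod uniqueDiffOn_univ

lemma halfSpace_subset_closure : halfSpace E ⊆ closure (interior (halfSpace E)) := by
  rw [halfSpace_eq_prod, interior_prod_eq, closure_prod_eq, interior_Ici, closure_Ioi]
  simp

lemma zero_mem_halfSpace (x : E) : ((0 : ℝ), x) ∈ halfSpace E := le_refl (0 : ℝ)

/-- In the maximum metric, decreasing the first coordinate towards `0` does not increase the
distance to `(0, x₀)`. This lets local estimates be integrated along normal segments. -/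
lemma eventually_segment {P : ℝ × E → Prop} {x₀ : E} (h : ∀ᶠ z in 𝓝[halfSpace E] (0, x₀), P z) :
    ∀ᶠ z in 𝓝[halfSpace E] (0, x₀), ∀ t ∈ Icc 0 z.1, P (t, z.2) := by
  obtain ⟨r, hr, H⟩ := Metric.mem_nhdsWithin_iff.1 h
  refine Metric.mem_nhdsWithin_iff.2 ⟨r, hr, fun z hz t ht ↦ H ⟨?_, ht.1⟩⟩
  have := hz.1
  rw [Metric.mem_ball, Prod.dist_eq, max_lt_iff] at this ⊢
  refine ⟨lt_of_le_of_lt ?_ this.1, this.2⟩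
  rw [Real.dist_eq, Real.dist_eq, sub_zero, sub_zero, abs_of_nonneg ht.1]
  exact ht.2.trans (le_abs_self _)

lemma eventually_boundary {P : ℝ × E → Prop} {x₀ : E} (h : ∀ᶠ z in 𝓝[halfSpace E] (0, x₀), P z) :
    ∀ᶠ x in 𝓝 x₀, P (0, x) := by
  have h1 : Tendsto (fun x : E ↦ ((0 : ℝ), x)) (𝓝 x₀) (𝓝[halfSpace E] (0, x₀)) :=
    tendsto_nhdsWithin_iff.2 ⟨(Continuous.prodMk_right (0 : ℝ)).continuousAt,
      Eventually.of_forall zero_mem_halfSpace⟩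
  exact h1.eventually h

lemma eventually_of_boundary {P : E → Prop} {x₀ : E} (h : ∀ᶠ x in 𝓝 x₀, P x) :
    ∀ᶠ z in 𝓝[halfSpace E] ((0 : ℝ), x₀), P z.2 :=
  ((continuous_snd.tendsto ((0 : ℝ), x₀)).eventually h).filter_mono nhdsWithin_le_nhds

lemma eventually_ray {P : ℝ × E → Prop} {x₀ : E} (h : ∀ᶠ z in 𝓝[halfSpace E] (0, x₀), P z) :
    ∀ᶠ x in 𝓝 x₀, ∀ᶠ t in 𝓝[≥] (0 : ℝ), P (t, x) := by
  filter_upwards [eventually_boundary (eventually_eventually_nhdsWithin.2 h)] with x hx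
  have h1 : Tendsto (fun t : ℝ ↦ (t, x)) (𝓝[≥] 0) (𝓝[halfSpace E] (0, x)) :=
    tendsto_nhdsWithin_iff.2 ⟨(Continuous.prodMk_left x).continuousAt.tendsto.mono_left
      nhdsWithin_le_nhds, eventually_mem_nhdsWithin⟩
  exact h1.eventually hx

lemma hasDerivWithinAt_dRho {f : ℝ × E → V} {t : ℝ} {x : E}
    (hf : DifferentiableWithinAt ℝ f (halfSpace E) (t, x)) :
    HasDerivWithinAt (fun s ↦ f (s, x)) (dRho f (t, x)) (Ici 0) t := by
  have h1 : HasDerivWithinAt (fun s : ℝ ↦ (s, x)) (1, 0) (Ici 0) t :=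
    ((hasDerivAt_id t).prodMk (hasDerivAt_const t x)).hasDerivWithinAt
  exact hf.hasFDerivWithinAt.comp_hasDerivWithinAt t h1 fun s hs ↦ hs

lemma fderivWithin_halfSpace_apply (f : ℝ × E → V) (z v : ℝ × E) :
    fderivWithin ℝ f (halfSpace E) z v = v.1 • dRho f z + dTan f z v.2 := by
  have : v = v.1 • ((1, 0) : ℝ × E) + (0, v.2) := by ext <;> simp
  conv_lhs => rw [this, map_add, map_smul]
  rfl

/-! ### Functions flat at the boundary, and powers of the boundary distance. -/

section Smooth

variable {f g : ℝ × E → V} {x₀ : E}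

lemma ContDiffWithinAt.eventually_differentiable
    (hf : ContDiffWithinAt ℝ ∞ f (halfSpace E) (0, x₀)) :
    ∀ᶠ z in 𝓝[halfSpace E] (0, x₀), DifferentiableWithinAt ℝ f (halfSpace E) z := by
  have h := (hf.of_le (m := 1) (WithTop.coe_le_coe.2 le_top)).eventually (by simp)
  rw [insert_eq_of_mem (zero_mem_halfSpace x₀)] at h
  exact h.mono fun z hz ↦ hz.differentiableWithinAt (by simp)

lemma ContDiffWithinAt.fderivWithin_halfSpace (hf : ContDiffWithinAt ℝ ∞ f (halfSpace E) (0, x₀)) :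
    ContDiffWithinAt ℝ ∞ (fderivWithin ℝ f (halfSpace E)) (halfSpace E) (0, x₀) :=
  hf.fderivWithin_right uniqueDiffOn_halfSpace (by simp) (zero_mem_halfSpace x₀)

lemma ContDiffWithinAt.dRho (hf : ContDiffWithinAt ℝ ∞ f (halfSpace E) (0, x₀)) :
    ContDiffWithinAt ℝ ∞ (dRho f) (halfSpace E) (0, x₀) :=
  hf.fderivWithin_halfSpace.clm_apply contDiffWithinAt_const

lemma ContDiffWithinAt.dTan (hf : ContDiffWithinAt ℝ ∞ f (halfSpace E) (0, x₀)) :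
    ContDiffWithinAt ℝ ∞ (dTan f) (halfSpace E) (0, x₀) :=
  hf.fderivWithin_halfSpace.clm_comp contDiffWithinAt_const

lemma Filter.EventuallyEq.dRho (h : f =ᶠ[𝓝[halfSpace E] (0, x₀)] g) :
    dRho f =ᶠ[𝓝[halfSpace E] (0, x₀)] dRho g := by
  filter_upwards [h.fderivWithin' (𝕜 := ℝ) subset_rfl] with z hz
  simp only [_root_.dRho, hz]

lemma Filter.EventuallyEq.iterate_dRho (h : f =ᶠ[𝓝[halfSpace E] (0, x₀)] g) (j : ℕ) :
    _root_.dRho^[j] f =ᶠ[𝓝[halfSpace E] (0, x₀)] _root_.dRho^[j] g := by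
  induction j generalizing f g with
  | zero => exact h
  | succ j ih => exact ih h.dRho

lemma FlatAt.congr {k : ℕ} (hf : FlatAt k f x₀) (h : f =ᶠ[𝓝[halfSpace E] (0, x₀)] g) :
    FlatAt k g x₀ := fun j hj ↦ by
  filter_upwards [hf j hj, eventually_boundary (h.iterate_dRho j)] with x h1 h2
  rw [← h2, h1]

lemma flatAt_succ {k : ℕ} : FlatAt (k + 1) f x₀ ↔ FlatAt 0 f x₀ ∧ FlatAt k (dRho f) x₀ := by
  constructor
  · intro h
    exact ⟨fun j hj ↦ h j (by omega), fun j hj ↦ h (j + 1) (by omega)⟩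
  · rintro ⟨h1, h2⟩ j hj
    cases j with
    | zero => exact h1 0 le_rfl
    | succ j => exact h2 j (by omega)

/-- Symmetry of second derivatives, valid up to the boundary because the half-space lies in the
closure of its interior. -/
lemma dRho_dTan (hf : ContDiffWithinAt ℝ ∞ f (halfSpace E) (0, x₀)) :
    dRho (dTan f) =ᶠ[𝓝[halfSpace E] (0, x₀)] dTan (dRho f) := by
  have h := (hf.of_le (m := 2) (WithTop.coe_le_coe.2 le_top)).eventually (by simp)
  rw [insert_eq_of_mem (zero_mem_halfSpace x₀)] at h
  filter_upwards [h, eventually_mem_nhdsWithin, hf.fderivWithin_halfSpace.eventually_differentiable]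
    with z hz hz' hd
  have hs := hz.isSymmSndFDerivWithinAt (by simp) uniqueDiffOn_halfSpace
    (halfSpace_subset_closure hz') hz'
  have hu := uniqueDiffOn_halfSpace z hz'
  have e1 : fderivWithin ℝ (dTan f) (halfSpace E) z = _ :=
    (hd.hasFDerivWithinAt.clm_comp (hasFDerivWithinAt_const (ContinuousLinearMap.inr ℝ ℝ E) z _)).fderivWithin hu
  have e2 : fderivWithin ℝ (dRho f) (halfSpace E) z = _ :=
    (hd.hasFDerivWithinAt.clm_apply (hasFDerivWithinAt_const ((1, 0) : ℝ × E) z _)).fderivWithin hu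
  ext v
  rw [dRho, e1, dTan, e2]
  simpa using hs (1, 0) (0, v)

lemma FlatAt.dTan_zero (hf : ContDiffWithinAt ℝ ∞ f (halfSpace E) (0, x₀)) (h : FlatAt 0 f x₀) :
    FlatAt 0 (dTan f) x₀ := by
  intro j hj
  obtain rfl : j = 0 := by omega
  filter_upwards [(h 0 le_rfl).eventually_nhds, eventually_boundary hf.eventually_differentiable]
    with x hx hd
  have h1 : HasFDerivWithinAt (fun x : E ↦ ((0 : ℝ), x)) (ContinuousLinearMap.inr ℝ ℝ E) univ x :=
    (hasFDerivAt_prodMk_right (0 : ℝ) x).hasFDerivWithinAt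
  have h2 := hd.hasFDerivWithinAt.comp x h1 fun s _ ↦ zero_mem_halfSpace s
  rw [hasFDerivWithinAt_univ] at h2
  exact h2.unique ((hasFDerivAt_const (0 : V) x).congr_of_eventuallyEq hx)

/-- A function vanishing on the boundary has vanishing tangential derivatives there, and tangential
derivatives commute with normal ones. This is why flatness, unlike a little-o condition, can be
differentiated. -/
lemma FlatAt.dTan {k : ℕ} (hf : ContDiffWithinAt ℝ ∞ f (halfSpace E) (0, x₀)) (h : FlatAt k f x₀) :
    FlatAt k (dTan f) x₀ := by
  induction k generalizing f with
  | zero => exact FlatAt.dTan_zero hf h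
  | succ k ih =>
    rw [flatAt_succ] at h ⊢
    exact ⟨FlatAt.dTan_zero hf h.1, (ih hf.dRho h.2).congr (dRho_dTan hf).symm⟩

/-- The mean value inequality on `[0, ρ]`, where `C t ^ k ≤ C ρ ^ k`. The sharper factor `1 / (k +
1)` is not needed. -/
lemma norm_le_of_dRho {C ρ : ℝ} {k : ℕ} {φ ψ : ℝ → V} (hρ : 0 ≤ ρ)
    (h : ∀ t ∈ Icc 0 ρ, HasDerivWithinAt φ (ψ t) (Ici 0) t) (h0 : φ 0 = 0)
    (hψ : ∀ t ∈ Icc 0 ρ, ‖ψ t‖ ≤ C * t ^ k) (hC : 0 ≤ C) : ‖φ ρ‖ ≤ C * ρ ^ (k + 1) := by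
  have := (convex_Icc 0 ρ).norm_image_sub_le_of_norm_hasDerivWithin_le (f := φ) (f' := ψ)
    (C := C * ρ ^ k) (fun t ht ↦ (h t ht).mono Icc_subset_Ici_self)
    (fun t ht ↦ (hψ t ht).trans (by have := ht.1; have := ht.2; gcongr))
    (left_mem_Icc.2 hρ) (right_mem_Icc.2 hρ)
  rw [h0, sub_zero, sub_zero, Real.norm_of_nonneg hρ] at this
  rwa [pow_succ, ← mul_assoc]

/-- Integration in the normal direction from the boundary, where `f` vanishes, gains one power of
`ρ`. -/
lemma isBigO_of_dRho {k : ℕ} (hf : ContDiffWithinAt ℝ ∞ f (halfSpace E) (0, x₀))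
    (h0 : FlatAt 0 f x₀)
    (h : dRho f =O[𝓝[halfSpace E] (0, x₀)] fun z ↦ z.1 ^ k) :
    f =O[𝓝[halfSpace E] (0, x₀)] fun z ↦ z.1 ^ (k + 1) := by
  obtain ⟨C, hC, hb⟩ := h.exists_pos
  refine IsBigO.of_bound C ?_
  filter_upwards [eventually_segment (hb.bound.and hf.eventually_differentiable),
    eventually_mem_nhdsWithin, eventually_of_boundary (h0 0 le_rfl)] with z hz hz' hz0
  have hz' : 0 ≤ z.1 := hz'
  rw [Real.norm_of_nonneg (by positivity)]
  refine norm_le_of_dRho (φ := fun t ↦ f (t, z.2)) hz'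
    (fun t ht ↦ hasDerivWithinAt_dRho (hz t ht).2) hz0 (fun t ht ↦ ?_) hC.le
  have := (hz t ht).1
  rwa [Real.norm_of_nonneg (pow_nonneg ht.1 _)] at this

lemma ContDiffWithinAt.isBigO_one (hf : ContDiffWithinAt ℝ ∞ f (halfSpace E) (0, x₀)) :
    f =O[𝓝[halfSpace E] (0, x₀)] fun _ ↦ (1 : ℝ) :=
  hf.continuousWithinAt.tendsto.isBigO_one ℝ

/-- Repeated normal integration, starting from the boundedness of the last derivative. The exponent
exceeds the order of flatness by one: smoothness improves `o(ρ ^ k)` to `O(ρ ^ (k + 1))`. -/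
lemma FlatAt.isBigO {k : ℕ} (hf : ContDiffWithinAt ℝ ∞ f (halfSpace E) (0, x₀)) (h : FlatAt k f x₀) :
    f =O[𝓝[halfSpace E] (0, x₀)] fun z ↦ z.1 ^ (k + 1) := by
  induction k generalizing f with
  | zero => exact isBigO_of_dRho hf h (by simpa using hf.dRho.isBigO_one)
  | succ k ih =>
    rw [flatAt_succ] at h
    exact isBigO_of_dRho hf h.1 (ih hf.dRho h.2)

/-- The Taylor expansion along rays transverse to the boundary. -/
lemma FlatAt.isLittleO_ray {k : ℕ} (hf : ContDiffWithinAt ℝ ∞ f (halfSpace E) (0, x₀))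
    (h : FlatAt k f x₀) : ∀ᶠ x in 𝓝 x₀,
      (fun t ↦ f (t, x) - (t ^ (k + 1) / (k + 1).factorial) • _root_.dRho^[k + 1] f (0, x)) =o[𝓝[≥] 0]
        fun t : ℝ ↦ t ^ (k + 1) := by
  induction k generalizing f with
  | zero =>
    filter_upwards [h 0 le_rfl, eventually_boundary hf.eventually_differentiable] with x h0 hd
    have := (hasDerivWithinAt_iff_isLittleO.1 (hasDerivWithinAt_dRho hd))
    have h0 : f (0, x) = 0 := h0
    simpa [h0] using this
  | succ k ih =>
    rw [flatAt_succ] at h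
    filter_upwards [ih hf.dRho h.2, h.1 0 le_rfl, eventually_ray hf.eventually_differentiable]
      with x hx h0 hd
    rw [Function.iterate_succ_apply]
    set c := _root_.dRho^[k + 1] (_root_.dRho f) (0, x)
    rw [isLittleO_iff] at hx ⊢
    intro ε hε
    obtain ⟨δ, hδ, H⟩ := mem_nhdsGE_iff_exists_Icc_subset.1 ((hx hε).and hd)
    filter_upwards [Icc_mem_nhdsGE hδ] with t ht
    rw [Real.norm_of_nonneg (pow_nonneg ht.1 _)]
    -- Subtracting the Taylor term from `f` subtracts from its normal derivative the Taylor term of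
    -- one degree less, since `t ^ (k + 2) / (k + 2)!` has derivative `t ^ (k + 1) / (k + 1)!`. The
    -- induction hypothesis then supplies the bound to be integrated.
    refine norm_le_of_dRho (φ := fun t ↦ f (t, x) - (t ^ (k + 1 + 1) / (k + 1 + 1).factorial) • c)
      (ψ := fun t ↦ _root_.dRho f (t, x) - (t ^ (k + 1) / (k + 1).factorial) • c) ht.1 (fun s hs ↦ ?_) ?_
      (fun s hs ↦ ?_) hε.le
    · refine (hasDerivWithinAt_dRho (H ⟨hs.1, hs.2.trans ht.2⟩).2).sub
        (HasDerivWithinAt.smul_const ?_ c)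
      have h2 := ((hasDerivAt_pow (k + 1 + 1) s).div_const ((k + 1 + 1).factorial : ℝ)).hasDerivWithinAt
        (s := Ici 0)
      have e : s ^ (k + 1) / ((k + 1).factorial : ℝ) =
          ((k + 1 + 1 : ℕ) : ℝ) * s ^ (k + 1 + 1 - 1) / ((k + 1 + 1).factorial : ℝ) := by
        rw [Nat.factorial_succ (k + 1), Nat.add_sub_cancel]
        push_cast
        field_simp
      rw [e]
      exact h2
    · have h0 : f (0, x) = 0 := h0
      simp [h0]
    · have := (H ⟨hs.1, hs.2.trans ht.2⟩).1
      rwa [Real.norm_of_nonneg (pow_nonneg hs.1 _)] at this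

/-- By Taylor's formula, the first non-vanishing normal derivative would dominate `f` along the ray.
This converts the asymptotic conditions on a symmetry into conditions that can be differentiated. -/
lemma flatAt_of_isLittleO_ray {k : ℕ} (hf : ContDiffWithinAt ℝ ∞ f (halfSpace E) (0, x₀))
    (h : ∀ᶠ x in 𝓝 x₀, (fun t ↦ f (t, x)) =o[𝓝[≥] 0] fun t : ℝ ↦ t ^ k) : FlatAt k f x₀ := by
  induction k with
  | zero =>
    intro j hj
    obtain rfl : j = 0 := by omega
    filter_upwards [h] with x hx
    -- The filter `𝓝[≥] 0` contains `t = 0` itself, so `f = o(1)` forces `f (0, x) = 0`.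
    refine norm_le_zero_iff.1 (le_of_forall_pos_le_add fun ε hε ↦ ?_)
    simpa using (hx.def hε).self_of_nhdsWithin (le_refl (0 : ℝ))
  | succ k ih =>
    have hk : FlatAt k f x₀ := by
      refine ih (h.mono fun x hx ↦ hx.trans_isBigO ?_)
      refine IsBigO.of_bound 1 ?_
      filter_upwards [Icc_mem_nhdsGE (zero_lt_one' ℝ)] with t ht
      rw [one_mul, Real.norm_of_nonneg (pow_nonneg ht.1 _), Real.norm_of_nonneg (pow_nonneg ht.1 _)]
      exact pow_le_pow_of_le_one ht.1 ht.2 (Nat.le_succ k)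
    intro j hj
    rcases Nat.lt_or_ge j (k + 1) with hj' | hj'
    · exact hk j (by omega)
    obtain rfl : j = k + 1 := by omega
    filter_upwards [hk.isLittleO_ray hf, h] with x h1 h2
    have h3 := h2.sub h1
    simp only [sub_sub_cancel] at h3
    by_contra hc
    have hc : 0 < ‖_root_.dRho^[k + 1] f (0, x)‖ := norm_pos_iff.2 hc
    have hk0 : (0 : ℝ) < (k + 1).factorial := by positivity
    -- The constant is half the Taylor coefficient. A strictly positive `t` is then selected, since
    -- at `t = 0` the inequality carries no information.
    have h4 := (h3.def (c := ‖_root_.dRho^[k + 1] f (0, x)‖ / (2 * (k + 1).factorial))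
      (by positivity)).filter_mono (nhdsWithin_mono 0 Ioi_subset_Ici_self)
    obtain ⟨t, ht, ht0⟩ := (h4.and eventually_mem_nhdsWithin).exists
    have ht0 : 0 < t := ht0
    rw [norm_smul, Real.norm_of_nonneg (by positivity), Real.norm_of_nonneg (by positivity)] at ht
    have h5 : t ^ (k + 1) / (k + 1).factorial * ‖_root_.dRho^[k + 1] f (0, x)‖ =
      2 * (‖_root_.dRho^[k + 1] f (0, x)‖ / (2 * (k + 1).factorial) * t ^ (k + 1)) := by
      field_simp
    have h6 : 0 < ‖_root_.dRho^[k + 1] f (0, x)‖ / (2 * (k + 1).factorial) * t ^ (k + 1) := by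
      positivity
    linarith

end Smooth

lemma isBigO_pow_succ {x₀ : E} (k : ℕ) :
    (fun z : ℝ × E ↦ z.1 ^ (k + 1)) =O[𝓝[halfSpace E] (0, x₀)] fun z ↦ z.1 ^ k := by
  have h : (fun z : ℝ × E ↦ z.1) =O[𝓝[halfSpace E] (0, x₀)] fun _ ↦ (1 : ℝ) :=
    ContDiffWithinAt.isBigO_one contDiffAt_fst.contDiffWithinAt
  simpa [pow_succ] using (isBigO_refl (fun z : ℝ × E ↦ z.1 ^ k) _).mul h

lemma isLittleO_pow_succ {x₀ : E} (k : ℕ) :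
    (fun z : ℝ × E ↦ z.1 ^ (k + 1)) =o[𝓝[halfSpace E] (0, x₀)] fun z ↦ z.1 ^ k := by
  have h : (fun z : ℝ × E ↦ z.1) =o[𝓝[halfSpace E] (0, x₀)] fun _ ↦ (1 : ℝ) :=
    (isLittleO_one_iff ℝ).2 ((continuous_fst.tendsto ((0 : ℝ), x₀)).mono_left nhdsWithin_le_nhds)
  simpa [pow_succ] using (isBigO_refl (fun z : ℝ × E ↦ z.1 ^ k) _).mul_isLittleO h

lemma isBigO_clm_apply {α W : Type*} [NormedAddCommGroup W] [NormedSpace ℝ W] {l : Filter α}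
    {L : α → W →L[ℝ] V} {v : α → W} {f g : α → ℝ} (hL : L =O[l] f) (hv : v =O[l] g) :
    (fun z ↦ L z (v z)) =O[l] fun z ↦ f z * g z :=
  (IsBigO.of_bound 1 (Eventually.of_forall fun z ↦ by
    simpa using (L z).le_opNorm (v z))).trans (hL.norm_left.mul hv.norm_left)

/-! ### Brackets of vector fields with prescribed asymptotics -/

section Bracket

/-- The asymptotics `F = (-ρ² w + O(ρ³), c + ρ g + O(ρ²))` of a smooth vector field in a half-space. -/
structure HasBoundaryExpansion (F : ℝ × E → ℝ × E) (w : E → ℝ) (c g : E → E) (x₀ : E) : Prop where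
  smooth : ContDiffWithinAt ℝ ∞ F (halfSpace E) (0, x₀)
  smooth_w : ContDiffAt ℝ ∞ w x₀
  smooth_c : ContDiffAt ℝ ∞ c x₀
  smooth_g : ContDiffAt ℝ ∞ g x₀
  flat_fst : FlatAt 2 (fun z ↦ (F z).1 + z.1 ^ 2 * w z.2) x₀
  flat_snd : FlatAt 1 (fun z ↦ (F z).2 - (c z.2 + z.1 • g z.2)) x₀

namespace HasBoundaryExpansion

variable {F F₁ F₂ : ℝ × E → ℝ × E} {w w₁ w₂ : E → ℝ} {c c₁ c₂ g g₁ g₂ : E → E} {x₀ : E}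

lemma _root_.ContDiffAt.comp_snd_halfSpace {f : E → V} (hf : ContDiffAt ℝ ∞ f x₀) :
    ContDiffWithinAt ℝ ∞ (fun z : ℝ × E ↦ f z.2) (halfSpace E) (0, x₀) :=
  (hf.comp ((0 : ℝ), x₀) contDiffAt_snd).contDiffWithinAt

lemma _root_.ContDiffAt.eventually_hasFDerivWithinAt_comp_snd {f : E → V}
    (hf : ContDiffAt ℝ ∞ f x₀) : ∀ᶠ z in 𝓝[halfSpace E] ((0 : ℝ), x₀),
    HasFDerivWithinAt (fun z : ℝ × E ↦ f z.2)
      ((fderiv ℝ f z.2).comp (ContinuousLinearMap.snd ℝ ℝ E)) (halfSpace E) z := by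
  have h1 := (hf.of_le (m := 1) (WithTop.coe_le_coe.2 le_top)).eventually (by simp)
  filter_upwards [eventually_of_boundary h1] with z hz
  exact ((hz.differentiableAt (by simp)).hasFDerivAt.comp z hasFDerivAt_snd).hasFDerivWithinAt

lemma smooth_fst (h : HasBoundaryExpansion F w c g x₀) :
    ContDiffWithinAt ℝ ∞ (fun z ↦ (F z).1 + z.1 ^ 2 * w z.2) (halfSpace E) (0, x₀) :=
  (contDiffAt_fst.comp_contDiffWithinAt _ h.smooth).add
    ((contDiffAt_fst.contDiffWithinAt.pow 2).mul h.smooth_w.comp_snd_halfSpace)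

lemma smooth_snd (h : HasBoundaryExpansion F w c g x₀) :
    ContDiffWithinAt ℝ ∞ (fun z ↦ (F z).2 - (c z.2 + z.1 • g z.2)) (halfSpace E) (0, x₀) :=
  (contDiffAt_snd.comp_contDiffWithinAt _ h.smooth).sub
    (h.smooth_c.comp_snd_halfSpace.add
      (contDiffAt_fst.contDiffWithinAt.smul h.smooth_g.comp_snd_halfSpace))

lemma isBigO_fst (h : HasBoundaryExpansion F w c g x₀) :
    (fun z ↦ (F z).1) =O[𝓝[halfSpace E] (0, x₀)] fun z ↦ z.1 ^ 2 := by
  have h1 := h.flat_fst.isBigO h.smooth_fst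
  have h2 : (fun z : ℝ × E ↦ z.1 ^ 2 * w z.2) =O[𝓝[halfSpace E] (0, x₀)] fun z ↦ z.1 ^ 2 := by
    simpa using (isBigO_refl (fun z : ℝ × E ↦ z.1 ^ 2) _).mul
      h.smooth_w.comp_snd_halfSpace.isBigO_one
  have h3 := (h1.trans (isBigO_pow_succ 2)).sub h2
  simpa using h3

lemma isBigO_snd (h : HasBoundaryExpansion F w c g x₀) :
    (fun z ↦ (F z).2 - c z.2) =O[𝓝[halfSpace E] (0, x₀)] fun z ↦ z.1 ^ 1 := by
  have h1 := h.flat_snd.isBigO h.smooth_snd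
  have h2 : (fun z : ℝ × E ↦ z.1 • g z.2) =O[𝓝[halfSpace E] (0, x₀)] fun z ↦ z.1 ^ 1 := by
    simpa using (isBigO_refl (fun z : ℝ × E ↦ z.1) _).smul h.smooth_g.comp_snd_halfSpace.isBigO_one
  refine ((h1.trans (isBigO_pow_succ 1)).add h2).congr_left fun z ↦ ?_
  abel

/-- The differential is split into that of the flat remainders, which the estimates control, and
that of the explicit leading terms. -/
lemma fderivWithin_apply (h : HasBoundaryExpansion F w c g x₀) :
    ∀ᶠ z in 𝓝[halfSpace E] (0, x₀), ∀ V, fderivWithin ℝ F (halfSpace E) z V =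
      (V.1 * dRho (fun z ↦ (F z).1 + z.1 ^ 2 * w z.2) z
          + dTan (fun z ↦ (F z).1 + z.1 ^ 2 * w z.2) z V.2
          - (2 * z.1 * V.1 * w z.2 + z.1 ^ 2 * fderiv ℝ w z.2 V.2),
        V.1 • dRho (fun z ↦ (F z).2 - (c z.2 + z.1 • g z.2)) z
          + dTan (fun z ↦ (F z).2 - (c z.2 + z.1 • g z.2)) z V.2
          + (fderiv ℝ c z.2 V.2 + (z.1 • fderiv ℝ g z.2 V.2 + V.1 • g z.2))) := by
  filter_upwards [h.smooth_w.eventually_hasFDerivWithinAt_comp_snd,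
    h.smooth_c.eventually_hasFDerivWithinAt_comp_snd, h.smooth_g.eventually_hasFDerivWithinAt_comp_snd,
    h.smooth_fst.eventually_differentiable, h.smooth_snd.eventually_differentiable,
    h.smooth.eventually_differentiable, eventually_mem_nhdsWithin] with z hw hc hg hα hβ hF hz V
  have hu := uniqueDiffOn_halfSpace z hz
  have hf : HasFDerivWithinAt (fun z : ℝ × E ↦ z.1) (ContinuousLinearMap.fst ℝ ℝ E) (halfSpace E) z :=
    hasFDerivWithinAt_fst
  have e1 := (hF.hasFDerivWithinAt.fst.add ((hf.pow 2).mul hw)).fderivWithin hu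
  have e2 := (hF.hasFDerivWithinAt.snd.sub (hc.add (hf.smul hg))).fderivWithin hu
  have a1 := fderivWithin_halfSpace_apply (fun z : ℝ × E ↦ (F z).1 + z.1 ^ 2 * w z.2) z V
  have a2 := fderivWithin_halfSpace_apply (fun z : ℝ × E ↦ (F z).2 - (c z.2 + z.1 • g z.2)) z V
  refine Prod.ext ?_ ?_
  · dsimp only
    rw [← smul_eq_mul V.1, ← a1]
    refine Eq.trans ?_ (congrArg (fun L : ℝ × E →L[ℝ] ℝ ↦
      L V - (2 * z.1 * V.1 * w z.2 + z.1 ^ 2 * fderiv ℝ w z.2 V.2)) e1.symm)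
    simp
    ring
  · dsimp only
    rw [← a2]
    refine Eq.trans ?_ (congrArg (fun L : ℝ × E →L[ℝ] E ↦
      L V + (fderiv ℝ c z.2 V.2 + (z.1 • fderiv ℝ g z.2 V.2 + V.1 • g z.2))) e2.symm)
    simp

/-- The only contribution of order `ρ²` is the derivative of `-ρ² w₂` along `c₁`. Differentiating
the factor `ρ²` costs one power, but it is multiplied by the normal component of `F₁`, which is
`O(ρ²)`. -/
lemma isBigO_fderivWithin_fst (h₁ : HasBoundaryExpansion F₁ w₁ c₁ g₁ x₀)
    (h₂ : HasBoundaryExpansion F₂ w₂ c₂ g₂ x₀) :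
    (fun z ↦ (fderivWithin ℝ F₂ (halfSpace E) z (F₁ z)).1 + z.1 ^ 2 * fderiv ℝ w₂ z.2 (c₁ z.2))
      =O[𝓝[halfSpace E] (0, x₀)] fun z ↦ z.1 ^ 3 := by
  have hb : (fun z ↦ (F₁ z).2) =O[𝓝[halfSpace E] (0, x₀)] fun _ ↦ (1 : ℝ) :=
    ContDiffWithinAt.isBigO_one (contDiffAt_snd.comp_contDiffWithinAt _ h₁.smooth)
  have ha := h₁.isBigO_fst
  have t1 := ha.mul (((flatAt_succ.1 h₂.flat_fst).2).isBigO h₂.smooth_fst.dRho)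
  have t2 := isBigO_clm_apply ((h₂.flat_fst.dTan h₂.smooth_fst).isBigO h₂.smooth_fst.dTan) hb
  have t3 := (((isBigO_refl (fun z : ℝ × E ↦ z.1) (𝓝[halfSpace E] (0, x₀))).const_mul_left 2).mul
    ha).mul h₂.smooth_w.comp_snd_halfSpace.isBigO_one
  have hw : (fun z : ℝ × E ↦ fderiv ℝ w₂ z.2) =O[𝓝[halfSpace E] (0, x₀)] fun _ ↦ (1 : ℝ) :=
    (h₂.smooth_w.fderiv_right (m := ∞) (by simp)).comp_snd_halfSpace.isBigO_one
  have t4 := (isBigO_refl (fun z : ℝ × E ↦ z.1 ^ 2) (𝓝[halfSpace E] (0, x₀))).mul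
    (isBigO_clm_apply hw h₁.isBigO_snd)
  have t1' := (t1.congr_right (g₂ := fun z ↦ z.1 ^ (3 + 1)) fun z ↦ by ring).trans (isBigO_pow_succ 3)
  have t2' := t2.congr_right (g₂ := fun z ↦ z.1 ^ 3) fun z ↦ by ring
  have t3' := t3.congr_right (g₂ := fun z ↦ z.1 ^ 3) fun z ↦ by ring
  have t4' := t4.congr_right (g₂ := fun z ↦ z.1 ^ 3) fun z ↦ by ring
  refine (((t1'.add t2').sub t3').sub t4').congr' ?_ EventuallyEq.rfl
  filter_upwards [h₂.fderivWithin_apply] with z hz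
  rw [hz]
  simp only [map_sub]
  ring

/-- The normal component of `F₁` is `O(ρ²)` and does not enter at first order. The terms of order
`ρ` come from `g₂` differentiated along `c₁` and `c₂` differentiated along `ρ g₁`. -/
lemma isBigO_fderivWithin_snd (h₁ : HasBoundaryExpansion F₁ w₁ c₁ g₁ x₀)
    (h₂ : HasBoundaryExpansion F₂ w₂ c₂ g₂ x₀) :
    (fun z ↦ (fderivWithin ℝ F₂ (halfSpace E) z (F₁ z)).2 - (fderiv ℝ c₂ z.2 (c₁ z.2) +
      z.1 • (fderiv ℝ g₂ z.2 (c₁ z.2) + fderiv ℝ c₂ z.2 (g₁ z.2))))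
      =O[𝓝[halfSpace E] (0, x₀)] fun z ↦ z.1 ^ 2 := by
  have hb : (fun z ↦ (F₁ z).2) =O[𝓝[halfSpace E] (0, x₀)] fun _ ↦ (1 : ℝ) :=
    ContDiffWithinAt.isBigO_one (contDiffAt_snd.comp_contDiffWithinAt _ h₁.smooth)
  have ha := h₁.isBigO_fst
  have t1 := ha.smul (h₂.smooth_snd.dRho.isBigO_one.add h₂.smooth_g.comp_snd_halfSpace.isBigO_one)
  have t2 := isBigO_clm_apply ((h₂.flat_snd.dTan h₂.smooth_snd).isBigO h₂.smooth_snd.dTan) hb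
  have hc : (fun z : ℝ × E ↦ fderiv ℝ c₂ z.2) =O[𝓝[halfSpace E] (0, x₀)] fun _ ↦ (1 : ℝ) :=
    (h₂.smooth_c.fderiv_right (m := ∞) (by simp)).comp_snd_halfSpace.isBigO_one
  have hg : (fun z : ℝ × E ↦ fderiv ℝ g₂ z.2) =O[𝓝[halfSpace E] (0, x₀)] fun _ ↦ (1 : ℝ) :=
    (h₂.smooth_g.fderiv_right (m := ∞) (by simp)).comp_snd_halfSpace.isBigO_one
  have t3 := isBigO_clm_apply hc (h₁.flat_snd.isBigO h₁.smooth_snd)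
  have t4 := (isBigO_refl (fun z : ℝ × E ↦ z.1) (𝓝[halfSpace E] (0, x₀))).smul
    (isBigO_clm_apply hg h₁.isBigO_snd)
  have t1' := t1.congr_right (g₂ := fun z ↦ z.1 ^ 2) fun z ↦ by simp
  have t2' := t2.congr_right (g₂ := fun z ↦ z.1 ^ 2) fun z ↦ by ring
  have t3' := t3.congr_right (g₂ := fun z ↦ z.1 ^ 2) fun z ↦ by ring
  have t4' := t4.congr_right (g₂ := fun z ↦ z.1 ^ 2) fun z ↦ by simp; ring
  refine (((t1'.add t2').add t3').add t4').congr' ?_ EventuallyEq.rfl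
  filter_upwards [h₂.fderivWithin_apply] with z hz
  rw [hz]
  simp only [map_sub, map_add, map_smul, smul_add, smul_sub]
  abel

lemma lieBracketWithin_fst (h₁ : HasBoundaryExpansion F₁ w₁ c₁ g₁ x₀)
    (h₂ : HasBoundaryExpansion F₂ w₂ c₂ g₂ x₀) :
    (fun z ↦ (VectorField.lieBracketWithin ℝ F₁ F₂ (halfSpace E) z).1 - -(z.1 ^ 2 *
      (fderiv ℝ w₂ z.2 (c₁ z.2) - fderiv ℝ w₁ z.2 (c₂ z.2))))
      =O[𝓝[halfSpace E] (0, x₀)] fun z ↦ z.1 ^ 3 := by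
  refine ((isBigO_fderivWithin_fst h₁ h₂).sub (isBigO_fderivWithin_fst h₂ h₁)).congr_left fun z ↦ ?_
  simp only [VectorField.lieBracketWithin, Prod.fst_sub]
  ring

lemma lieBracketWithin_snd (h₁ : HasBoundaryExpansion F₁ w₁ c₁ g₁ x₀)
    (h₂ : HasBoundaryExpansion F₂ w₂ c₂ g₂ x₀) :
    (fun z ↦ (VectorField.lieBracketWithin ℝ F₁ F₂ (halfSpace E) z).2 -
      (VectorField.lieBracket ℝ c₁ c₂ z.2 +
        z.1 • (VectorField.lieBracket ℝ c₁ g₂ z.2 - VectorField.lieBracket ℝ c₂ g₁ z.2)))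
      =O[𝓝[halfSpace E] (0, x₀)] fun z ↦ z.1 ^ 2 := by
  refine ((isBigO_fderivWithin_snd h₁ h₂).sub (isBigO_fderivWithin_snd h₂ h₁)).congr_left fun z ↦ ?_
  simp only [VectorField.lieBracketWithin, VectorField.lieBracket, Prod.snd_sub, smul_add, smul_sub]
  abel

end HasBoundaryExpansion

end Bracket



end HalfSpace

/-! ### The Lie algebra of asymptotic symmetries -/

namespace AsymptoticallyFlat

variable {kind : InfinityKind} {n : ℕ} {B : Type*} [TopologicalSpace B]
  [ChartedSpace (EuclideanSpace ℝ (Fin n)) B] [IsManifold (𝓡 n) ∞ B]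
  (S : AsymptoticallyFlat kind n B)

/-- In the Lorentzian case, a vector orthogonal to everything is orthogonal to a time-like `t`; if
non-zero it would be space-like, yet it is also orthogonal to itself. -/
lemma h_nondegenerate (y : B) (v : TangentSpace (𝓡 n) y) (hv : ∀ w, S.h y v w = 0) : v = 0 := by
  have hsig := S.h_signature
  cases kind with
  | timelike =>
    by_contra h0
    exact ((hsig y).2 v h0).ne' (hv v)
  | spacelike =>
    obtain ⟨hsym, t, -, hpos⟩ := hsig y
    by_contra h0
    exact (hpos v ((hsym t v).trans (hv t)) h0).ne' (hv v)

lemma dom_mem_nhdsWithin (y : B) : S.dom ∈ 𝓝[{p : ℝ × B | 0 ≤ p.1}] ((0 : ℝ), y) := by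
  obtain ⟨O, hO, hdom⟩ := S.dom_eq
  have hy := S.boundary_mem y
  rw [hdom] at hy ⊢
  exact inter_mem (mem_nhdsWithin_of_mem_nhds (hO.mem_nhds hy.1)) self_mem_nhdsWithin

lemma dom_nonneg {p : ℝ × B} (hp : p ∈ S.dom) : 0 ≤ p.1 := by
  obtain ⟨O, hO, hdom⟩ := S.dom_eq
  rw [hdom] at hp
  exact hp.2

lemma tendsto_closed_ray (y : B) :
    Tendsto (fun r : ℝ ↦ (r, y)) (𝓝[≥] 0) (𝓝[S.dom] ((0 : ℝ), y)) := by
  have h1 : Tendsto (fun r : ℝ ↦ (r, y)) (𝓝[≥] 0) (𝓝[{p : ℝ × B | 0 ≤ p.1}] ((0 : ℝ), y)) :=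
    tendsto_nhdsWithin_iff.2 ⟨((Continuous.prodMk_left y).tendsto 0).mono_left nhdsWithin_le_nhds,
      eventually_mem_nhdsWithin⟩
  exact h1.mono_right (nhdsWithin_le_iff.2 (S.dom_mem_nhdsWithin y))

lemma uniqueMDiffOn_dom : UniqueMDiffOn (lineModel n) S.dom := by
  obtain ⟨O, hO, hdom⟩ := S.dom_eq
  have h1 : {p : ℝ × B | 0 ≤ p.1} = Ici (0 : ℝ) ×ˢ univ := by ext; simp
  rw [hdom, h1, inter_comm]
  exact ((uniqueDiffOn_Ici (0 : ℝ)).uniqueMDiffOn.prod uniqueMDiffOn_univ).inter hO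

lemma chart_boundary (y : B) : extChartAt (lineModel n) ((0 : ℝ), y) (0, y) =
    (0, extChartAt (𝓡 n) y y) := extChartAt_lineModel _ _

/-- The chart leaves `ρ` unchanged, and the domain is relatively open in `ρ ≥ 0`. -/
lemma preimage_dom_eventuallyEq (y : B) :
    ((extChartAt (lineModel n) ((0 : ℝ), y)).symm ⁻¹' S.dom : Set (ℝ × EuclideanSpace ℝ (Fin n)))
      =ᶠ[𝓝 (0, extChartAt (𝓡 n) y y)] halfSpace (EuclideanSpace ℝ (Fin n)) := by
  obtain ⟨O, hO, hdom⟩ := S.dom_eq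
  have hy := S.boundary_mem y
  rw [hdom] at hy
  have hc : ContinuousAt (extChartAt (lineModel n) ((0 : ℝ), y)).symm (0, extChartAt (𝓡 n) y y) := by
    rw [← chart_boundary]; exact continuousAt_extChartAt_symm _
  have h1 : (extChartAt (lineModel n) ((0 : ℝ), y)).symm ⁻¹' O ∈
      𝓝 (((0 : ℝ), extChartAt (𝓡 n) y y)) := by
    refine hc.preimage_mem_nhds (hO.mem_nhds ?_)
    rw [← chart_boundary, extChartAt_to_inv]
    exact hy.1
  filter_upwards [h1] with z hz
  refine propext ⟨fun h ↦ ?_, fun h ↦ ?_⟩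
  · have h2 := S.dom_nonneg h
    rw [extChartAt_lineModel_symm] at h2
    exact h2
  · change _ ∈ S.dom
    rw [hdom]
    refine ⟨hz, ?_⟩
    rw [mem_ofPred_eq, extChartAt_lineModel_symm]
    exact h

lemma tendsto_chart (y : B) : Tendsto (extChartAt (lineModel n) ((0 : ℝ), y)) (𝓝[S.dom] (0, y))
    (𝓝[halfSpace (EuclideanSpace ℝ (Fin n))] (0, extChartAt (𝓡 n) y y)) := by
  refine tendsto_nhdsWithin_iff.2 ⟨?_, ?_⟩
  · rw [← chart_boundary]
    exact (continuousAt_extChartAt _).mono_left nhdsWithin_le_nhds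
  · filter_upwards [self_mem_nhdsWithin] with p hp
    rw [extChartAt_lineModel]
    exact S.dom_nonneg hp

lemma eventually_mem_chart_source (y : B) :
    ∀ᶠ p in 𝓝[S.dom] ((0 : ℝ), y), p.2 ∈ (extChartAt (𝓡 n) y).source := by
  have : Tendsto (Prod.snd : ℝ × B → B) (𝓝[S.dom] ((0 : ℝ), y)) (𝓝 y) :=
    (continuous_snd.tendsto ((0 : ℝ), y)).mono_left nhdsWithin_le_nhds
  exact this.eventually (extChartAt_source_mem_nhds y)

lemma contDiffWithinAt_chartRep {ξ : Π p : ℝ × B, TangentSpace (lineModel n) p}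
    (hξ : SmoothFieldOn (lineModel n) ξ S.dom) (y : B) :
    ContDiffWithinAt ℝ ∞ (chartRep (lineModel n) (0, y) ξ) (halfSpace (EuclideanSpace ℝ (Fin n)))
      (0, extChartAt (𝓡 n) y y) := by
  have h1 := (contMDiffWithinAt_iff_chartRep (mem_extChartAt_source ((0 : ℝ), y))).1
    (hξ _ (S.boundary_mem y))
  rw [chart_boundary] at h1
  exact h1.congr_set (S.preimage_dom_eventuallyEq y)

lemma chartComp_self (y : B) (v : TangentSpace (𝓡 n) y) : chartComp y y v = v := by
  have : IsManifold (𝓡 n) 1 B := .of_le (n := ∞) (by simp)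
  rw [chartComp, mfderiv_extChartAt_self]; rfl

/-- A change of charts at a fixed point of the base is a continuous linear map. -/
lemma isLittleO_chartComp {α : Type*} {l : Filter α} {y : B} {v : α → TangentSpace (𝓡 n) y} {f : α → ℝ}
    (h : (fun a ↦ chartComp y y (v a)) =o[l] f) (y₀ : B) : (fun a ↦ chartComp y₀ y (v a)) =o[l] f := by
  have key (L : EuclideanSpace ℝ (Fin n) →L[ℝ] EuclideanSpace ℝ (Fin n))
      {v : α → EuclideanSpace ℝ (Fin n)} (h : v =o[l] f) : (fun a ↦ L (v a)) =o[l] f :=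
    (L.isBigO_comp v l).trans_isLittleO h
  simp only [chartComp_self] at h
  exact key _ h

lemma chartComp_sub (y₀ y : B) (v w : TangentSpace (𝓡 n) y) :
    chartComp y₀ y (v - w) = chartComp y₀ y v - chartComp y₀ y w := map_sub _ v w

lemma chartComp_add (y₀ y : B) (v w : TangentSpace (𝓡 n) y) :
    chartComp y₀ y (v + w) = chartComp y₀ y v + chartComp y₀ y w := map_add _ v w

lemma chartComp_smul (y₀ y : B) (c : ℝ) (v : TangentSpace (𝓡 n) y) :
    chartComp y₀ y (c • v) = c • chartComp y₀ y v := map_smul _ c v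

lemma chartComp_extChartAt {y₀ y : B} (hy : y ∈ (extChartAt (𝓡 n) y₀).source)
    (X : Π y : B, TangentSpace (𝓡 n) y) :
    chartComp y₀ y (X y) = chartRep (𝓡 n) y₀ X (extChartAt (𝓡 n) y₀ y) :=
  (chartRep_extChartAt hy X).symm

lemma chartRep_line_extChartAt {p q : ℝ × B} (hq : q.2 ∈ (extChartAt (𝓡 n) p.2).source)
    (X : Π p : ℝ × B, TangentSpace (lineModel n) p) :
    chartRep (lineModel n) p X (extChartAt (lineModel n) p q) =
      (lineComp (X q), chartComp p.2 q.2 (baseComp (X q))) :=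
  (chartRep_extChartAt (mem_extChartAt_lineModel_source.2 hq) X).trans (mfderiv_extChartAt_lineModel hq _)

lemma contMDiff_const_smul_real {w : B → ℝ} (hw : ContMDiff (𝓡 n) 𝓘(ℝ, ℝ) ∞ w) (a : ℝ) :
    ContMDiff (𝓡 n) 𝓘(ℝ, ℝ) ∞ (a • w) :=
  (contDiff_const_smul (𝕜 := ℝ) (n := ∞) a).contMDiff.comp hw

/-- The bracket of two vector fields on the spacetime in a chart. -/
lemma chartRep_mlieBracketWithin_dom {ξ₁ ξ₂ : Π p : ℝ × B, TangentSpace (lineModel n) p}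
    (h₁ : SmoothFieldOn (lineModel n) ξ₁ S.dom) (h₂ : SmoothFieldOn (lineModel n) ξ₂ S.dom) (y : B) :
    chartRep (lineModel n) (0, y) (VectorField.mlieBracketWithin (lineModel n) ξ₁ ξ₂ S.dom)
      =ᶠ[𝓝[halfSpace (EuclideanSpace ℝ (Fin n))] (0, extChartAt (𝓡 n) y y)]
      VectorField.lieBracketWithin ℝ (chartRep (lineModel n) (0, y) ξ₁) (chartRep (lineModel n) (0, y) ξ₂)
        (halfSpace (EuclideanSpace ℝ (Fin n))) := by
  have h3 := eventually_mem_line_target (n := n) (p := ((0 : ℝ), y)) (q := (0, y))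
    (mem_extChartAt_source (I := 𝓡 n) y)
  rw [chart_boundary] at h3
  filter_upwards [mem_nhdsWithin_of_mem_nhds (S.preimage_dom_eventuallyEq y).eventuallyEq_nhds,
    mem_nhdsWithin_of_mem_nhds h3, self_mem_nhdsWithin] with z hz ht hz0
  have ht' : z ∈ (extChartAt (lineModel n) ((0 : ℝ), y)).target := mem_extChartAt_lineModel_target.2 ht
  have hp : (extChartAt (lineModel n) ((0 : ℝ), y)).symm z ∈ S.dom :=
    hz.self_of_nhds.mpr hz0
  have h4 := chartRep_mlieBracketWithin S.uniqueMDiffOn_dom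
    ((extChartAt (lineModel n) ((0 : ℝ), y)).map_target ht') hp (h₁ _ hp) (h₂ _ hp)
  rw [(extChartAt (lineModel n) ((0 : ℝ), y)).right_inv ht'] at h4
  rw [h4]
  exact VectorField.lieBracketWithin_congr_set hz

/-- The components of an asymptotic symmetry in a chart. -/
lemma hasBoundaryExpansion {ξ : Π p : ℝ × B, TangentSpace (lineModel n) p} {w : B → ℝ}
    {χ G : Π y : B, TangentSpace (𝓡 n) y} (hξ : SmoothFieldOn (lineModel n) ξ S.dom)
    (hw : ContMDiff (𝓡 n) 𝓘(ℝ, ℝ) ∞ w) (hχ : SmoothFieldOn (𝓡 n) χ univ)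
    (hG : SmoothFieldOn (𝓡 n) G univ)
    (h₁ : ∀ y₀ : B, (fun p : ℝ × B ↦ lineComp (ξ p) - (-(p.1 ^ 2 * w p.2)))
      =o[𝓝[S.dom] (0, y₀)] fun p ↦ p.1 ^ 2)
    (h₂ : ∀ y₀ : B, (fun p : ℝ × B ↦
      chartComp y₀ p.2 (baseComp (ξ p) - (χ p.2 + (p.1 * S.ν₀⁻¹) • G p.2)))
        =o[𝓝[S.dom] (0, y₀)] fun p ↦ p.1) (y : B) :
    HasBoundaryExpansion (chartRep (lineModel n) (0, y) ξ) (w ∘ (extChartAt (𝓡 n) y).symm)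
      (chartRep (𝓡 n) y χ) (S.ν₀⁻¹ • chartRep (𝓡 n) y G) (extChartAt (𝓡 n) y y) := by
  have hy := mem_extChartAt_source (I := 𝓡 n) y
  rw [smoothFieldOn_univ_iff] at hχ hG
  have hexp : _ ∧ _ ∧ _ ∧ _ := ⟨S.contDiffWithinAt_chartRep hξ y, (contMDiffAt_iff_comp_symm hy).1 (hw y),
    (contMDiffAt_iff_chartRep hy).1 (hχ y),
    contDiffAt_const (c := S.ν₀⁻¹).smul ((contMDiffAt_iff_chartRep hy).1 (hG y))⟩
  have ht := (isOpen_extChartAt_target (I := 𝓡 n) y).mem_nhds (mem_extChartAt_target y)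
  refine ⟨hexp.1, hexp.2.1, hexp.2.2.1, hexp.2.2.2, flatAt_of_isLittleO_ray ?_ ?_,
    flatAt_of_isLittleO_ray ?_ ?_⟩
  · exact (contDiffAt_fst.comp_contDiffWithinAt _ hexp.1).add
      ((contDiffAt_fst.contDiffWithinAt.pow 2).mul hexp.2.1.comp_snd_halfSpace)
  · filter_upwards [ht] with x hx
    refine ((h₁ _).comp_tendsto (S.tendsto_closed_ray ((extChartAt (𝓡 n) y).symm x))).congr
      (fun t ↦ ?_) (fun t ↦ rfl)
    rw [chartRep_line (p := (0, y)) (z := (t, x)) hx]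
    simp
  · exact (contDiffAt_snd.comp_contDiffWithinAt _ hexp.1).sub
      (hexp.2.2.1.comp_snd_halfSpace.add
        (contDiffAt_fst.contDiffWithinAt.smul hexp.2.2.2.comp_snd_halfSpace))
  · filter_upwards [ht] with x hx
    have h3 := (h₂ _).comp_tendsto (S.tendsto_closed_ray ((extChartAt (𝓡 n) y).symm x))
    -- The condition at a nearby boundary point is expressed in the chart centred there. Along a
    -- single ray the base point is fixed, so passing to the chart at `y` applies one fixed linear
    -- map.
    refine (isLittleO_chartComp h3 y).congr (fun t ↦ ?_) (fun t ↦ (pow_one t).symm)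
    rw [chartRep_line (p := (0, y)) (z := (t, x)) hx, chartComp_sub, chartComp_add, chartComp_smul]
    simp only [Pi.smul_apply, mul_smul]
    rfl

/-- Asymptotic conditions can be read off in a chart. -/
lemma expansion_of_chart {ξ : Π p : ℝ × B, TangentSpace (lineModel n) p} {w : B → ℝ}
    {χ G : Π y : B, TangentSpace (𝓡 n) y} {y : B}
    (h₁ : (fun z ↦ (chartRep (lineModel n) (0, y) ξ z).1 - -(z.1 ^ 2 *
        (w ∘ (extChartAt (𝓡 n) y).symm) z.2))
      =o[𝓝[halfSpace (EuclideanSpace ℝ (Fin n))] (0, extChartAt (𝓡 n) y y)] fun z ↦ z.1 ^ 2)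
    (h₂ : (fun z ↦ (chartRep (lineModel n) (0, y) ξ z).2 - (chartRep (𝓡 n) y χ z.2 +
        (z.1 * S.ν₀⁻¹) • chartRep (𝓡 n) y G z.2))
      =o[𝓝[halfSpace (EuclideanSpace ℝ (Fin n))] (0, extChartAt (𝓡 n) y y)] fun z ↦ z.1) :
    ((fun p : ℝ × B ↦ lineComp (ξ p) - (-(p.1 ^ 2 * w p.2))) =o[𝓝[S.dom] (0, y)] fun p ↦ p.1 ^ 2) ∧
      (fun p : ℝ × B ↦ chartComp y p.2 (baseComp (ξ p) - (χ p.2 + (p.1 * S.ν₀⁻¹) • G p.2)))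
        =o[𝓝[S.dom] (0, y)] fun p ↦ p.1 := by
  refine ⟨(h₁.comp_tendsto (S.tendsto_chart y)).congr' ?_ ?_,
    (h₂.comp_tendsto (S.tendsto_chart y)).congr' ?_ ?_⟩
  · filter_upwards [S.eventually_mem_chart_source y] with p hp
    have hp' : p.2 ∈ (extChartAt (𝓡 n) ((0 : ℝ), y).2).source := hp
    simp only [Function.comp_apply]
    rw [chartRep_line_extChartAt hp', extChartAt_lineModel, (extChartAt (𝓡 n) y).left_inv hp]
  · exact Eventually.of_forall fun p ↦ by
      simp only [Function.comp_apply]; rw [extChartAt_lineModel]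
  · filter_upwards [S.eventually_mem_chart_source y] with p hp
    have hp' : p.2 ∈ (extChartAt (𝓡 n) ((0 : ℝ), y).2).source := hp
    simp only [Function.comp_apply]
    rw [chartRep_line_extChartAt hp', chartComp_sub, chartComp_add, chartComp_smul,
      chartComp_extChartAt hp χ, chartComp_extChartAt hp G, extChartAt_lineModel]
  · exact Eventually.of_forall fun p ↦ by
      simp only [Function.comp_apply]; rw [extChartAt_lineModel]

/-! ### Linear combinations and brackets of asymptotic symmetries. -/

variable {S}

lemma IsAsymptoticSymmetry.linear {ξ₁ ξ₂ : Π p : ℝ × B, TangentSpace (lineModel n) p} {w₁ w₂ : B → ℝ}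
    {χ₁ χ₂ : Π y : B, TangentSpace (𝓡 n) y} (h₁ : S.IsAsymptoticSymmetry ξ₁ w₁ χ₁)
    (h₂ : S.IsAsymptoticSymmetry ξ₂ w₂ χ₂) (a b : ℝ) :
    S.IsAsymptoticSymmetry (a • ξ₁ + b • ξ₂) (a • w₁ + b • w₂) (a • χ₁ + b • χ₂) := by
  obtain ⟨hs₁, hw₁, hχ₁, hl₁, G₁, hG₁, hb₁⟩ := h₁
  obtain ⟨hs₂, hw₂, hχ₂, hl₂, G₂, hG₂, hb₂⟩ := h₂
  refine ⟨fun p hp ↦ ?_, ?_, (hχ₁.smul a).add (hχ₂.smul b), fun y ↦ ?_, a • G₁ + b • G₂, ?_, fun y ↦ ?_⟩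
  · exact (((contMDiffWithinAt_const (c := a)).smul_section (hs₁ p hp))).add_section
      ((contMDiffWithinAt_const (c := b)).smul_section (hs₂ p hp))
  · exact (contMDiff_const_smul_real hw₁ a).add (contMDiff_const_smul_real hw₂ b)
  · refine (((hl₁ y).const_mul_left a).add ((hl₂ y).const_mul_left b)).congr_left fun p ↦ ?_
    simp only [Pi.add_apply, Pi.smul_apply, lineComp_add, lineComp_smul, smul_eq_mul]
    ring
  · exact (hG₁.smul hw₁ a).add (hG₂.smul hw₂ b) (contMDiff_const_smul_real hw₁ a)
      (contMDiff_const_smul_real hw₂ b)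
  · refine (((hb₁ y).const_smul_left a).add ((hb₂ y).const_smul_left b)).congr_left fun p ↦ ?_
    simp only [Pi.add_apply, Pi.smul_apply, baseComp_add, baseComp_smul, chartComp_sub, chartComp_add,
      chartComp_smul, smul_add, smul_sub, smul_comm a, smul_comm b]
    abel

/-- The bracket is computed in boundary charts, where the flat remainders of the two fields
contribute only `O(ρ³)` and `O(ρ²)`. The first order term has the required form because the
derivative of a gradient along a Killing field is again a gradient. -/
lemma IsAsymptoticSymmetry.mlieBracketWithin {ξ₁ ξ₂ : Π p : ℝ × B, TangentSpace (lineModel n) p}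
    {w₁ w₂ : B → ℝ} {χ₁ χ₂ : Π y : B, TangentSpace (𝓡 n) y} (h₁ : S.IsAsymptoticSymmetry ξ₁ w₁ χ₁)
    (h₂ : S.IsAsymptoticSymmetry ξ₂ w₂ χ₂) :
    S.IsAsymptoticSymmetry (VectorField.mlieBracketWithin (lineModel n) ξ₁ ξ₂ S.dom)
      (fun y ↦ dirDeriv (𝓡 n) w₂ χ₁ y - dirDeriv (𝓡 n) w₁ χ₂ y)
      (VectorField.mlieBracket (𝓡 n) χ₁ χ₂) := by
  obtain ⟨hs₁, hw₁, hχ₁, hl₁, G₁, hG₁, hb₁⟩ := h₁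
  obtain ⟨hs₂, hw₂, hχ₂, hl₂, G₂, hG₂, hb₂⟩ := h₂
  have hGs₁ := hG₁.smooth S.h_smooth S.h_nondegenerate hw₁
  have hGs₂ := hG₂.smooth S.h_smooth S.h_nondegenerate hw₂
  have hd₁ : ContMDiff (𝓡 n) 𝓘(ℝ, ℝ) ∞ (dirDeriv (𝓡 n) w₁ χ₂) :=
    fun y ↦ contMDiffAt_dirDeriv (hw₁ y) (hχ₂.contMDiffAt y)
  have hd₂ : ContMDiff (𝓡 n) 𝓘(ℝ, ℝ) ∞ (dirDeriv (𝓡 n) w₂ χ₁) :=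
    fun y ↦ contMDiffAt_dirDeriv (hw₂ y) (hχ₁.contMDiffAt y)
  -- The candidate `[χ₁, G₂] - [χ₂, G₁]` is the first order coefficient found for the bracket, up to
  -- `ν₀⁻¹`; it is the gradient of the new function by `IsGradient.mlieBracket`.
  have hgrad : IsGradient (𝓡 n) S.h (fun y ↦ dirDeriv (𝓡 n) w₂ χ₁ y - dirDeriv (𝓡 n) w₁ χ₂ y)
      (VectorField.mlieBracket (𝓡 n) χ₁ G₂ + (-1 : ℝ) • VectorField.mlieBracket (𝓡 n) χ₂ G₁) := by
    have := (hG₂.mlieBracket hχ₁ hw₂ hGs₂).add ((hG₁.mlieBracket hχ₂ hw₁ hGs₁).smul hd₁ (-1)) hd₂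
      (contMDiff_const_smul_real hd₁ (-1))
    have e : dirDeriv (𝓡 n) w₂ χ₁ + (-1 : ℝ) • dirDeriv (𝓡 n) w₁ χ₂ =
      fun y ↦ dirDeriv (𝓡 n) w₂ χ₁ y - dirDeriv (𝓡 n) w₁ χ₂ y := by
        ext y; simp [sub_eq_add_neg]
    rwa [e] at this
  have hb (y : B) := S.chartRep_mlieBracketWithin_dom hs₁ hs₂ y
  have he₁ (y : B) := S.hasBoundaryExpansion hs₁ hw₁ hχ₁.1 hGs₁ hl₁ hb₁ y
  have he₂ (y : B) := S.hasBoundaryExpansion hs₂ hw₂ hχ₂.1 hGs₂ hl₂ hb₂ y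
  have hL₁ (y : B) : (fun z ↦ (chartRep (lineModel n) (0, y)
      (VectorField.mlieBracketWithin (lineModel n) ξ₁ ξ₂ S.dom) z).1 - -(z.1 ^ 2 *
        ((fun y ↦ dirDeriv (𝓡 n) w₂ χ₁ y - dirDeriv (𝓡 n) w₁ χ₂ y) ∘ (extChartAt (𝓡 n) y).symm) z.2))
      =o[𝓝[halfSpace (EuclideanSpace ℝ (Fin n))] (0, extChartAt (𝓡 n) y y)] fun z ↦ z.1 ^ 2 := by
    have hy := mem_extChartAt_source (I := 𝓡 n) y
    refine (((he₁ y).lieBracketWithin_fst (he₂ y)).trans_isLittleO (isLittleO_pow_succ 2)).congr'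
      ?_ EventuallyEq.rfl
    filter_upwards [hb y, eventually_of_boundary (dirDeriv_comp_symm (X := χ₁) hy (hw₂ y)),
      eventually_of_boundary (dirDeriv_comp_symm (X := χ₂) hy (hw₁ y))] with z h1 h2 h3
    rw [h1, ← h2, ← h3]
    rfl
  have hL₂ (y : B) : (fun z ↦ (chartRep (lineModel n) (0, y)
      (VectorField.mlieBracketWithin (lineModel n) ξ₁ ξ₂ S.dom) z).2 -
        (chartRep (𝓡 n) y (VectorField.mlieBracket (𝓡 n) χ₁ χ₂) z.2 + (z.1 * S.ν₀⁻¹) •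
        chartRep (𝓡 n) y (VectorField.mlieBracket (𝓡 n) χ₁ G₂ +
          (-1 : ℝ) • VectorField.mlieBracket (𝓡 n) χ₂ G₁) z.2))
      =o[𝓝[halfSpace (EuclideanSpace ℝ (Fin n))] (0, extChartAt (𝓡 n) y y)] fun z ↦ z.1 := by
    refine (((he₁ y).lieBracketWithin_snd (he₂ y)).trans_isLittleO (isLittleO_pow_succ 1)).congr'
      ?_ (Eventually.of_forall fun z ↦ pow_one z.1)
    filter_upwards [hb y, eventually_of_boundary
      ((isOpen_extChartAt_target (I := 𝓡 n) y).mem_nhds (mem_extChartAt_target y))] with z h1 ht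
    have hs := (extChartAt (𝓡 n) y).map_target ht
    have hb {X Y : Π y : B, TangentSpace (𝓡 n) y} (hX : SmoothFieldOn (𝓡 n) X univ)
        (hY : SmoothFieldOn (𝓡 n) Y univ) := chartRep_mlieBracket hs
          (smoothFieldOn_univ_iff.1 hX _) (smoothFieldOn_univ_iff.1 hY _)
    have hd {X : Π y : B, TangentSpace (𝓡 n) y} (hX : SmoothFieldOn (𝓡 n) X univ) :=
      ((contMDiffAt_iff_chartRep hs).1 (smoothFieldOn_univ_iff.1 hX _)).differentiableAt (by simp)
    rw [(extChartAt (𝓡 n) y).right_inv ht] at hb hd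
    rw [h1, chartRep_add, chartRep_smul, hb hχ₁.1 hχ₂.1, hb hχ₁.1 hGs₂, hb hχ₂.1 hGs₁,
      VectorField.lieBracket_const_smul_right (hd hGs₂), VectorField.lieBracket_const_smul_right (hd hGs₁),
      neg_one_smul, ← sub_eq_add_neg, ← smul_sub, mul_smul]
  have key (y : B) := S.expansion_of_chart
    (ξ := VectorField.mlieBracketWithin (lineModel n) ξ₁ ξ₂ S.dom)
    (w := fun y ↦ dirDeriv (𝓡 n) w₂ χ₁ y - dirDeriv (𝓡 n) w₁ χ₂ y)
    (χ := VectorField.mlieBracket (𝓡 n) χ₁ χ₂) (y := y)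
    (G := VectorField.mlieBracket (𝓡 n) χ₁ G₂ + (-1 : ℝ) • VectorField.mlieBracket (𝓡 n) χ₂ G₁)
  refine ⟨fun p hp ↦ ?_, hd₂.sub hd₁, hχ₁.mlieBracket S.h_smooth hχ₂, fun y ↦ (key y ?_ ?_).1, _, hgrad,
    fun y ↦ (key y ?_ ?_).2⟩
  · have : IsManifold (lineModel n) ((⊤ : ℕ∞) + 1 : WithTop ℕ∞) (ℝ × B) :=
      inferInstanceAs (IsManifold (lineModel n) ∞ (ℝ × B))
    have : IsManifold (lineModel n) (minSmoothness ℝ 2) (ℝ × B) := .of_le (n := ∞)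
      (by rw [minSmoothness_of_isRCLikeNormedField]; exact WithTop.coe_le_coe.2 le_top)
    exact ContMDiffWithinAt.mlieBracketWithin_vectorField (m := ∞) (n := ∞) (hs₁ p hp) (hs₂ p hp)
      S.uniqueMDiffOn_dom hp (by rw [minSmoothness_of_isRCLikeNormedField]; rfl)
  · exact hL₁ y
  · exact hL₂ y
  · exact hL₁ y
  · exact hL₂ y

end AsymptoticallyFlat

/-! ### Flows near the boundary of a half-space -/

section HalfSpaceFlow

open scoped NNReal

variable {E : Type*} [NormedAddCommGroup E] [NormedSpace ℝ E]

/-- Quantitative bounds on a vector field with prescribed asymptotics in a part of a half-space. -/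
structure ControlledOn (F : ℝ × E → ℝ × E) (w : E → ℝ) (W : Set (ℝ × E)) (C : ℝ≥0) : Prop where
  nonneg : ∀ z ∈ W, 0 ≤ z.1
  le_one : ∀ z ∈ W, z.1 ≤ 1
  lip : LipschitzOnWith C F W
  fst_bound : ∀ z ∈ W, |(F z).1 + z.1 ^ 2 * w z.2| ≤ C * z.1 ^ 3
  w_bound : ∀ z ∈ W, |w z.2| ≤ C
  w_lip : ∀ z ∈ W, ∀ z' ∈ W, |w z.2 - w z'.2| ≤ C * dist z z'

/-- A function continuously differentiable up to the boundary of a convex set is locally Lipschitz,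
and flatness of order two gives the cubic bound. One constant, the sum of all, serves every
estimate. -/
lemma HasBoundaryExpansion.exists_controlledOn {F : ℝ × E → ℝ × E} {w : E → ℝ} {c g : E → E} {x₀ : E}
    (h : HasBoundaryExpansion F w c g x₀) :
    ∃ (C : ℝ≥0), ∃ W ∈ 𝓝[halfSpace E] ((0 : ℝ), x₀), ControlledOn F w W C := by
  obtain ⟨C₁, W₁, hW₁, h₁⟩ := (h.smooth.of_le (m := 1)
    (WithTop.coe_le_coe.2 le_top)).exists_lipschitzOnWith convex_halfSpace
  obtain ⟨C₂, W₂, hW₂, h₂⟩ := (h.smooth_w.of_le (m := 1)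
    (WithTop.coe_le_coe.2 le_top)).exists_lipschitzOnWith
  obtain ⟨C₃, hC₃, h₃⟩ := (h.flat_fst.isBigO h.smooth_fst).exists_pos
  obtain ⟨C₄, hC₄, h₄⟩ := h.smooth_w.comp_snd_halfSpace.isBigO_one.exists_pos
  have h₅ : ∀ᶠ z in 𝓝[halfSpace E] ((0 : ℝ), x₀), z.1 < 1 :=
    ((continuous_fst.tendsto ((0 : ℝ), x₀)).mono_left nhdsWithin_le_nhds).eventually_lt_const one_pos
  let C : ℝ≥0 := C₁ + C₂ + ⟨C₃, hC₃.le⟩ + ⟨C₄, hC₄.le⟩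
  have hC : (C : ℝ) = C₁ + C₂ + C₃ + C₄ := rfl
  have n₁ := C₁.2
  have n₂ := C₂.2
  refine ⟨C, _, inter_mem (inter_mem (inter_mem (eventually_mem_nhdsWithin (s := halfSpace E)) h₅)
    (inter_mem hW₁ (eventually_of_boundary hW₂))) (inter_mem h₃.bound h₄.bound), ?_⟩
  refine ⟨fun z hz ↦ hz.1.1.1, fun z hz ↦ (show z.1 < 1 from hz.1.1.2).le, ?_, fun z hz ↦ ?_,
    fun z hz ↦ ?_, fun z hz z' hz' ↦ ?_⟩
  · refine (h₁.mono fun z hz ↦ hz.1.2.1).weaken ?_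
    rw [← NNReal.coe_le_coe, hC]
    linarith
  · have h6 : 0 ≤ z.1 := hz.1.1.1
    have := hz.2.1
    simp only [mem_ofPred_eq, Real.norm_eq_abs] at this
    refine this.trans ?_
    rw [abs_of_nonneg (by positivity), hC]
    gcongr
    linarith
  · have := hz.2.2
    simp only [mem_ofPred_eq, Real.norm_eq_abs, abs_one, mul_one] at this
    rw [hC]
    linarith
  · have := h₂.dist_le_mul _ hz.1.2.2 _ hz'.1.2.2
    rw [Real.dist_eq] at this
    refine this.trans ?_
    rw [hC]
    gcongr
    · linarith
    · exact le_max_right _ _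

namespace ControlledOn

variable {F : ℝ × E → ℝ × E} {w : E → ℝ} {W : Set (ℝ × E)} {C : ℝ≥0}

lemma mono (h : ControlledOn F w W C) {W' : Set (ℝ × E)} (hW : W' ⊆ W) : ControlledOn F w W' C :=
  ⟨fun z hz ↦ h.nonneg z (hW hz), fun z hz ↦ h.le_one z (hW hz), h.lip.mono hW,
    fun z hz ↦ h.fst_bound z (hW hz), fun z hz ↦ h.w_bound z (hW hz),
    fun z hz z' hz' ↦ h.w_lip z (hW hz) z' (hW hz')⟩

/-- The cubic remainder and the term `ρ² w` are each at most `C ρ²`, as `ρ ≤ 1`. -/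
lemma abs_fst_le (h : ControlledOn F w W C) {z : ℝ × E} (hz : z ∈ W) : |(F z).1| ≤ 2 * C * z.1 ^ 2 := by
  have h0 := h.nonneg z hz
  have h1 : |(F z).1| ≤ |(F z).1 + z.1 ^ 2 * w z.2| + |z.1 ^ 2 * w z.2| := by
    have := abs_sub ((F z).1 + z.1 ^ 2 * w z.2) (z.1 ^ 2 * w z.2)
    rwa [add_sub_cancel_right] at this
  rw [abs_mul, abs_of_nonneg (by positivity : 0 ≤ z.1 ^ 2)] at h1
  have h2 : z.1 ^ 2 * |w z.2| ≤ z.1 ^ 2 * C := by gcongr; exact h.w_bound z hz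
  have h3 : (C : ℝ) * z.1 ^ 3 ≤ C * z.1 ^ 2 :=
    mul_le_mul_of_nonneg_left (pow_le_pow_of_le_one h0 (h.le_one z hz) (by norm_num)) C.2
  linarith [h.fst_bound z hz]

/-- Weakened to a linear bound, the form in which Gronwall's inequality applies to `ρ`. -/
lemma abs_fst_le_abs (h : ControlledOn F w W C) {z : ℝ × E} (hz : z ∈ W) :
    |(F z).1| ≤ 2 * C * |z.1| := by
  have h0 := h.nonneg z hz
  refine (h.abs_fst_le hz).trans ?_
  rw [abs_of_nonneg h0]
  have := mul_le_mul_of_nonneg_left (pow_le_pow_of_le_one h0 (h.le_one z hz) one_le_two)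
    (by positivity : 0 ≤ 2 * (C : ℝ))
  rwa [pow_one] at this

end ControlledOn

lemma HasDerivWithinAt.of_Icc_Ico {V : Type*} [NormedAddCommGroup V] [NormedSpace ℝ V] {φ : ℝ → V}
    {φ' : V} {a b t : ℝ} (h : HasDerivWithinAt φ φ' (Icc a b) t) (ht : t ∈ Ico a b) :
    HasDerivWithinAt φ φ' (Ici t) t :=
  h.mono_of_mem_nhdsWithin (Icc_mem_nhdsGE_of_mem ht)

lemma HasDerivWithinAt.prod_fst {V V' : Type*} [NormedAddCommGroup V] [NormedSpace ℝ V]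
    [NormedAddCommGroup V'] [NormedSpace ℝ V'] {φ : ℝ → V × V'} {φ' : V × V'} {S : Set ℝ} {t : ℝ}
    (h : HasDerivWithinAt φ φ' S t) : HasDerivWithinAt (fun t ↦ (φ t).1) φ'.1 S t :=
  (ContinuousLinearMap.fst ℝ V V').hasFDerivAt.comp_hasDerivWithinAt t h

/-- Any time segment, forward or backward, is rescaled to `[0, 1]`; the signed length becomes a
factor of the velocity. Thus both directions of time are treated together. -/
lemma HasDerivWithinAt.comp_segment {V : Type*} [NormedAddCommGroup V] [NormedSpace ℝ V] {φ : ℝ → V}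
    {φ' : ℝ → V} {S : Set ℝ} {s s' : ℝ} (h : ∀ t ∈ S, HasDerivWithinAt φ (φ' t) S t)
    (hS : uIcc s s' ⊆ S) {σ : ℝ} (hσ : σ ∈ Icc (0 : ℝ) 1) :
    HasDerivWithinAt (fun σ ↦ φ (s + σ * (s' - s))) ((s' - s) • φ' (s + σ * (s' - s))) (Icc 0 1) σ := by
  have hm : MapsTo (fun σ : ℝ ↦ s + σ * (s' - s)) (Icc 0 1) S := fun σ hσ ↦ hS (by
    rw [← segment_eq_uIcc, segment_eq_image']
    exact ⟨σ, hσ, by simp⟩)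
  have h1 : HasDerivWithinAt (fun σ : ℝ ↦ s + σ * (s' - s)) (s' - s) (Icc 0 1) σ := by
    simpa using (((hasDerivAt_id σ).mul_const (s' - s)).const_add s).hasDerivWithinAt
  exact (h _ (hm hσ)).scomp σ h1 hm

/-- A function with `|φ'| ≤ C |φ|` which is non-negative initially remains so. -/
lemma nonneg_of_abs_deriv_le {φ φ' : ℝ → ℝ} {C : ℝ}
    (h : ∀ t ∈ Icc (0 : ℝ) 1, HasDerivWithinAt φ (φ' t) (Icc 0 1) t)
    (hb : ∀ t ∈ Icc (0 : ℝ) 1, |φ' t| ≤ C * |φ t|) (h0 : 0 ≤ φ 0) : 0 ≤ φ 1 := by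
  by_contra! h1
  have hc : ContinuousOn φ (Icc 0 1) := fun t ht ↦ (h t ht).continuousWithinAt
  -- A negative final value would force an intermediate zero, after which Gronwall's inequality
  -- keeps `φ` equal to zero.
  obtain ⟨t, ht, hφ⟩ := intermediate_value_Icc' zero_le_one hc ⟨h1.le, h0⟩
  have hsub : Icc t 1 ⊆ Icc 0 1 := Icc_subset_Icc_left ht.1
  have := eq_zero_of_abs_deriv_le_mul_abs_self_of_eq_zero_right (hc.mono hsub)
    (fun x hx ↦ (h x (hsub (Ico_subset_Icc_self hx))).of_Icc_Ico ⟨ht.1.trans hx.1, hx.2⟩) hφ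
    (fun x hx ↦ hb x (hsub (Ico_subset_Icc_self hx))) 1 ⟨ht.2, le_rfl⟩
  exact h1.ne this

lemma eq_zero_of_abs_deriv_le {φ φ' : ℝ → ℝ} {C : ℝ}
    (h : ∀ t ∈ Icc (0 : ℝ) 1, HasDerivWithinAt φ (φ' t) (Icc 0 1) t)
    (hb : ∀ t ∈ Icc (0 : ℝ) 1, |φ' t| ≤ C * |φ t|) (h0 : φ 0 = 0) : φ 1 = 0 :=
  eq_zero_of_abs_deriv_le_mul_abs_self_of_eq_zero_right
    (fun t ht ↦ (h t ht).continuousWithinAt)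
    (fun x hx ↦ (h x (Ico_subset_Icc_self hx)).of_Icc_Ico hx) h0
    (fun x hx ↦ hb x (Ico_subset_Icc_self hx)) 1 ⟨zero_le_one, le_rfl⟩

namespace ControlledOn

variable {F : ℝ × E → ℝ × E} {w : E → ℝ} {W : Set (ℝ × E)} {C : ℝ≥0}

/-- Comparison of two trajectories. -/
lemma dist_le (h : ControlledOn F w W C) {τ : ℝ} (hτ : |τ| ≤ 1) {z ζ : ℝ → ℝ × E}
    (hz : ∀ σ ∈ Icc (0 : ℝ) 1, HasDerivWithinAt z (τ • F (z σ)) (Icc 0 1) σ)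
    (hζ : ∀ σ ∈ Icc (0 : ℝ) 1, HasDerivWithinAt ζ (τ • F (ζ σ)) (Icc 0 1) σ)
    (hzW : ∀ σ ∈ Icc (0 : ℝ) 1, z σ ∈ W) (hζW : ∀ σ ∈ Icc (0 : ℝ) 1, ζ σ ∈ W) {σ : ℝ}
    (hσ : σ ∈ Icc (0 : ℝ) 1) : dist (z σ) (ζ σ) ≤ Real.exp C * dist (z 0) (ζ 0) := by
  have hl : LipschitzOnWith C (fun z ↦ τ • F z) W := by
    refine LipschitzOnWith.of_dist_le_mul fun x hx y hy ↦ ?_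
    rw [dist_smul₀, Real.norm_eq_abs]
    have := h.lip.dist_le_mul x hx y hy
    calc |τ| * dist (F x) (F y) ≤ 1 * dist (F x) (F y) := by gcongr
      _ ≤ _ := by rwa [one_mul]
  have := dist_le_of_trajectories_ODE_of_mem (v := fun _ z ↦ τ • F z) (s := fun _ ↦ W) (K := C)
    (fun _ _ ↦ hl) (fun t ht ↦ (hz t ht).continuousWithinAt)
    (fun x hx ↦ (hz x (Ico_subset_Icc_self hx)).of_Icc_Ico hx)
    (fun x hx ↦ hzW x (Ico_subset_Icc_self hx)) (fun t ht ↦ (hζ t ht).continuousWithinAt)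
    (fun x hx ↦ (hζ x (Ico_subset_Icc_self hx)).of_Icc_Ico hx)
    (fun x hx ↦ hζW x (Ico_subset_Icc_self hx)) le_rfl σ hσ
  refine this.trans ?_
  rw [mul_comm]
  gcongr
  rw [sub_zero]
  exact mul_le_of_le_one_right C.2 hσ.2

/-- The boundary distance stays comparable to its initial value. -/
lemma fst_le (h : ControlledOn F w W C) {τ : ℝ} (hτ : |τ| ≤ 1) {z : ℝ → ℝ × E}
    (hz : ∀ σ ∈ Icc (0 : ℝ) 1, HasDerivWithinAt z (τ • F (z σ)) (Icc 0 1) σ)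
    (hzW : ∀ σ ∈ Icc (0 : ℝ) 1, z σ ∈ W) {σ : ℝ} (hσ : σ ∈ Icc (0 : ℝ) 1) :
    (z σ).1 ≤ Real.exp (2 * C) * (z 0).1 := by
  have hd (σ : ℝ) (hσ : σ ∈ Icc (0 : ℝ) 1) := (hz σ hσ).prod_fst
  have := norm_le_gronwallBound_of_norm_deriv_right_le (f := fun σ ↦ (z σ).1) (δ := ‖(z 0).1‖)
    (K := 2 * C) (ε := 0) (fun t ht ↦ (hd t ht).continuousWithinAt)
    (fun x hx ↦ (hd x (Ico_subset_Icc_self hx)).of_Icc_Ico hx) le_rfl (fun x hx ↦ ?_) σ hσ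
  · rw [gronwallBound_ε0, Real.norm_of_nonneg (h.nonneg _ (hzW σ hσ)),
      Real.norm_of_nonneg (h.nonneg _ (hzW 0 (left_mem_Icc.2 zero_le_one)))] at this
    have h0 := h.nonneg _ (hzW 0 (left_mem_Icc.2 zero_le_one))
    refine this.trans ?_
    rw [mul_comm, sub_zero]
    exact mul_le_mul_of_nonneg_right (Real.exp_le_exp.2
      (mul_le_of_le_one_right (mul_nonneg zero_le_two C.2) hσ.2)) h0
  · rw [add_zero]
    have h1 := h.abs_fst_le_abs (hzW x (Ico_subset_Icc_self hx))
    calc ‖(τ • F (z x)).1‖ = |τ| * |(F (z x)).1| := by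
          rw [Prod.smul_fst, smul_eq_mul, norm_mul]; rfl
      _ ≤ 1 * |(F (z x)).1| := by gcongr
      _ ≤ _ := by rw [one_mul]; exact h1

/-- The second order expansion of the boundary distance along trajectories. -/
lemma abs_fst_sub_le (h : ControlledOn F w W C) {τ : ℝ} (hτ : |τ| ≤ 1) {z ζ : ℝ → ℝ × E}
    (hz : ∀ σ ∈ Icc (0 : ℝ) 1, HasDerivWithinAt z (τ • F (z σ)) (Icc 0 1) σ)
    (hζ : ∀ σ ∈ Icc (0 : ℝ) 1, HasDerivWithinAt ζ (τ • F (ζ σ)) (Icc 0 1) σ)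
    (hzW : ∀ σ ∈ Icc (0 : ℝ) 1, z σ ∈ W) (hζW : ∀ σ ∈ Icc (0 : ℝ) 1, ζ σ ∈ W)
    (hζ0 : (ζ 0).1 = 0) {Ω : ℝ → ℝ}
    (hΩ : ∀ σ ∈ Icc (0 : ℝ) 1, HasDerivWithinAt Ω (τ * w (ζ σ).2) (Icc 0 1) σ) :
    |(z 1).1 - (z 0).1 + (z 0).1 ^ 2 * (Ω 1 - Ω 0)| ≤
      (C * Real.exp (2 * C) ^ 3 + C * Real.exp (2 * C) ^ 2 * Real.exp C +
        2 * C * Real.exp (2 * C) ^ 2 * (Real.exp (2 * C) + 1) * C) *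
        ((z 0).1 ^ 2 * dist (z 0) (ζ 0)) := by
  set A := Real.exp (2 * C) with hA
  set d := dist (z 0) (ζ 0) with hd
  set r₀ := (z 0).1 with hr₀
  have m0 : (0 : ℝ) ∈ Icc (0 : ℝ) 1 := left_mem_Icc.2 zero_le_one
  have hr₀0 : 0 ≤ r₀ := h.nonneg _ (hzW 0 m0)
  -- The comparison trajectory starts on the boundary, so `r₀` is at most the initial distance. This
  -- turns terms in `r₀ ^ 3` into `r₀ ^ 2 * d`.
  have hr₀d : r₀ ≤ d := by
    have h1 : dist (z 0).1 (ζ 0).1 ≤ d := le_max_left _ _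
    rw [hζ0, Real.dist_eq, sub_zero, abs_of_nonneg hr₀0] at h1
    exact h1
  have hA0 : 0 < A := Real.exp_pos _
  have hder (σ : ℝ) (hσ : σ ∈ Icc (0 : ℝ) 1) := (hz σ hσ).prod_fst
  have hr (σ : ℝ) (hσ : σ ∈ Icc (0 : ℝ) 1) : (z σ).1 ≤ A * r₀ := h.fst_le hτ hz hzW hσ
  have hr' (σ : ℝ) (hσ : σ ∈ Icc (0 : ℝ) 1) : |(z σ).1 - r₀| ≤ 2 * C * A ^ 2 * r₀ ^ 2 := by
    have := (convex_Icc (0 : ℝ) 1).norm_image_sub_le_of_norm_hasDerivWithin_le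
      (C := 2 * C * A ^ 2 * r₀ ^ 2) hder (fun s hs ↦ ?_) m0 hσ
    · refine this.trans (mul_le_of_le_one_right (by positivity) ?_)
      rw [sub_zero, Real.norm_of_nonneg hσ.1]
      exact hσ.2
    · have h0 := h.nonneg _ (hzW s hs)
      calc ‖(τ • F (z s)).1‖ = |τ| * |(F (z s)).1| := by
            rw [Prod.smul_fst, smul_eq_mul, norm_mul]; rfl
        _ ≤ 1 * (2 * C * (z s).1 ^ 2) := by gcongr; exact h.abs_fst_le (hzW s hs)
        _ ≤ 1 * (2 * C * (A * r₀) ^ 2) := by gcongr; exact hr s hs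
        _ = _ := by ring
  have := (convex_Icc (0 : ℝ) 1).norm_image_sub_le_of_norm_hasDerivWithin_le
    (C := (C * A ^ 3 + C * A ^ 2 * Real.exp C + 2 * C * A ^ 2 * (A + 1) * C) * (r₀ ^ 2 * d))
    (f := fun σ ↦ (z σ).1 + r₀ ^ 2 * Ω σ)
    (fun σ hσ ↦ (hder σ hσ).add ((hΩ σ hσ).const_mul (r₀ ^ 2))) (fun σ hσ ↦ ?_) m0
    (right_mem_Icc.2 zero_le_one)
  · simp only [sub_zero, norm_one, mul_one, Real.norm_eq_abs] at this
    refine le_of_eq_of_le (congrArg _ ?_) this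
    ring
  · have hσ0 := h.nonneg _ (hzW σ hσ)
    -- Three errors, one for each summand of the constant: the cubic remainder of the field, the
    -- change of `w` between the two trajectories, and the replacement of the current `ρ²` by its
    -- initial value.
    have e : (τ • F (z σ)).1 + r₀ ^ 2 * (τ * w (ζ σ).2) =
        τ * (((F (z σ)).1 + (z σ).1 ^ 2 * w (z σ).2) - (z σ).1 ^ 2 * (w (z σ).2 - w (ζ σ).2) -
          (((z σ).1 - r₀) * ((z σ).1 + r₀)) * w (ζ σ).2) := by
      rw [Prod.smul_fst, smul_eq_mul]; ring
    have b1 : |(F (z σ)).1 + (z σ).1 ^ 2 * w (z σ).2| ≤ C * A ^ 3 * (r₀ ^ 2 * d) := by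
      refine (h.fst_bound _ (hzW σ hσ)).trans ?_
      calc (C : ℝ) * (z σ).1 ^ 3 ≤ C * (A * r₀) ^ 3 := by gcongr; exact hr σ hσ
        _ = C * A ^ 3 * (r₀ ^ 2 * r₀) := by ring
        _ ≤ _ := by gcongr
    have b2 : |(z σ).1 ^ 2 * (w (z σ).2 - w (ζ σ).2)| ≤ C * A ^ 2 * Real.exp C * (r₀ ^ 2 * d) := by
      rw [abs_mul, abs_of_nonneg (by positivity)]
      calc (z σ).1 ^ 2 * |w (z σ).2 - w (ζ σ).2| ≤ (A * r₀) ^ 2 * (C * (Real.exp C * d)) := by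
            gcongr
            · exact hr σ hσ
            · refine (h.w_lip _ (hzW σ hσ) _ (hζW σ hσ)).trans ?_
              gcongr
              exact h.dist_le hτ hz hζ hzW hζW hσ
        _ = _ := by ring
    have b3 : |(((z σ).1 - r₀) * ((z σ).1 + r₀)) * w (ζ σ).2| ≤
        2 * C * A ^ 2 * (A + 1) * C * (r₀ ^ 2 * d) := by
      rw [abs_mul, abs_mul, abs_of_nonneg (by positivity : 0 ≤ (z σ).1 + r₀)]
      calc |(z σ).1 - r₀| * ((z σ).1 + r₀) * |w (ζ σ).2|
          ≤ (2 * C * A ^ 2 * r₀ ^ 2) * (A * r₀ + r₀) * C := by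
            gcongr
            · exact hr' σ hσ
            · exact hr σ hσ
            · exact h.w_bound _ (hζW σ hσ)
        _ = 2 * C * A ^ 2 * (A + 1) * C * (r₀ ^ 2 * r₀) := by ring
        _ ≤ _ := by gcongr
    rw [e, norm_mul, Real.norm_eq_abs, Real.norm_eq_abs]
    refine (mul_le_of_le_one_left (abs_nonneg _) hτ).trans ?_
    refine ((abs_sub _ _).trans (add_le_add (abs_sub _ _) le_rfl)).trans ?_
    linarith

end ControlledOn

end HalfSpaceFlow

/-! ### Existence of flows near the boundary of a half-space -/

section HalfSpaceFlowExistence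

open scoped NNReal

variable {E : Type*} [NormedAddCommGroup E] [NormedSpace ℝ E]

/-- A field which is Lipschitz on a closed ball and bounded everywhere has a flow staying there. -/
lemma exists_flow_of_lipschitzOnWith [CompleteSpace E] {f : E → E} {x₀ : E} {a L : ℝ} {K : ℝ≥0}
    (ha : 0 < a) (hL : 0 < L) (hf : LipschitzOnWith K f (Metric.closedBall x₀ a))
    (hb : ∀ x, ‖f x‖ ≤ L) : ∃ ε > 0, ∃ α : E × ℝ → E,
      (∀ x ∈ Metric.closedBall x₀ (a / 2), α (x, 0) = x ∧ ∀ t ∈ Icc (-ε) ε,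
        α (x, t) ∈ Metric.closedBall x₀ a ∧
          HasDerivWithinAt (fun t ↦ α (x, t)) (f (α (x, t))) (Icc (-ε) ε) t) ∧
      ContinuousOn α (Metric.closedBall x₀ (a / 2) ×ˢ Icc (-ε) ε) := by
  -- With speed at most `L`, a trajectory moves by at most `a / 2` during time `ε`, so from the
  -- half-ball it stays in the ball.
  set ε := a / 2 / L with hε
  have hε0 : 0 < ε := by positivity
  have h0 : (0 : ℝ) ∈ Icc (-ε) ε := ⟨by linarith, hε0.le⟩
  have hLε : L * ε = a / 2 := by rw [hε]; field_simp
  have hpl : IsPicardLindelof (fun _ : ℝ ↦ f) (tmin := -ε) (tmax := ε) ⟨0, h0⟩ x₀ ⟨a, ha.le⟩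
      ⟨a / 2, by positivity⟩ ⟨L, hL.le⟩ K := by
    refine IsPicardLindelof.of_time_independent (fun x _ ↦ hb x) hf ?_
    simp only [sub_zero, zero_sub, neg_neg, max_self]
    change L * ε ≤ a - a / 2
    linarith
  obtain ⟨α, hα, hc⟩ := hpl.exists_forall_mem_closedBall_eq_hasDerivWithinAt_continuousOn
  refine ⟨ε, hε0, α, fun x hx ↦ ⟨(hα x hx).1, fun t ht ↦ ⟨?_, (hα x hx).2 t ht⟩⟩, hc⟩
  have h1 := (convex_Icc (-ε) ε).norm_image_sub_le_of_norm_hasDerivWithin_le (hα x hx).2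
    (fun t _ ↦ hb _) h0 ht
  rw [(hα x hx).1, sub_zero, Real.norm_eq_abs, ← dist_eq_norm] at h1
  have h2 : L * |t| ≤ a / 2 := by
    rw [← hLε]
    gcongr
    exact abs_le.2 ht
  have h3 : dist x x₀ ≤ a / 2 := hx
  exact (dist_triangle _ x _).trans (by linarith)

/-- The Picard-Lindelöf theorem asks for a full ball, while `F` is controlled only in the
half-space. The field is therefore precomposed with the projection `P` to the half-space, which does
not increase distances. Trajectories starting in the half-space stay there, where `P` is the
identity, and so solve the original equation. -/
lemma ControlledOn.exists_flow [CompleteSpace E] {F : ℝ × E → ℝ × E} {w : E → ℝ} {W : Set (ℝ × E)}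
    {C : ℝ≥0} {x₀ : E} (h : ControlledOn F w W C) (hW : W ∈ 𝓝[halfSpace E] ((0 : ℝ), x₀)) :
    ∃ ε > 0, ∃ r > 0, ∃ α : (ℝ × E) × ℝ → ℝ × E,
      (∀ z ∈ halfSpace E ∩ Metric.closedBall ((0 : ℝ), x₀) r, α (z, 0) = z ∧ ∀ t ∈ Icc (-ε) ε,
        α (z, t) ∈ W ∧ HasDerivWithinAt (fun t ↦ α (z, t)) (F (α (z, t))) (Icc (-ε) ε) t) ∧
      ContinuousOn α ((halfSpace E ∩ Metric.closedBall ((0 : ℝ), x₀) r) ×ˢ Icc (-ε) ε) := by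
  classical
  obtain ⟨R, hR, hRW⟩ := Metric.mem_nhdsWithin_iff.1 hW
  set a := R / 2 with ha
  have ha0 : 0 < a := by positivity
  set z₀ : ℝ × E := (0, x₀) with hz₀
  let P : ℝ × E → ℝ × E := fun z ↦ (max z.1 0, z.2)
  have hP (z z' : ℝ × E) : dist (P z) (P z') ≤ dist z z' :=
    max_le_max (by
      rw [Real.dist_eq, Real.dist_eq]
      exact abs_max_sub_max_le_abs _ _ _) le_rfl
  have hP0 : P z₀ = z₀ := by simp [P, hz₀]
  have hPW {z : ℝ × E} (hz : z ∈ Metric.closedBall z₀ a) : P z ∈ W := by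
    refine hRW ⟨?_, show 0 ≤ max z.1 0 from le_max_right _ _⟩
    have h1 := hP z z₀
    rw [hP0] at h1
    have h2 : dist z z₀ ≤ a := hz
    rw [Metric.mem_ball]
    linarith
  -- Cutting off by zero may break continuity, but the Lipschitz condition is required only on the
  -- ball, whereas the norm bound is required everywhere.
  let f : ℝ × E → ℝ × E := fun z ↦ if z ∈ Metric.closedBall z₀ a then F (P z) else 0
  have hf : LipschitzOnWith C f (Metric.closedBall z₀ a) := by
    refine LipschitzOnWith.of_dist_le_mul fun z hz z' hz' ↦ ?_
    simp only [f, if_pos hz, if_pos hz']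
    refine (h.lip.dist_le_mul _ (hPW hz) _ (hPW hz')).trans ?_
    gcongr
    exact hP z z'
  have hb (z : ℝ × E) : ‖f z‖ ≤ ‖F z₀‖ + C * a + 1 := by
    by_cases hz : z ∈ Metric.closedBall z₀ a
    · simp only [f, if_pos hz]
      have hz0 : z₀ ∈ Metric.closedBall z₀ a := Metric.mem_closedBall_self ha0.le
      have h1 := h.lip.dist_le_mul _ (hPW hz) _ (hPW hz0)
      have h2 : dist (P z) (P z₀) ≤ a := (hP z z₀).trans hz
      rw [hP0] at h1 h2
      have h3 : (C : ℝ) * dist (P z) z₀ ≤ C * a := by gcongr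
      have h4 := norm_le_norm_add_norm_sub' (F (P z)) (F z₀)
      rw [← dist_eq_norm] at h4
      linarith
    · simp only [f, if_neg hz, norm_zero]
      positivity
  obtain ⟨ε, hε, α, hα, hc⟩ := exists_flow_of_lipschitzOnWith ha0 (by positivity) hf hb
  -- The normal velocity is bounded by a multiple of `max ρ 0 ≤ |ρ|`, so a trajectory cannot leave
  -- the half-space.
  have hnn {z : ℝ × E} (hz : z ∈ halfSpace E ∩ Metric.closedBall z₀ (a / 2)) {t : ℝ}
      (ht : t ∈ Icc (-ε) ε) : 0 ≤ (α (z, t)).1 := by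
    have h0 : (0 : ℝ) ∈ Icc (-ε) ε := ⟨by linarith, hε.le⟩
    have hS : uIcc 0 t ⊆ Icc (-ε) ε := (ordConnected_Icc).uIcc_subset h0 ht
    have hd (σ : ℝ) (hσ : σ ∈ Icc (0 : ℝ) 1) := (HasDerivWithinAt.comp_segment
      (fun t ht ↦ ((hα z hz.2).2 t ht).2) hS hσ).prod_fst
    have hmem (σ : ℝ) (hσ : σ ∈ Icc (0 : ℝ) 1) : 0 + σ * (t - 0) ∈ Icc (-ε) ε := hS (by
      rw [← segment_eq_uIcc, segment_eq_image']
      exact ⟨σ, hσ, by simp⟩)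
    have := nonneg_of_abs_deriv_le (C := |t| * (2 * C)) hd (fun σ hσ ↦ ?_) ?_
    · simpa using this
    · have hB := ((hα z hz.2).2 _ (hmem σ hσ)).1
      simp only [f, if_pos hB]
      rw [Prod.smul_fst, smul_eq_mul, abs_mul, sub_zero, mul_assoc]
      gcongr
      refine (h.abs_fst_le_abs (hPW (by simpa using hB))).trans ?_
      refine mul_le_mul_of_nonneg_left ?_ (mul_nonneg zero_le_two C.2)
      have e (x : ℝ) : |max x 0| ≤ |x| := by
        rw [abs_of_nonneg (le_max_right x 0)]
        exact max_le (le_abs_self _) (abs_nonneg _)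
      simpa using e _
    · simp only [zero_mul, add_zero, (hα z hz.2).1]
      exact hz.1
  refine ⟨ε, hε, a / 2, by positivity, α, fun z hz ↦ ⟨(hα z hz.2).1, fun t ht ↦ ?_⟩,
    hc.mono (prod_mono_left inter_subset_right)⟩
  have hB := ((hα z hz.2).2 t ht).1
  have hPα : P (α (z, t)) = α (z, t) := Prod.ext (max_eq_left (hnn hz ht)) rfl
  refine ⟨hPα ▸ hPW hB, ?_⟩
  have := ((hα z hz.2).2 t ht).2
  simpa only [f, if_pos hB, hPα] using this

end HalfSpaceFlowExistence

/-! ### Integral curves in charts -/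

section IntegralCurveCharts

lemma HasMFDerivWithinAt.hasDerivWithinAt_space {F : Type*} [NormedAddCommGroup F] [NormedSpace ℝ F]
    {φ : ℝ → F} {L : ℝ →L[ℝ] F} {s : Set ℝ} {t : ℝ}
    (h : HasMFDerivWithinAt 𝓘(ℝ, ℝ) 𝓘(ℝ, F) φ s t L) : HasDerivWithinAt φ (L 1) s t :=
  HasFDerivWithinAt.hasDerivWithinAt (show HasFDerivWithinAt φ L s t from
    hasMFDerivWithinAt_iff_hasFDerivWithinAt.1 h)

lemma clm_comp_toSpanSingleton {E F : Type*} [NormedAddCommGroup E] [NormedSpace ℝ E]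
    [NormedAddCommGroup F] [NormedSpace ℝ F] (L : E →L[ℝ] F) (v : E) (w : F) (h : L v = w) :
    L.comp (ContinuousLinearMap.toSpanSingleton ℝ v) = (1 : ℝ →L[ℝ] ℝ).smulRight w := by
  ext; simp [h]

variable {E : Type*} [NormedAddCommGroup E] [NormedSpace ℝ E]
  {H : Type*} [TopologicalSpace H] {I : ModelWithCorners ℝ E H} [I.Boundaryless]
  {M : Type*} [TopologicalSpace M] [ChartedSpace H M] [IsManifold I ∞ M]

lemma IsMIntegralCurveOn.hasDerivWithinAt_chartRep {γ : ℝ → M} {X : Π x : M, TangentSpace I x}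
    {s : Set ℝ} (hγ : IsMIntegralCurveOn γ X s) {t : ℝ} (ht : t ∈ s) {x₀ : M}
    (hx : γ t ∈ (extChartAt I x₀).source) :
    HasDerivWithinAt (extChartAt I x₀ ∘ γ) (chartRep I x₀ X (extChartAt I x₀ (γ t))) s t := by
  have : IsManifold I 1 M := .of_le (n := ∞) (by simp)
  have hx' : γ t ∈ (chartAt H x₀).source := by rwa [extChartAt_source] at hx
  have h1 := (mdifferentiableAt_extChartAt (I := I) hx').hasMFDerivAt.comp_hasMFDerivWithinAt t (hγ t ht)
  refine (HasMFDerivWithinAt.hasDerivWithinAt_space h1).congr_deriv ?_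
  refine Eq.trans ?_ (chartRep_extChartAt hx X).symm
  exact congrArg (mfderiv I 𝓘(ℝ, E) (extChartAt I x₀) (γ t)) (one_smul ℝ (X (γ t)))

lemma hasMFDerivWithinAt_of_chartRep {β : ℝ → E} {X : Π x : M, TangentSpace I x} {s : Set ℝ} {t : ℝ}
    {x₀ : M} (hβ : HasDerivWithinAt β (chartRep I x₀ X (β t)) s t)
    (ht : β t ∈ (extChartAt I x₀).target) :
    HasMFDerivWithinAt 𝓘(ℝ, ℝ) I ((extChartAt I x₀).symm ∘ β) s t
      ((1 : ℝ →L[ℝ] ℝ).smulRight (X ((extChartAt I x₀).symm (β t)))) := by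
  have : IsManifold I 1 M := .of_le (n := ∞) (by simp)
  have h0 : MDifferentiableAt 𝓘(ℝ, E) I (extChartAt I x₀).symm (β t) := by
    have := mdifferentiableWithinAt_extChartAt_symm (I := I) ht
    rwa [I.range_eq_univ, mdifferentiableWithinAt_univ] at this
  have h1 : HasMFDerivWithinAt 𝓘(ℝ, ℝ) 𝓘(ℝ, E) β s t _ := hβ.hasFDerivWithinAt.hasMFDerivWithinAt
  have h2 := mfderivWithin_extChartAt_symm_comp_mfderiv_extChartAt (I := I) ht
  rw [I.range_eq_univ, mfderivWithin_univ] at h2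
  have h3 := DFunLike.congr_fun h2 (X ((extChartAt I x₀).symm (β t)))
  exact (h0.hasMFDerivAt.comp_hasMFDerivWithinAt t h1).congr_mfderiv
    (clm_comp_toSpanSingleton (E := E) (F := E) _ _ _ h3)

end IntegralCurveCharts

namespace AsymptoticallyFlat

open scoped NNReal

variable {kind : InfinityKind} {n : ℕ} {B : Type*} [TopologicalSpace B]
  [ChartedSpace (EuclideanSpace ℝ (Fin n)) B] [IsManifold (𝓡 n) ∞ B]
  {S : AsymptoticallyFlat kind n B} {ξ : Π p : ℝ × B, TangentSpace (lineModel n) p} {w : B → ℝ}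
  {χ : Π y : B, TangentSpace (𝓡 n) y}

lemma IsAsymptoticSymmetry.exists_expansion (h : S.IsAsymptoticSymmetry ξ w χ) (y : B) :
    ∃ g, HasBoundaryExpansion (chartRep (lineModel n) (0, y) ξ) (w ∘ (extChartAt (𝓡 n) y).symm)
      (chartRep (𝓡 n) y χ) g (extChartAt (𝓡 n) y y) := by
  obtain ⟨hs, hw, hχ, hl, G, hG, hb⟩ := h
  exact ⟨_, S.hasBoundaryExpansion hs hw hχ.1 (hG.smooth S.h_smooth S.h_nondegenerate hw) hl hb y⟩

/-- A neighbourhood of a boundary point on which an asymptotic symmetry is well controlled. -/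
lemma IsAsymptoticSymmetry.exists_window (h : S.IsAsymptoticSymmetry ξ w χ) (y : B) :
    ∃ (C : ℝ≥0), ∃ W ∈ 𝓝[halfSpace (EuclideanSpace ℝ (Fin n))] ((0 : ℝ), extChartAt (𝓡 n) y y),
      ControlledOn (chartRep (lineModel n) (0, y) ξ) (w ∘ (extChartAt (𝓡 n) y).symm) W C ∧
      ∀ z ∈ W, z ∈ (extChartAt (lineModel n) ((0 : ℝ), y)).target ∧
        (extChartAt (lineModel n) ((0 : ℝ), y)).symm z ∈ S.dom := by
  obtain ⟨g, hg⟩ := h.exists_expansion y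
  obtain ⟨C, W, hW, hC⟩ := hg.exists_controlledOn
  have h1 : ∀ᶠ z in 𝓝[halfSpace (EuclideanSpace ℝ (Fin n))] ((0 : ℝ), extChartAt (𝓡 n) y y),
      z ∈ (extChartAt (lineModel n) ((0 : ℝ), y)).target ∧
        (extChartAt (lineModel n) ((0 : ℝ), y)).symm z ∈ S.dom := by
    have h3 := eventually_mem_line_target (n := n) (p := ((0 : ℝ), y)) (q := (0, y))
      (mem_extChartAt_source (I := 𝓡 n) y)
    rw [chart_boundary] at h3
    filter_upwards [mem_nhdsWithin_of_mem_nhds (S.preimage_dom_eventuallyEq y),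
      mem_nhdsWithin_of_mem_nhds h3, self_mem_nhdsWithin] with z hz ht hz0
    exact ⟨mem_extChartAt_lineModel_target.2 ht, hz.mpr hz0⟩
  exact ⟨C, _, inter_mem hW h1, hC.mono inter_subset_left, fun z hz ↦ hz.2⟩

/-- Asymptotic symmetries have local flows around boundary points. -/
lemma IsAsymptoticSymmetry.exists_localFlow (h : S.IsAsymptoticSymmetry ξ w χ) (y : B) :
    ∃ Φ D, S.IsLocalFlow ξ Φ D ∧ ((0 : ℝ), ((0 : ℝ), y)) ∈ D := by
  obtain ⟨C, W, hW, hC, hWt⟩ := h.exists_window y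
  obtain ⟨ε, hε, r, hr, α, hα, hc⟩ := hC.exists_flow hW
  set e := extChartAt (lineModel n) ((0 : ℝ), y) with he
  set z₀ : ℝ × EuclideanSpace ℝ (Fin n) := (0, extChartAt (𝓡 n) y y) with hz₀
  have hez₀ : e (0, y) = z₀ := chart_boundary y
  set O : Set (ℝ × (ℝ × B)) := Ioo (-ε) ε ×ˢ (e.source ∩ e ⁻¹' Metric.ball z₀ r) with hO
  have hα' {z : ℝ × (ℝ × B)} (hz : z ∈ O ∩ {z | z.2 ∈ S.dom}) :
      e z.2 ∈ halfSpace (EuclideanSpace ℝ (Fin n)) ∩ Metric.closedBall z₀ r := by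
    refine ⟨?_, Metric.ball_subset_closedBall hz.1.2.2⟩
    rw [he, extChartAt_lineModel]
    exact S.dom_nonneg hz.2
  have hW' {z : ℝ × (ℝ × B)} (hz : z ∈ O ∩ {z | z.2 ∈ S.dom}) : α (e z.2, z.1) ∈ W :=
    ((hα _ (hα' hz)).2 z.1 (Ioo_subset_Icc_self hz.1.1)).1
  refine ⟨fun t p ↦ e.symm (α (e p, t)), O ∩ {z | z.2 ∈ S.dom}, ⟨⟨O, ?_, rfl⟩, ?_, ?_, ?_, ?_, ?_⟩, ?_⟩
  · exact isOpen_Ioo.prod (isOpen_extChartAt_preimage' _ Metric.isOpen_ball)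
  · intro t p hp s hs
    exact ⟨⟨(ordConnected_Ioo).uIcc_subset ⟨by linarith, hε⟩ hp.1.1 hs, hp.1.2⟩, hp.2⟩
  · intro t p hp
    exact (hWt _ (hW' hp)).2
  · intro p hp
    rw [(hα _ (hα' hp)).1, e.left_inv hp.1.2.1]
  · have h1 : ContinuousOn (fun z : ℝ × (ℝ × B) ↦ (e z.2, z.1)) (O ∩ {z | z.2 ∈ S.dom}) := by
      refine ContinuousOn.prodMk ?_ continuousOn_fst
      exact (continuousOn_extChartAt _).comp continuousOn_snd fun z hz ↦ hz.1.2.1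
    exact (continuousOn_extChartAt_symm _).comp
      (hc.comp h1 fun z hz ↦ ⟨hα' hz, Ioo_subset_Icc_self hz.1.1⟩) fun z hz ↦ (hWt _ (hW' hz)).1
  · intro p t ht
    have h3 : {t | (t, p) ∈ O ∩ {z | z.2 ∈ S.dom}} ⊆ Icc (-ε) ε :=
      fun s hs ↦ Ioo_subset_Icc_self hs.1.1
    have h2 := ((hα _ (hα' ht)).2 t (Ioo_subset_Icc_self ht.1.1)).2.mono h3
    exact hasMFDerivWithinAt_of_chartRep h2 (hWt _ (hW' ht)).1
  · refine ⟨⟨⟨by linarith, hε⟩, mem_extChartAt_source _, ?_⟩, S.boundary_mem y⟩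
    rw [mem_preimage, hez₀]
    exact Metric.mem_ball_self hr

end AsymptoticallyFlat

/-! ### Local flows of asymptotic symmetries -/

section ChartChange

variable {E : Type*} [NormedAddCommGroup E] [NormedSpace ℝ E]
  {H : Type*} [TopologicalSpace H] {I : ModelWithCorners ℝ E H} [I.Boundaryless]
  {M : Type*} [TopologicalSpace M] [ChartedSpace H M] [IsManifold I ∞ M]

/-- Distances to a point measured in two charts are comparable. -/
lemma isBigO_extChartAt_sub {x₁ x₂ p : M} (h₁ : p ∈ (extChartAt I x₁).source)
    (h₂ : p ∈ (extChartAt I x₂).source) :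
    (fun q ↦ extChartAt I x₂ q - extChartAt I x₂ p) =O[𝓝 p]
      fun q ↦ extChartAt I x₁ q - extChartAt I x₁ p := by
  have h3 : ContMDiffAt I 𝓘(ℝ, E) ∞ (extChartAt I x₂) p :=
    contMDiffAt_extChartAt' (by rwa [extChartAt_source] at h₂)
  -- The change of charts is differentiable at the point, hence its increments are bounded by a
  -- multiple of the displacement.
  have h4 := ((contMDiffAt_iff_comp_symm h₁).1 h3).differentiableAt (by simp)
  have h5 := h4.isBigO_sub.comp_tendsto (continuousAt_extChartAt' h₁)
  refine h5.congr' ?_ EventuallyEq.rfl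
  filter_upwards [extChartAt_source_mem_nhds' h₁] with q hq
  simp only [Function.comp_apply]
  rw [(extChartAt I x₁).left_inv hq, (extChartAt I x₁).left_inv h₁]

end ChartChange

namespace AsymptoticallyFlat

open scoped NNReal

variable {kind : InfinityKind} {n : ℕ} {B : Type*} [TopologicalSpace B]
  [ChartedSpace (EuclideanSpace ℝ (Fin n)) B] [IsManifold (𝓡 n) ∞ B]
  {S : AsymptoticallyFlat kind n B} {ξ : Π p : ℝ × B, TangentSpace (lineModel n) p} {w : B → ℝ}
  {χ : Π y : B, TangentSpace (𝓡 n) y} {Φ : ℝ → ℝ × B → ℝ × B} {D : Set (ℝ × (ℝ × B))}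

lemma IsAsymptoticSymmetry.baseComp_boundary (h : S.IsAsymptoticSymmetry ξ w χ) (y : B) :
    baseComp (ξ (0, y)) = χ y := by
  have : IsManifold (𝓡 n) 1 B := .of_le (n := ∞) (by simp)
  have : IsManifold (lineModel n) 1 (ℝ × B) := .of_le (n := ∞) (by simp)
  obtain ⟨g, hg⟩ := h.exists_expansion y
  have h1 := (hg.flat_snd 0 (by norm_num)).self_of_nhds
  simp only [Function.iterate_zero, id_eq, zero_smul, add_zero] at h1
  rw [← chart_boundary] at h1
  have h2 := sub_eq_zero.1 h1
  have h3 := chartRep_self ((0 : ℝ), y) ξ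
  have h4 := chartRep_self y χ
  exact (congrArg Prod.snd h3).symm.trans (h2.trans h4)

/-! ### Times of existence, neighbourhoods in the flow domain, and invariance of the boundary. -/

namespace IsLocalFlow

lemma isOpen_times (hΦ : S.IsLocalFlow ξ Φ D) {p : ℝ × B} (hp : p ∈ S.dom) :
    IsOpen {t | (t, p) ∈ D} := by
  obtain ⟨O, hO, rfl⟩ := hΦ.isOpen
  have : {t : ℝ | (t, p) ∈ O ∩ {z | z.2 ∈ S.dom}} = (fun t ↦ (t, p)) ⁻¹' O := by
    ext t; simp [hp]
  rw [this]
  exact hO.preimage (Continuous.prodMk_left p)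

lemma ordConnected_times (hΦ : S.IsLocalFlow ξ Φ D) (p : ℝ × B) :
    OrdConnected {t | (t, p) ∈ D} :=
  ordConnected_of_uIcc_subset_left (x := 0) fun t ht s hs ↦ hΦ.interval t p ht s hs

lemma isPreconnected_times (hΦ : S.IsLocalFlow ξ Φ D) (p : ℝ × B) :
    IsPreconnected {t | (t, p) ∈ D} :=
  (hΦ.ordConnected_times p).isPreconnected

lemma mem_dom (hΦ : S.IsLocalFlow ξ Φ D) {t : ℝ} {p : ℝ × B} (h : (t, p) ∈ D) : p ∈ S.dom := by
  obtain ⟨O, hO, rfl⟩ := hΦ.isOpen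
  exact h.2

lemma zero_mem (hΦ : S.IsLocalFlow ξ Φ D) {t : ℝ} {p : ℝ × B} (h : (t, p) ∈ D) : (0, p) ∈ D :=
  hΦ.interval t p h 0 left_mem_uIcc

lemma nhdsWithin_eq (hΦ : S.IsLocalFlow ξ Φ D) {t : ℝ} {p : ℝ × B} (h : (t, p) ∈ D) :
    𝓝[D] (t, p) = 𝓝 t ×ˢ 𝓝[S.dom] p := by
  obtain ⟨O, hO, rfl⟩ := hΦ.isOpen
  have h1 : {z : ℝ × (ℝ × B) | z.2 ∈ S.dom} = univ ×ˢ S.dom := by ext; simp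
  rw [nhdsWithin_inter_of_mem (mem_nhdsWithin_of_mem_nhds (hO.mem_nhds h.1)), h1,
    nhdsWithin_prod_eq, nhdsWithin_univ]

lemma tendsto (hΦ : S.IsLocalFlow ξ Φ D) {t : ℝ} {p : ℝ × B} (h : (t, p) ∈ D) :
    Tendsto (fun z : ℝ × (ℝ × B) ↦ Φ z.1 z.2) (𝓝 t ×ˢ 𝓝[S.dom] p) (𝓝[S.dom] (Φ t p)) := by
  rw [← hΦ.nhdsWithin_eq h]
  exact tendsto_nhdsWithin_iff.2 ⟨hΦ.continuousOn _ h,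
    eventually_mem_nhdsWithin.mono fun z hz ↦ hΦ.mapsTo _ _ hz⟩

lemma tendsto_apply (hΦ : S.IsLocalFlow ξ Φ D) {t : ℝ} {p : ℝ × B} (h : (t, p) ∈ D) :
    Tendsto (Φ t) (𝓝[S.dom] p) (𝓝[S.dom] (Φ t p)) :=
  (hΦ.tendsto h).comp (tendsto_const_pure.mono_right (pure_le_nhds t) |>.prodMk tendsto_id)

/-- Near a time at which a trajectory is at the boundary, nearby trajectories can be followed in a
chart in which the vector field is well controlled. -/
lemma exists_window (hΦ : S.IsLocalFlow ξ Φ D) (h : S.IsAsymptoticSymmetry ξ w χ) {s₀ : ℝ}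
    {p : ℝ × B} (hD : (s₀, p) ∈ D) {y₀ : B} (hy₀ : Φ s₀ p = (0, y₀)) :
    ∃ (C : ℝ≥0), ∃ W,
      ControlledOn (chartRep (lineModel n) (0, y₀) ξ) (w ∘ (extChartAt (𝓡 n) y₀).symm) W C ∧
      ∃ δ > 0, δ ≤ 1 / 2 ∧ ∀ᶠ q in 𝓝[S.dom] p, ∀ s ∈ Ioo (s₀ - δ) (s₀ + δ), (s, q) ∈ D ∧
        Φ s q ∈ (extChartAt (lineModel n) ((0 : ℝ), y₀)).source ∧
        extChartAt (lineModel n) ((0 : ℝ), y₀) (Φ s q) ∈ W := by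
  obtain ⟨C, W, hW, hC, -⟩ := h.exists_window y₀
  refine ⟨C, W, hC, ?_⟩
  have h1 : ∀ᶠ q in 𝓝[S.dom] ((0 : ℝ), y₀), q ∈ (extChartAt (lineModel n) ((0 : ℝ), y₀)).source ∧
      extChartAt (lineModel n) ((0 : ℝ), y₀) q ∈ W := by
    filter_upwards [mem_nhdsWithin_of_mem_nhds (extChartAt_source_mem_nhds (I := lineModel n) ((0 : ℝ), y₀)),
      (S.tendsto_chart y₀).eventually hW] with q hq hq' using ⟨hq, hq'⟩
  have h2 := hΦ.tendsto hD
  rw [hy₀] at h2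
  have h3 : ∀ᶠ z in 𝓝 s₀ ×ˢ 𝓝[S.dom] p, z ∈ D := by
    rw [← hΦ.nhdsWithin_eq hD]; exact eventually_mem_nhdsWithin
  obtain ⟨P, hP, Q, hQ, H⟩ := eventually_prod_iff.1 (h3.and (h2.eventually h1))
  obtain ⟨δ, hδ, hball⟩ := Metric.eventually_nhds_iff_ball.1 hP
  -- The bound `1 / 2` ensures that two times in the window differ by at most `1`, as the trajectory
  -- estimates require.
  refine ⟨min δ (1 / 2), by positivity, min_le_right _ _, hQ.mono fun q hq s hs ↦ H (hball s ?_) hq⟩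
  rw [Real.ball_eq_Ioo]
  have := min_le_left δ (1 / 2)
  exact ⟨by linarith [hs.1], by linarith [hs.2]⟩

/-- Produces trajectories in unit time, with velocity factor `b - a`, in the form taken by the
estimates of `ControlledOn`. -/
lemma hasDerivWithinAt_segment (hΦ : S.IsLocalFlow ξ Φ D) {y₀ : B} {q : ℝ × B} {a b : ℝ}
    {W : Set (ℝ × EuclideanSpace ℝ (Fin n))}
    (hT : ∀ s ∈ uIcc a b, (s, q) ∈ D ∧ Φ s q ∈ (extChartAt (lineModel n) ((0 : ℝ), y₀)).source ∧
      extChartAt (lineModel n) ((0 : ℝ), y₀) (Φ s q) ∈ W) :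
    (∀ σ ∈ Icc (0 : ℝ) 1,
      HasDerivWithinAt (fun σ ↦ extChartAt (lineModel n) ((0 : ℝ), y₀) (Φ (a + σ * (b - a)) q))
        ((b - a) • chartRep (lineModel n) (0, y₀) ξ
          (extChartAt (lineModel n) ((0 : ℝ), y₀) (Φ (a + σ * (b - a)) q))) (Icc 0 1) σ) ∧
    ∀ σ ∈ Icc (0 : ℝ) 1, extChartAt (lineModel n) ((0 : ℝ), y₀) (Φ (a + σ * (b - a)) q) ∈ W := by
  refine ⟨fun σ hσ ↦ ?_, fun σ hσ ↦ (hT _ ?_).2.2⟩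
  · refine HasDerivWithinAt.comp_segment (φ := fun s ↦ extChartAt (lineModel n) ((0 : ℝ), y₀) (Φ s q))
      (φ' := fun s ↦ chartRep (lineModel n) (0, y₀) ξ (extChartAt (lineModel n) ((0 : ℝ), y₀) (Φ s q)))
      (S := uIcc a b) (fun s hs ↦ ?_) subset_rfl hσ
    exact ((hΦ.integralCurve q).hasDerivWithinAt_chartRep (hT s hs).1 (hT s hs).2.1).mono
      fun s hs ↦ (hT s hs).1
  · rw [← segment_eq_uIcc, segment_eq_image']
    exact ⟨σ, hσ, by simp⟩

/-- Local flows preserve the boundary. -/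
lemma fst_eq_zero (hΦ : S.IsLocalFlow ξ Φ D) (h : S.IsAsymptoticSymmetry ξ w χ) {p : ℝ × B}
    (hp : p.1 = 0) {t : ℝ} (ht : (t, p) ∈ D) : (Φ t p).1 = 0 := by
  have hdom := hΦ.mem_dom ht
  have h0 := hΦ.zero_mem ht
  -- Being at the boundary at one time implies it at another: this relation is transitive and holds
  -- in both directions for nearby times, so connectedness of the set of times propagates it from
  -- `0` to `t`.
  refine (hΦ.isPreconnected_times p).induction₂' (fun s t ↦ (Φ s p).1 = 0 → (Φ t p).1 = 0)
    (fun s hs ↦ ?_) (fun _ _ _ _ _ _ h1 h2 h3 ↦ h2 (h1 h3)) h0 ht (by rw [hΦ.zero p h0, hp])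
  by_cases hz : (Φ s p).1 = 0
  · obtain ⟨y₀, hy₀⟩ : ∃ y₀, Φ s p = (0, y₀) := ⟨(Φ s p).2, Prod.ext hz rfl⟩
    obtain ⟨C, W, hC, δ, hδ, -, hq⟩ := hΦ.exists_window h hs hy₀
    have hq := hq.self_of_nhdsWithin hdom
    filter_upwards [mem_nhdsWithin_of_mem_nhds (Ioo_mem_nhds (sub_lt_self s hδ) (lt_add_of_pos_right s hδ))]
      with s' hs'
    have key {a b : ℝ} (ha : a ∈ Ioo (s - δ) (s + δ)) (hb : b ∈ Ioo (s - δ) (s + δ))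
        (h0 : (Φ a p).1 = 0) : (Φ b p).1 = 0 := by
      obtain ⟨hd, hm⟩ := hΦ.hasDerivWithinAt_segment
        fun s' hs' ↦ hq s' (ordConnected_Ioo.uIcc_subset ha hb hs')
      have := eq_zero_of_abs_deriv_le (C := |b - a| * (2 * C)) (fun σ hσ ↦ (hd σ hσ).prod_fst)
        (fun σ hσ ↦ ?_) ?_
      · rw [extChartAt_lineModel] at this
        simpa only [one_mul, add_sub_cancel] using this
      · rw [Prod.smul_fst, smul_eq_mul, abs_mul, mul_assoc]
        gcongr
        exact hC.abs_fst_le_abs (hm σ hσ)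
      · rw [extChartAt_lineModel]
        simpa only [zero_mul, add_zero] using h0
    have hs : s ∈ Ioo (s - δ) (s + δ) := ⟨sub_lt_self s hδ, lt_add_of_pos_right s hδ⟩
    exact ⟨key hs hs', key hs' hs⟩
  -- Off the boundary at time `s`, the trajectory is off the boundary at all nearby times, and both
  -- implications are vacuous.
  · have hc : ContinuousWithinAt (fun t ↦ (Φ t p).1) {t | (t, p) ∈ D} s :=
      (hΦ.integralCurve p s hs).1.fst
    filter_upwards [hc.eventually_ne hz] with t ht
    exact ⟨fun h ↦ absurd h hz, fun h ↦ absurd h ht⟩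

end IsLocalFlow

end AsymptoticallyFlat

/-! ### Second order expansion of local flows at the boundary -/

namespace AsymptoticallyFlat

open scoped NNReal

variable {kind : InfinityKind} {n : ℕ} {B : Type*} [TopologicalSpace B]
  [ChartedSpace (EuclideanSpace ℝ (Fin n)) B] [IsManifold (𝓡 n) ∞ B]
  {S : AsymptoticallyFlat kind n B} {ξ : Π p : ℝ × B, TangentSpace (lineModel n) p} {w : B → ℝ}
  {χ : Π y : B, TangentSpace (𝓡 n) y} {Φ : ℝ → ℝ × B → ℝ × B} {D : Set (ℝ × (ℝ × B))}

/-- The displacement from `p` in the chart at `p`. -/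
noncomputable def displacement (p q : ℝ × B) : ℝ × EuclideanSpace ℝ (Fin n) :=
  extChartAt (lineModel n) p q - extChartAt (lineModel n) p p

lemma tendsto_displacement (p : ℝ × B) : Tendsto (displacement (n := n) p) (𝓝 p) (𝓝 0) := by
  have h := (continuousAt_extChartAt (I := lineModel n) p).sub_const (extChartAt (lineModel n) p p)
  have h1 : displacement (n := n) p p = 0 := sub_self _
  rw [← h1]
  exact h

lemma displacement_fst {p : ℝ × B} (hp : p.1 = 0) (q : ℝ × B) :
    (displacement (n := n) p q).1 = q.1 := by
  rw [displacement, extChartAt_lineModel, extChartAt_lineModel, Prod.fst_sub, hp, sub_zero]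

lemma isBigO_fst_displacement {p : ℝ × B} (hp : p.1 = 0) (l : Filter (ℝ × B)) :
    (fun q : ℝ × B ↦ q.1) =O[l] displacement (n := n) p :=
  IsBigO.of_bound 1 (Eventually.of_forall fun q ↦ by
    rw [one_mul, ← displacement_fst (n := n) hp q]
    exact norm_fst_le _)

lemma isBigO_sub_displacement {x p : ℝ × B} (hp : p ∈ (extChartAt (lineModel n) x).source) :
    (fun q ↦ extChartAt (lineModel n) x q - extChartAt (lineModel n) x p) =O[𝓝 p]
      displacement (n := n) p :=
  isBigO_extChartAt_sub (mem_extChartAt_source p) hp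

lemma displacement_isBigO {x p : ℝ × B} (hp : p ∈ (extChartAt (lineModel n) x).source) :
    displacement (n := n) p =O[𝓝 p]
      (fun q ↦ extChartAt (lineModel n) x q - extChartAt (lineModel n) x p) :=
  isBigO_extChartAt_sub hp (mem_extChartAt_source p)

/-- The local diffeomorphism `Ψ`, defined near the boundary point `p`, is Lipschitz at `p`, and it
transforms `ρ` into `ρ - k ρ²` up to terms of third order. -/
structure ExpandsAt (S : AsymptoticallyFlat kind n B) (Ψ : ℝ × B → ℝ × B) (p : ℝ × B) (k : ℝ) :
    Prop where
  lipschitz : (fun q ↦ displacement (n := n) (Ψ p) (Ψ q)) =O[𝓝[S.dom] p] displacement (n := n) p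
  fst : (fun q ↦ (Ψ q).1 - q.1 + q.1 ^ 2 * k) =O[𝓝[S.dom] p]
    fun q ↦ q.1 ^ 2 * ‖displacement (n := n) p q‖

namespace ExpandsAt

variable {Ψ : ℝ × B → ℝ × B} {p : ℝ × B} {k : ℝ}

lemma fst_sub (h : S.ExpandsAt Ψ p k) :
    (fun q ↦ (Ψ q).1 - q.1) =O[𝓝[S.dom] p] fun q ↦ q.1 ^ 2 := by
  have h1 : (fun q : ℝ × B ↦ q.1 ^ 2 * ‖displacement (n := n) p q‖) =O[𝓝[S.dom] p]
      fun q ↦ q.1 ^ 2 * 1 :=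
    (isBigO_refl _ _).mul (((tendsto_displacement p).mono_left nhdsWithin_le_nhds).isBigO_one ℝ).norm_left
  have h2 : (fun q : ℝ × B ↦ q.1 ^ 2 * k) =O[𝓝[S.dom] p] fun q ↦ q.1 ^ 2 * 1 :=
    (isBigO_refl _ _).mul (isBigO_const_const k one_ne_zero _)
  simpa using (h.fst.trans h1).sub h2

lemma fst_isBigO (h : S.ExpandsAt Ψ p k) :
    (fun q ↦ (Ψ q).1) =O[𝓝[S.dom] p] fun q ↦ q.1 := by
  have h1 : (fun q : ℝ × B ↦ q.1) =O[𝓝[S.dom] p] fun _ ↦ (1 : ℝ) :=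
    ((continuous_fst.tendsto p).mono_left nhdsWithin_le_nhds).isBigO_one ℝ
  have h2 : (fun q : ℝ × B ↦ q.1 ^ 2) =O[𝓝[S.dom] p] fun q ↦ q.1 := by
    simpa [sq] using h1.mul (isBigO_refl (fun q : ℝ × B ↦ q.1) _)
  simpa using (h.fst_sub.trans h2).add (isBigO_refl _ _)

/-- The difference of squares factors into `O(ρ²)` times `O(ρ)`, and at a boundary point `ρ` is
bounded by the displacement. -/
lemma sq_sub_sq (h : S.ExpandsAt Ψ p k) (hp : p.1 = 0) :
    (fun q ↦ (Ψ q).1 ^ 2 - q.1 ^ 2) =O[𝓝[S.dom] p]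
      fun q ↦ q.1 ^ 2 * ‖displacement (n := n) p q‖ := by
  have h1 : (fun q ↦ (Ψ q).1 + q.1) =O[𝓝[S.dom] p] fun q ↦ ‖displacement (n := n) p q‖ :=
    ((h.fst_isBigO.add (isBigO_refl _ _)).trans (isBigO_fst_displacement hp _)).norm_right
  refine (h.fst_sub.mul h1).congr_left fun q ↦ ?_
  ring

end ExpandsAt

/-- One propagation step inside a single chart. Nearby trajectories are compared with that of `p`,
which runs in the boundary and along which `Ω` integrates `w`. Since `|b - a| ≤ 1` with either sign,
expansions propagate in both directions of time. -/
lemma IsLocalFlow.expandsAt_window (hΦ : S.IsLocalFlow ξ Φ D) {p : ℝ × B} (hp : p.1 = 0)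
    {Ω : ℝ → ℝ} (hΩ : ∀ s, (s, p) ∈ D → HasDerivWithinAt Ω (w (Φ s p).2) {s | (s, p) ∈ D} s)
    {y₀ : B} {C : ℝ≥0} {W : Set (ℝ × EuclideanSpace ℝ (Fin n))}
    (hC : ControlledOn (chartRep (lineModel n) (0, y₀) ξ) (w ∘ (extChartAt (𝓡 n) y₀).symm) W C)
    {a b : ℝ} (hab : |b - a| ≤ 1) (hpD : p ∈ S.dom) (hpa : (Φ a p).1 = 0)
    (hq : ∀ᶠ q in 𝓝[S.dom] p, ∀ s ∈ uIcc a b, (s, q) ∈ D ∧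
        Φ s q ∈ (extChartAt (lineModel n) ((0 : ℝ), y₀)).source ∧
        extChartAt (lineModel n) ((0 : ℝ), y₀) (Φ s q) ∈ W)
    (ha : S.ExpandsAt (Φ a) p (Ω a)) : S.ExpandsAt (Φ b) p (Ω b) := by
  have hP := hq.self_of_nhdsWithin hpD
  obtain ⟨hζ, hζW⟩ := hΦ.hasDerivWithinAt_segment hP
  have hpA := hP a left_mem_uIcc
  have hpB := hP b right_mem_uIcc
  have hΩ' (σ : ℝ) (hσ : σ ∈ Icc (0 : ℝ) 1) := HasDerivWithinAt.comp_segment (φ := Ω)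
    (φ' := fun s ↦ w (Φ s p).2) (S := uIcc a b)
    (fun s hs ↦ (hΩ s (hP s hs).1).mono fun s hs ↦ (hP s hs).1) subset_rfl hσ
  have hΩ'' (σ : ℝ) (hσ : σ ∈ Icc (0 : ℝ) 1) : HasDerivWithinAt (fun σ ↦ Ω (a + σ * (b - a)))
      ((b - a) * (w ∘ (extChartAt (𝓡 n) y₀).symm)
        (extChartAt (lineModel n) ((0 : ℝ), y₀) (Φ (a + σ * (b - a)) p)).2) (Icc 0 1) σ := by
    refine (hΩ' σ hσ).congr_deriv ?_
    have hm : a + σ * (b - a) ∈ uIcc a b := by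
      rw [← segment_eq_uIcc, segment_eq_image']
      exact ⟨σ, hσ, by simp⟩
    rw [extChartAt_lineModel, Function.comp_apply, (extChartAt (𝓡 n) y₀).left_inv
      (mem_extChartAt_lineModel_source.1 (hP _ hm).2.1), smul_eq_mul]
  set ψ : ℝ → ℝ × B → ℝ × EuclideanSpace ℝ (Fin n) := fun s q ↦
    extChartAt (lineModel n) ((0 : ℝ), y₀) (Φ s q) - extChartAt (lineModel n) ((0 : ℝ), y₀) (Φ s p) with hψ
  have hψa : ψ a =O[𝓝[S.dom] p] displacement (n := n) p :=
    (((isBigO_sub_displacement hpA.2.1).mono nhdsWithin_le_nhds).comp_tendsto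
      (hΦ.tendsto_apply hpA.1)).trans ha.lipschitz
  have hψb : ψ b =O[𝓝[S.dom] p] ψ a := by
    refine IsBigO.of_bound (Real.exp C) (hq.mono fun q hq ↦ ?_)
    obtain ⟨hz, hzW⟩ := hΦ.hasDerivWithinAt_segment hq
    have := hC.dist_le hab hz hζ hzW hζW (right_mem_Icc.2 zero_le_one)
    simpa only [one_mul, zero_mul, add_zero, add_sub_cancel, dist_eq_norm] using this
  have hfst : (fun q ↦ (Φ b q).1 - (Φ a q).1 + (Φ a q).1 ^ 2 * (Ω b - Ω a)) =O[𝓝[S.dom] p]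
      fun q ↦ (Φ a q).1 ^ 2 * ‖ψ a q‖ := by
    refine IsBigO.of_bound (C * Real.exp (2 * C) ^ 3 + C * Real.exp (2 * C) ^ 2 * Real.exp C +
      2 * C * Real.exp (2 * C) ^ 2 * (Real.exp (2 * C) + 1) * C) (hq.mono fun q hq ↦ ?_)
    obtain ⟨hz, hzW⟩ := hΦ.hasDerivWithinAt_segment hq
    have := hC.abs_fst_sub_le hab hz hζ hzW hζW (by
      rw [extChartAt_lineModel]
      simpa only [zero_mul, add_zero] using hpa) hΩ''
    rw [extChartAt_lineModel, extChartAt_lineModel] at this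
    simp only [one_mul, zero_mul, add_zero, add_sub_cancel] at this
    rw [norm_mul, norm_norm, Real.norm_of_nonneg (sq_nonneg (Φ a q).1), hψ, ← dist_eq_norm,
      Real.norm_eq_abs]
    exact this
  refine ⟨?_, ?_⟩
  · exact (((displacement_isBigO hpB.2.1).mono nhdsWithin_le_nhds).comp_tendsto
      (hΦ.tendsto_apply hpB.1)).trans (hψb.trans hψa)
  · have h1 : (fun q ↦ (Φ a q).1 ^ 2 * ‖ψ a q‖) =O[𝓝[S.dom] p]
        fun q ↦ q.1 ^ 2 * ‖displacement (n := n) p q‖ :=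
      (ha.fst_isBigO.pow 2).mul hψa.norm_norm
    -- The expansion from time `a` to `b` is added to the one at time `a`; subtracting `(ρ_a² -
    -- ρ²)(Ω b - Ω a)` refers everything to the initial `ρ²`, and the increments of `Ω` add up.
    have h2 := ((hfst.trans h1).add ha.fst).sub ((ha.sq_sub_sq hp).const_mul_left (Ω b - Ω a))
    refine h2.congr_left fun q ↦ ?_
    ring

/-- Local flows of asymptotic symmetries have a second order expansion at the boundary. -/
lemma IsLocalFlow.expandsAt (hΦ : S.IsLocalFlow ξ Φ D) (h : S.IsAsymptoticSymmetry ξ w χ)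
    {p : ℝ × B} (hp : p.1 = 0) {Ω : ℝ → ℝ} (hΩ0 : Ω 0 = 0)
    (hΩ : ∀ s, (s, p) ∈ D → HasDerivWithinAt Ω (w (Φ s p).2) {s | (s, p) ∈ D} s) {t : ℝ}
    (ht : (t, p) ∈ D) : S.ExpandsAt (Φ t) p (Ω t) := by
  have hdom := hΦ.mem_dom ht
  have h0 := hΦ.zero_mem ht
  -- Each window sees one chart only; connectedness of the time interval chains the windows from
  -- `0`, where the flow is the identity near `p`, to `t`.
  refine (hΦ.isPreconnected_times p).induction₂'
    (fun s t ↦ S.ExpandsAt (Φ s) p (Ω s) → S.ExpandsAt (Φ t) p (Ω t))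
    (fun s hs ↦ ?_) (fun _ _ _ _ _ _ h1 h2 h3 ↦ h2 (h1 h3)) h0 ht ?_
  · have hz := hΦ.fst_eq_zero h hp hs
    obtain ⟨y₀, hy₀⟩ : ∃ y₀, Φ s p = (0, y₀) := ⟨(Φ s p).2, Prod.ext hz rfl⟩
    obtain ⟨C, W, hC, δ, hδ, hδ2, hq⟩ := hΦ.exists_window h hs hy₀
    filter_upwards [mem_nhdsWithin_of_mem_nhds (Ioo_mem_nhds (sub_lt_self s hδ) (lt_add_of_pos_right s hδ)),
      self_mem_nhdsWithin] with s' hs' hsD'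
    have hs1 : s ∈ Ioo (s - δ) (s + δ) := ⟨sub_lt_self s hδ, lt_add_of_pos_right s hδ⟩
    have key {a b : ℝ} (ha : a ∈ Ioo (s - δ) (s + δ)) (hb : b ∈ Ioo (s - δ) (s + δ))
        (haD : (a, p) ∈ D) : S.ExpandsAt (Φ a) p (Ω a) → S.ExpandsAt (Φ b) p (Ω b) :=
      hΦ.expandsAt_window hp hΩ hC
        (abs_le.2 ⟨by linarith [ha.2, hb.1], by linarith [ha.1, hb.2]⟩) hdom
        (hΦ.fst_eq_zero h hp haD)
        (hq.mono fun q hq s' hs' ↦ hq s' (ordConnected_Ioo.uIcc_subset ha hb hs'))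
    exact ⟨key hs1 hs' hs, key hs' hs1 hsD'⟩
  · have h1 : ∀ᶠ q in 𝓝[S.dom] p, Φ 0 q = q := by
      have h2 : ∀ᶠ z in 𝓝 (0 : ℝ) ×ˢ 𝓝[S.dom] p, z ∈ D := by
        rw [← hΦ.nhdsWithin_eq h0]; exact eventually_mem_nhdsWithin
      have h3 : Tendsto (fun q : ℝ × B ↦ ((0 : ℝ), q)) (𝓝[S.dom] p) (𝓝 0 ×ˢ 𝓝[S.dom] p) :=
        tendsto_const_nhds.prodMk tendsto_id
      exact (h3.eventually h2).mono fun q hq ↦ hΦ.zero q hq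
    refine ⟨?_, ?_⟩
    · rw [hΦ.zero p h0]
      exact (isBigO_refl _ _).congr' (h1.mono fun q hq ↦ by simp only [hq]) EventuallyEq.rfl
    · refine (isBigO_zero _ _).congr' (h1.mono fun q hq ↦ ?_) EventuallyEq.rfl
      simp only [hq, hΩ0]
      simp

end AsymptoticallyFlat

/-! ### The action on the extended boundary -/

namespace AsymptoticallyFlat

variable {kind : InfinityKind} {n : ℕ} {B : Type*} [TopologicalSpace B]
  [ChartedSpace (EuclideanSpace ℝ (Fin n)) B] [IsManifold (𝓡 n) ∞ B]
  {S : AsymptoticallyFlat kind n B} {ξ : Π p : ℝ × B, TangentSpace (lineModel n) p} {w : B → ℝ}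
  {χ : Π y : B, TangentSpace (𝓡 n) y} {Φ : ℝ → ℝ × B → ℝ × B} {D : Set (ℝ × (ℝ × B))}

/-- The action on two-jets of the form `ρ + u ρ²`. -/
lemma ExpandsAt.isJetImage {Ψ : ℝ × B → ℝ × B} {p : ℝ × B} {k : ℝ} (h : S.ExpandsAt Ψ p k)
    (hp : p.1 = 0) {q₀ : ℝ × B} (hq₀ : Ψ p = q₀) (ht : Tendsto Ψ (𝓝[S.dom] p) (𝓝[S.dom] q₀))
    {u v : ℝ} (hv : v = u - k) :
    S.IsJetImage Ψ (S.jet q₀ (S.rhoQuad u q₀)) (S.jet p (S.rhoQuad v p)) := by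
  subst hq₀
  refine ⟨rfl, fun f f' hf hf' ↦ ?_⟩
  rw [jet_eq_iff] at hf hf'
  refine hf'.trans ?_
  have h1 : S.SameTwoJet p ((S.rhoQuad u (Ψ p)).1 ∘ Ψ) (f.1 ∘ Ψ) :=
    -- Since `Ψ` is Lipschitz at `p`, errors of second order at `Ψ p` remain of second order at `p`;
    -- hence the choice of representative does not matter.
    (IsLittleO.comp_tendsto hf.symm ht).trans_isBigO (h.lipschitz.norm_norm.pow 2)
  refine SameTwoJet.trans (g := (S.rhoQuad u (Ψ p)).1 ∘ Ψ) ?_ h1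
  have h2 := (h.fst.add ((h.sq_sub_sq hp).const_mul_left u)).neg_left
  -- One factor `ρ` is `o(1)` and the other is bounded by the displacement, so the error in the
  -- expansion is invisible in the two-jet.
  have h3 : (fun q : ℝ × B ↦ q.1 ^ 2 * ‖displacement (n := n) p q‖) =o[𝓝[S.dom] p]
      fun q ↦ ‖displacement (n := n) p q‖ ^ 2 := by
    have h4 : (fun q : ℝ × B ↦ q.1) =o[𝓝[S.dom] p] fun _ ↦ (1 : ℝ) := by
      rw [isLittleO_one_iff]
      have := continuous_fst.tendsto p
      rw [hp] at this
      exact this.mono_left nhdsWithin_le_nhds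
    have h5 := h4.mul_isBigO ((isBigO_fst_displacement (n := n) hp (𝓝[S.dom] p)).norm_right.mul
      (isBigO_refl (fun q ↦ ‖displacement (n := n) p q‖) _))
    refine h5.congr (fun q ↦ ?_) fun q ↦ ?_ <;> ring
  refine (h2.trans_isLittleO h3).congr_left fun q ↦ ?_
  simp only [Function.comp_apply, rhoQuad_apply, hv]
  ring

lemma clm_comp_smulRight {E F : Type*} [NormedAddCommGroup E] [NormedSpace ℝ E]
    [NormedAddCommGroup F] [NormedSpace ℝ F] (L : E →L[ℝ] F) (v : E) (w : F) (h : L v = w) :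
    L.comp ((1 : ℝ →L[ℝ] ℝ).smulRight v) = (1 : ℝ →L[ℝ] ℝ).smulRight w := by
  ext; simp [h]

lemma smulRight_one_injective {E : Type*} [NormedAddCommGroup E] [NormedSpace ℝ E] {v w : E}
    (h : (1 : ℝ →L[ℝ] ℝ).smulRight v = (1 : ℝ →L[ℝ] ℝ).smulRight w) : v = w := by
  simpa using DFunLike.congr_fun h 1

lemma clm_prod_smulRight {E F : Type*} [NormedAddCommGroup E] [NormedSpace ℝ E]
    [NormedAddCommGroup F] [NormedSpace ℝ F] (v : E) (w : F) :
    ((1 : ℝ →L[ℝ] ℝ).smulRight v).prod ((1 : ℝ →L[ℝ] ℝ).smulRight w) =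
      (1 : ℝ →L[ℝ] ℝ).smulRight (v, w) := by
  ext <;> simp

lemma IsAsymptoticSymmetry.baseComp_eq (h : S.IsAsymptoticSymmetry ξ w χ) {p : ℝ × B} (hp : p.1 = 0) :
    baseComp (ξ p) = χ p.2 := by
  obtain ⟨r, y⟩ := p
  obtain rfl : r = 0 := hp
  exact h.baseComp_boundary y

/-- At `ρ = 0` both corrections to `χ` in the tangential part of `ξ` vanish. -/
lemma IsMIntegralCurveOn.base (h : S.IsAsymptoticSymmetry ξ w χ) {γ : ℝ → ℝ × B}
    {T : Set ℝ} (hγ : IsMIntegralCurveOn γ ξ T) (h0 : ∀ t ∈ T, (γ t).1 = 0) :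
    IsMIntegralCurveOn (fun t ↦ (γ t).2) χ T := fun t ht ↦ by
  have h1 := (hasMFDerivAt_snd (I := 𝓘(ℝ, ℝ)) (I' := 𝓡 n) (γ t)).comp_hasMFDerivWithinAt t (hγ t ht)
  refine h1.congr_mfderiv (clm_comp_smulRight (E := ℝ × EuclideanSpace ℝ (Fin n))
    (F := EuclideanSpace ℝ (Fin n)) _ _ _ ?_)
  exact h.baseComp_eq (h0 t ht)

lemma hasDerivAt_primitive {J : Set ℝ} (hJ : IsOpen J) (hJc : OrdConnected J) (h0 : (0 : ℝ) ∈ J)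
    {f : ℝ → ℝ} (hf : ContinuousOn f J) {t : ℝ} (ht : t ∈ J) :
    HasDerivAt (fun t ↦ ∫ s in (0 : ℝ)..t, f s) (f t) t :=
  intervalIntegral.integral_hasDerivAt_right
    (hf.mono (hJc.uIcc_subset h0 ht)).intervalIntegrable
    (hf.stronglyMeasurableAtFilter hJ t ht) (hf.continuousAt (hJ.mem_nhds ht))

/-- Uniqueness of integral curves is applied on open intervals, so the compact segment of times has
to be thickened. -/
lemma exists_Ioo_of_uIcc_subset {K : Set ℝ} (hK : IsOpen K) {a b : ℝ}
    (h : uIcc a b ⊆ K) : ∃ c d, uIcc a b ⊆ Ioo c d ∧ Ioo c d ⊆ K := by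
  obtain ⟨c, hc, hcK⟩ := exists_Ioc_subset_of_mem_nhds (hK.mem_nhds (h ⟨le_rfl, inf_le_sup⟩))
    ⟨_, sub_one_lt _⟩
  obtain ⟨d, hd, hdK⟩ := exists_Ico_subset_of_mem_nhds (hK.mem_nhds (h ⟨inf_le_sup, le_rfl⟩))
    ⟨_, lt_add_one _⟩
  refine ⟨c, d, fun x hx ↦ ⟨hc.trans_le hx.1, lt_of_le_of_lt hx.2 hd⟩, fun x hx ↦ ?_⟩
  rcases le_total x (a ⊓ b) with h1 | h1
  · exact hcK ⟨hx.1, h1⟩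
  · rcases le_total x (a ⊔ b) with h2 | h2
    · exact h ⟨h1, h2⟩
    · exact hdK ⟨h2, hx.2⟩

/-! ### The induced flow and its uniqueness, over a Hausdorff boundary. -/

section

variable [T2Space B]

/-- The group property of local flows along the boundary. -/
lemma IsLocalFlow.snd_apply_apply (hΦ : S.IsLocalFlow ξ Φ D) (h : S.IsAsymptoticSymmetry ξ w χ)
    {p : ℝ × B} (hp : p.1 = 0) {t : ℝ} (ht : (t, p) ∈ D) (ht' : (-t, Φ t p) ∈ D) :
    ∀ σ ∈ uIcc 0 (-t), (Φ σ (Φ t p)).2 = (Φ (σ + t) p).2 := by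
  have hp' := hΦ.fst_eq_zero h hp ht
  have hpd := hΦ.mem_dom ht
  have hpd' := hΦ.mem_dom ht'
  have hadd : Continuous (fun σ : ℝ ↦ σ + t) := continuous_id.add continuous_const
  -- The times at which both curves are defined. This set is open and order-connected and contains
  -- `0` and `-t`, so uniqueness for `χ` applies along the whole segment.
  set K : Set ℝ := {σ | (σ, Φ t p) ∈ D} ∩ {σ | (σ + t, p) ∈ D} with hK
  have hKo : IsOpen K := (hΦ.isOpen_times hpd').inter ((hΦ.isOpen_times hpd).preimage hadd)
  have hKc : OrdConnected K := (hΦ.ordConnected_times _).inter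
    ((hΦ.ordConnected_times p).preimage_mono fun a b hab ↦ add_le_add_left hab t)
  have h0K : (0 : ℝ) ∈ K := ⟨hΦ.zero_mem ht', by simpa using ht⟩
  have htK : -t ∈ K := ⟨ht', by simpa using hΦ.zero_mem ht⟩
  obtain ⟨c, d, hcd, hcdK⟩ := exists_Ioo_of_uIcc_subset hKo (hKc.uIcc_subset h0K htK)
  have h1 : IsMIntegralCurveOn (fun σ ↦ (Φ σ (Φ t p)).2) χ (Ioo c d) :=
    (IsMIntegralCurveOn.base h (hΦ.integralCurve (Φ t p)) fun s hs ↦ hΦ.fst_eq_zero h hp' hs).mono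
      fun σ hσ ↦ (hcdK hσ).1
  have h2 : IsMIntegralCurveOn (fun σ ↦ (Φ (σ + t) p).2) χ (Ioo c d) := by
    have h3 := (IsMIntegralCurveOn.base h (hΦ.integralCurve p)
      fun s hs ↦ hΦ.fst_eq_zero h hp hs).comp_add t
    exact h3.mono fun σ hσ ↦ (hcdK hσ).2
  have hχ := h.2.2.1.1
  have : IsManifold (𝓡 n) 1 B := .of_le (n := ∞) (by simp)
  intro σ hσ
  exact isMIntegralCurveOn_Ioo_eqOn_of_contMDiff_boundaryless (I := 𝓡 n) (t₀ := 0) (hcd left_mem_uIcc)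
    ((contMDiffOn_univ.1 hχ).of_le (by simp)) h1 h2
    (by simp only [zero_add, hΦ.zero _ (hΦ.zero_mem ht')]) (hcd hσ)

/-- Pulling back by `Φ_{-t}` turns the coefficient `-∫₀⁻ᵗ w` of the expansion into `+∫₀ᵗ w`, by the
group property along the boundary. Differentiation of `(u + ∫₀ᵗ w, Φ_t y)` gives the lift. -/
lemma IsAsymptoticSymmetry.induces (h : S.IsAsymptoticSymmetry ξ w χ) :
    S.Induces ξ (verticalLift w χ) := by
  refine ⟨h.exists_localFlow, fun Φ D hΦ u y h0 ↦ ?_⟩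
  set p : ℝ × B := (0, y) with hp
  have hp0 : p.1 = 0 := rfl
  have hw := h.2.1.continuous
  have hcont (p : ℝ × B) : ContinuousOn (fun s ↦ w (Φ s p).2) {t | (t, p) ∈ D} := fun s hs ↦
    hw.continuousAt.comp_continuousWithinAt (hΦ.integralCurve p s hs).1.snd
  have hprim {p : ℝ × B} {t : ℝ} (ht : (t, p) ∈ D) :
      HasDerivAt (fun t ↦ ∫ s in (0 : ℝ)..t, w (Φ s p).2) (w (Φ t p).2) t :=
    hasDerivAt_primitive (hΦ.isOpen_times (hΦ.mem_dom ht)) (hΦ.ordConnected_times p) (hΦ.zero_mem ht)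
      (hcont p) ht
  refine ⟨fun t ↦ (u + ∫ s in (0 : ℝ)..t, w (Φ s p).2, (Φ t p).2), ?_, fun t ht ht' ↦ ?_, ?_⟩
  · exact Prod.ext (by simp) (Prod.mk.inj (hΦ.zero p h0)).2
  · have hz := hΦ.fst_eq_zero h hp0 ht
    have hgr := hΦ.snd_apply_apply h hp0 ht ht'
    have hback : Φ (-t) (Φ t p) = p := by
      have h1 := hgr (-t) right_mem_uIcc
      rw [neg_add_cancel, hΦ.zero p h0] at h1
      exact Prod.ext (hΦ.fst_eq_zero h hz ht') h1
    -- The expansion is taken at the image point `Φ t p` for the time `-t`, because the new jet sits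
    -- there and is obtained by composition with `Φ (-t)`.
    have hexp := hΦ.expandsAt h hz (Ω := fun t' ↦ ∫ s in (0 : ℝ)..t', w (Φ s (Φ t p)).2)
      (by simp) (fun s hs ↦ (hprim hs).hasDerivWithinAt) ht'
    have hint : ∫ s in (0 : ℝ)..(-t), w (Φ s (Φ t p)).2 = -∫ s in (0 : ℝ)..t, w (Φ s p).2 := by
      rw [intervalIntegral.integral_congr (g := fun s ↦ w (Φ (s + t) p).2)
        (fun s hs ↦ congrArg w (hgr s hs)),
        intervalIntegral.integral_comp_add_right (fun s ↦ w (Φ s p).2) t, zero_add, neg_add_cancel,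
        intervalIntegral.integral_symm]
    have hpt : Φ t p = (0, (Φ t p).2) := Prod.ext hz rfl
    refine ⟨hpt, ?_⟩
    rw [point_snd, point_snd]
    have htend := hΦ.tendsto_apply ht'
    rw [hback] at htend
    have := hexp.isJetImage hz hback htend (u := u) (v := u + ∫ s in (0 : ℝ)..t, w (Φ s p).2)
      (by simp only [hint]; ring)
    change S.IsJetImage (Φ (-t)) (S.jet p (S.rhoQuad u p)) (S.jet (0, (Φ t p).2)
      (S.rhoQuad (u + ∫ s in (0 : ℝ)..t, w (Φ s p).2) (0, (Φ t p).2)))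
    -- The types of the jets depend on the base point, so it is replaced by a variable before its
    -- first coordinate is set to zero.
    generalize Φ t p = z at hpt this ⊢
    obtain ⟨z₁, z₂⟩ := z
    obtain rfl : z₁ = 0 := congrArg Prod.fst hpt
    exact this
  · intro t ht
    have h1 : HasMFDerivWithinAt 𝓘(ℝ, ℝ) 𝓘(ℝ, ℝ) (fun t ↦ u + ∫ s in (0 : ℝ)..t, w (Φ s p).2)
        {t | (t, p) ∈ D ∧ (-t, Φ t p) ∈ D} t ((1 : ℝ →L[ℝ] ℝ).smulRight (w (Φ t p).2)) :=
      ((hprim ht.1).const_add u).hasDerivWithinAt.hasFDerivWithinAt.hasMFDerivWithinAt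
    have h2 := (IsMIntegralCurveOn.base h (hΦ.integralCurve p)
      fun s hs ↦ hΦ.fst_eq_zero h hp0 hs) t ht.1
    have h3 := h1.prodMk (h2.mono (s := {t | (t, p) ∈ D ∧ (-t, Φ t p) ∈ D}) fun s hs ↦ hs.1)
    exact h3.congr_mfderiv (clm_prod_smulRight (E := ℝ) (F := EuclideanSpace ℝ (Fin n)) _ _)

lemma IsJetImage.coords_eq {Ψ : ℝ × B → ℝ × B} {p : ℝ × B} {j : S.TwoJet p} {c c' : ℝ × B}
    (h₁ : S.IsJetImage Ψ j (S.point c).2.1) (h₂ : S.IsJetImage Ψ j (S.point c').2.1)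
    (h : c.2 = c'.2) : c = c' := by
  obtain ⟨a, b⟩ := c
  obtain ⟨a', b'⟩ := c'
  obtain rfl : b = b' := h
  exact Prod.ext (IsJetImage.unique S h₁ h₂) rfl

/-- For small times the flow on the boundary and the image jet determine both coordinates of the
moving point, hence its velocity at `(u, y)`. Existence of local flows ensures that every point is
tested. -/
lemma eq_of_induces {X Y : Π p : ℝ × B, TangentSpace (lineModel n) p}
    (hX : S.Induces ξ X) (hY : S.Induces ξ Y) : X = Y := by
  funext ⟨u, y⟩
  obtain ⟨Φ, D, hΦ, h0⟩ := hX.1 y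
  obtain ⟨c, hc0, hc, hcX⟩ := hX.2 Φ D hΦ u y h0
  obtain ⟨c', hc0', hc', hcY⟩ := hY.2 Φ D hΦ u y h0
  -- The admissible times form a neighbourhood of `0`, so the derivative within that set is a
  -- genuine derivative and is unique.
  have hT : {t | (t, ((0 : ℝ), y)) ∈ D ∧ (-t, Φ t (0, y)) ∈ D} ∈ 𝓝 (0 : ℝ) := by
    have h1 : D ∈ 𝓝 (0 : ℝ) ×ˢ 𝓝[S.dom] ((0 : ℝ), y) := by
      rw [← hΦ.nhdsWithin_eq h0]; exact self_mem_nhdsWithin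
    have hpd := hΦ.mem_dom h0
    have h2 : Tendsto (fun t : ℝ ↦ (t, ((0 : ℝ), y))) (𝓝 0) (𝓝 (0 : ℝ) ×ˢ 𝓝[S.dom] ((0 : ℝ), y)) :=
      tendsto_id.prodMk (tendsto_const_pure.mono_right (pure_le_nhdsWithin hpd))
    have h3 : Tendsto (fun t : ℝ ↦ (-t, Φ t (0, y))) (𝓝 0)
        (𝓝 (0 : ℝ) ×ˢ 𝓝[S.dom] ((0 : ℝ), y)) := by
      have h4 := (hΦ.tendsto h0).comp h2
      rw [hΦ.zero _ h0] at h4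
      have h5 := (continuous_neg (G := ℝ)).tendsto 0
      rw [neg_zero] at h5
      exact h5.prodMk h4
    exact inter_mem (h2 h1) (h3 h1)
  have heq : c' =ᶠ[𝓝 0] c := by
    filter_upwards [hT] with t ht
    obtain ⟨h1, h2⟩ := hc t ht.1 ht.2
    obtain ⟨h3, h4⟩ := hc' t ht.1 ht.2
    exact h4.coords_eq h2 (Prod.mk.inj (h3.symm.trans h1)).2
  have h1 := ((hcX 0 (mem_of_mem_nhds hT)).hasMFDerivAt hT).congr_of_eventuallyEq heq
  have h2 := (hcY 0 (mem_of_mem_nhds hT)).hasMFDerivAt hT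
  have h3 := smulRight_one_injective (E := ℝ × EuclideanSpace ℝ (Fin n)) (hasMFDerivAt_unique h1 h2)
  have h4 (z : ℝ × B) (hz : c 0 = z) (hz' : c' 0 = z) : X z = Y z := by
    subst hz
    have h5 (z : ℝ × B) (hz : z = c 0) : (show ℝ × EuclideanSpace ℝ (Fin n) from Y z) = Y (c 0) := by
      rw [hz]
    exact Eq.trans h3 (h5 _ hz')
  exact h4 _ hc0 hc0'

end

end AsymptoticallyFlat

/-! ### Construction of asymptotic symmetries -/

namespace AsymptoticallyFlat

variable {kind : InfinityKind} {n : ℕ} {B : Type*} [TopologicalSpace B]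
  [ChartedSpace (EuclideanSpace ℝ (Fin n)) B] [IsManifold (𝓡 n) ∞ B]

/-- All data are realised by asymptotic symmetries. -/
lemma exists_isAsymptoticSymmetry (S : AsymptoticallyFlat kind n B) {w : B → ℝ}
    {χ : Π y : B, TangentSpace (𝓡 n) y} (hw : ContMDiff (𝓡 n) 𝓘(ℝ, ℝ) ∞ w)
    (hχ : IsKilling (𝓡 n) S.h χ) : ∃ ξ, S.IsAsymptoticSymmetry ξ w χ := by
  have : IsManifold (lineModel n) 1 (ℝ × B) := .of_le (n := ∞) (by simp)
  obtain ⟨G, hG⟩ := exists_gradient S.h S.h_nondegenerate w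
  have hGs := hG.smooth S.h_smooth S.h_nondegenerate hw
  have h0 : ContMDiff (𝓡 n) 𝓘(ℝ, ℝ) ∞ (fun _ : B ↦ (0 : ℝ)) := contMDiff_const
  have h1 := smoothFieldOn_univ_iff.1 (smoothFieldOn_verticalLift h0 hχ.1)
  have h2 := smoothFieldOn_univ_iff.1 (smoothFieldOn_verticalLift h0 hGs)
  have h3 := smoothFieldOn_univ_iff.1 (smoothFieldOn_verticalLift hw smoothFieldOn_zero)
  have hρ : ContMDiff (lineModel n) 𝓘(ℝ, ℝ) ∞ (fun p : ℝ × B ↦ p.1) := contMDiff_fst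
  have ha : ContMDiff (lineModel n) 𝓘(ℝ, ℝ) ∞ (fun p : ℝ × B ↦ p.1 * S.ν₀⁻¹) := hρ.mul contMDiff_const
  have hb : ContMDiff (lineModel n) 𝓘(ℝ, ℝ) ∞ (fun p : ℝ × B ↦ -(p.1 ^ 2)) := (hρ.pow 2).neg
  -- The prescribed leading terms themselves, extended with zero remainder.
  let ξ : Π p : ℝ × B, TangentSpace (lineModel n) p := fun p ↦
    (verticalLift (fun _ ↦ 0) χ p + (p.1 * S.ν₀⁻¹) • verticalLift (fun _ ↦ 0) G p) +
      (-(p.1 ^ 2)) • verticalLift w 0 p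
  refine ⟨ξ, ?_, hw, hχ, fun y ↦ ?_, G, hG, fun y ↦ ?_⟩
  · exact ((h1.add_section (ha.smul_section h2)).add_section (hb.smul_section h3)).contMDiffOn
  · refine (isLittleO_zero _ _).congr_left fun p ↦ ?_
    simp only [ξ, verticalLift, lineComp_add, lineComp_smul, lineComp_lineVec]
    ring
  · refine (isLittleO_zero _ _).congr_left fun p ↦ ?_
    simp only [ξ, verticalLift, baseComp_add, baseComp_smul, baseComp_lineVec, Pi.zero_apply,
      smul_zero, add_zero, sub_self]
    exact (map_zero (mfderiv (𝓡 n) 𝓘(ℝ, EuclideanSpace ℝ (Fin n)) (extChartAt (𝓡 n) y) p.2)).symm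

end AsymptoticallyFlat

/-! ### The proposition. -/

theorem mainTheorem4 {kind : InfinityKind} {n : ℕ} {B : Type*} [TopologicalSpace B] [T2Space B]
    [ChartedSpace (EuclideanSpace ℝ (Fin n)) B] [IsManifold (𝓡 n) ∞ B]
    (S : AsymptoticallyFlat kind n B) :
    -- `(u, y)` are global coordinates on the extended boundary, in which `ℝ` acts by translations
    Function.Bijective S.point ∧
    (∀ α u y, S.translate α (S.point (u, y)) = S.point (u + α, y)) ∧
    -- asymptotic symmetries act on the extended boundary, through `w ∂_u + χ`
    (∀ ξ w χ, S.IsAsymptoticSymmetry ξ w χ →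
      S.Induces ξ (verticalLift w χ) ∧ ∀ X, S.Induces ξ X → X = verticalLift w χ) ∧
    -- this is an action of a Lie algebra
    (∀ ξ₁ ξ₂ w₁ w₂ χ₁ χ₂, S.IsAsymptoticSymmetry ξ₁ w₁ χ₁ → S.IsAsymptoticSymmetry ξ₂ w₂ χ₂ →
      (∀ a b : ℝ, S.IsAsymptoticSymmetry (a • ξ₁ + b • ξ₂) (a • w₁ + b • w₂) (a • χ₁ + b • χ₂)) ∧
      ∃ w χ, S.IsAsymptoticSymmetry
          (VectorField.mlieBracketWithin (lineModel n) ξ₁ ξ₂ S.dom) w χ ∧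
        verticalLift w χ =
          VectorField.mlieBracket (lineModel n) (verticalLift w₁ χ₁) (verticalLift w₂ χ₂)) ∧
    -- automorphisms of the weak Carrollian structure
    (∀ X, S.IsCarrollAutomorphism X ↔ ∃ w χ, ContMDiff (𝓡 n) 𝓘(ℝ, ℝ) ∞ w ∧
      IsKilling (𝓡 n) S.h χ ∧ X = verticalLift w χ) ∧
    -- the two algebras of vector fields on the extended boundary coincide
    {X | ∃ ξ ∈ S.asymptoticSymmetries, S.Induces ξ X} = {X | S.IsCarrollAutomorphism X} := by
  refine ⟨S.point_bijective, S.translate_point,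
    fun ξ w χ h ↦ ⟨h.induces, fun X hX ↦ AsymptoticallyFlat.eq_of_induces hX h.induces⟩,
    fun ξ₁ ξ₂ w₁ w₂ χ₁ χ₂ h₁ h₂ ↦ ⟨fun a b ↦ h₁.linear h₂ a b, _, _, h₁.mlieBracketWithin h₂,
      (verticalLift_mlieBracket h₁.2.1 h₁.2.2.1.1 h₂.2.1 h₂.2.2.1.1).symm⟩,
    S.isCarrollAutomorphism_iff, Set.ext fun X ↦ ⟨?_, fun hX ↦ ?_⟩⟩
  -- Uniqueness of the induced field identifies `X` with the lift of the data of `ξ`.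
  · rintro ⟨ξ, ⟨w, χ, h⟩, hX⟩
    exact (S.isCarrollAutomorphism_iff X).2
      ⟨w, χ, h.2.1, h.2.2.1, AsymptoticallyFlat.eq_of_induces hX h.induces⟩
  · obtain ⟨w, χ, hw, hχ, rfl⟩ := (S.isCarrollAutomorphism_iff X).1 hX
    obtain ⟨ξ, h⟩ := S.exists_isAsymptoticSymmetry hw hχ
    exact ⟨ξ, ⟨w, χ, h⟩, h.induces⟩
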